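/- All systems $A,B,\dots$ are finite-dimensional (and nonzero), $\log=\log_2$, $-\log 0=+\infty$, and reference systems $R,R',\dots$ are finite-dimensional of arbitrary dimension. A superchannel is given by two quantum channels $\Theta=(\mathcal E_{C\to AS},\mathcal D_{BS\to D})$ with memory $S$; for a channel $\mathcal N_{AR\to BR'}$ put $\Theta(\mathcal N)=\mathcal D\circ\mathcal N\circ\mathcal E$, a channel $CR\to DR'$. $\Theta^{\otimes n}$ is the superchannel with components $\mathcal E^{\otimes n},\mathcal D^{\otimes n}$. Divergences. For states let $\tilde D_{1/2}(\rho\|\sigma)=-2\log\operatorname{tr}\big[(\sigma^{1/2}\rho\,\sigma^{1/2})^{1/2}\big]=-\log\|\sqrt\rho\sqrt\sigma\|_1^2$ (and $+\infty$ for orthogonal states). Write $D=\tilde D_{1/2}$. For channels, $D(\mathcal N\|\mathcal M)=\sup_{\rho}D((\mathcal N\otimes\mathrm{id}_R)(\rho)\|(\mathcal M\otimes\mathrm{id}_R)(\rho))$ and $D^A(\mathcal N\|\mathcal M)=\sup_{\rho,\tau}\big[D((\mathcal N\otimes\mathrm{id}_R)(\rho)\|(\mathcal M\otimes\mathrm{id}_R)(\tau))-D(\rho\|\tau)\big]$.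 For superchannels $\Theta_i=(\mathcal E_i,\mathcal D_i)$, $i=1,2$, with the same $A,B,C,D$ and possibly different memories, \begin{align*} \tilde D_{1/2}(\Theta_1\|\Theta_2)&=\sup_{\rho_{CR},\,\mathcal N}D(\Theta_1(\mathcal N)(\rho)\|\Theta_2(\mathcal N)(\rho)),\\ \tilde D_{1/2}^{\infty}(\Theta_1\|\Theta_2)&=\lim_{n}\tfrac1n\tilde D_{1/2}(\Theta_1^{\otimes n}\|\Theta_2^{\otimes n}),\\ \tilde D_{1/2}^{s\infty}(\Theta_1\|\Theta_2)&=\lim_n\tfrac1n\sup_{\mathcal N_{AR\to BR'}}D(\Theta_1(\mathcal N)^{\otimes n}\|\Theta_2(\mathcal N)^{\otimes n}),\\ \tilde D_{1/2}^{c\infty}(\Theta_1\|\Theta_2)&=\lim_n\tfrac1n\sup_{\rho_{CR},\,\mathcal N_{A^nR^n\to B^nR'}}D(\Theta_1^{\otimes n}(\mathcal N)(\rho^{\otimes n})\|\Theta_2^{\otimes n}(\mathcal N)(\rho^{\otimes n})),\\ \tilde D_{1/2}^{sA}(\Theta_1\|\Theta_2)&=\sup_{\mathcal N}D^A(\Theta_1(\mathcal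 N)\|\Theta_2(\mathcal N)),\\ \tilde D_{1/2}^{A}(\Theta_1\|\Theta_2)&=\sup_{\mathcal N,\mathcal M}\big[D^A(\Theta_1(\mathcal N)\|\Theta_2(\mathcal M))-D^A(\mathcal N\|\mathcal M)\big],\\ \tilde D_{1/2}^{A^*}(\Theta_1\|\Theta_2)&=\sup_{\mathcal N,\mathcal M,\bar{\mathcal N},\bar{\mathcal M}}\big[D^A(\Theta_1(\mathcal N)\circ\bar{\mathcal N}\|\Theta_2(\mathcal M)\circ\bar{\mathcal M})-D^A(\mathcal N\circ\mathcal E_1\circ\bar{\mathcal N}\|\mathcal M\circ\mathcal E_1\circ\bar{\mathcal M})\big], \end{align*} where $\mathcal N,\mathcal M$ range over channels $AR\to BR'$ and $\bar{\mathcal N},\bar{\mathcal M}$ over channels $X\to CR$, for all $R,R',X$ (suprema of differences are over the choices with finite subtrahend). Strategies. A strategy with $n\ge1$ uses, including a final binary measurement $\{Q_1,Q_2=1-Q_1\}$, yields an output state $\rho_i$ if the superchannel is $\Theta_i$; put $\alpha_n=\operatorname{tr}(Q_2\rho_1)$, $\beta_n=\operatorname{tr}(Q_1\rho_2)$ and,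 for $p\in(0,1)$, $\xi^n(p,\Theta_1,\Theta_2)=\sup-\frac1n\log\big(p\,\alpha_n+(1-p)\beta_n\big)$ over the strategies in the class. The classes and their outputs are: * ($p$, product) $\big(\Theta_i(\mathcal N)(\rho_{CR})\big)^{\otimes n}$; * ($sp$, parallel with product channels) $(\Theta_i(\mathcal N)^{\otimes n}\otimes\mathrm{id}_E)(\rho)$ with an arbitrary joint input state $\rho$ and reference $E$; * ($cp$, parallel with product states) $\Theta_i^{\otimes n}(\mathcal N)(\rho_{CR}^{\otimes n})$ with an arbitrary channel $\mathcal N_{A^nR^n\to B^nR'}$; * ($fp$, parallel) $\Theta_i^{\otimes n}(\mathcal N)(\rho)$ with an arbitrary state $\rho_{C^nR}$ and channel $\mathcal N_{A^nR\to B^nR'}$; * ($sa$, successive adaptive) a channel $\mathcal N$ is fixed and $\Theta_i(\mathcal N)$ is used $n$ times in succession on an initial state, with a memory and with arbitrary channels applied between the uses; * ($na$, nested adaptive) $\mathcal N_n(\rho_{CR})$, where $\mathcal N_1=\Theta_i(\mathcal A_n)$ and $\mathcal N_{j+1}=\Theta_i(\mathcal A_{n-j}\circ\mathcal N_j\circ\mathcal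 A_{n+j})$ for arbitrary channels $\mathcal A_1,\dots,\mathcal A_{2n-1}$; * ($fg$, fully general adaptive) the $n$ copies of $\mathcal E_i$ and the $n$ copies of $\mathcal D_i$ are used in any fixed order in which each copy of $\mathcal E_i$ precedes the $\mathcal D_i$ of the same superchannel, on an initial state, with arbitrary channels, which do not act on the memories $S$, in between. Theorem. The limits that define $\tilde D_{1/2}^{s\infty},\tilde D_{1/2}^{c\infty},\tilde D_{1/2}^{\infty}$ exist as extended real numbers, and for all superchannels $\Theta_1,\Theta_2$, all $p\in(0,1)$ and all $n\ge1$, \begin{align*} \xi_{p}^n(p,\Theta_1,\Theta_2) &\leq -\tfrac1n \log[p(1-p)] + \tilde D_{1/2}(\Theta_1 \| \Theta_2 ), \\ \xi_{sp}^n(p,\Theta_1,\Theta_2) &\leq -\tfrac1n \log[p(1-p)] + \tilde D^{s\infty}_{1/2}(\Theta_1 \| \Theta_2 ), \\ \xi_{cp}^n(p,\Theta_1,\Theta_2) &\leq -\tfrac1n \log[p(1-p)] + \tilde D^{c\infty}_{1/2}(\Theta_1 \| \Theta_2 ), \\ \xi_{fp}^n(p,\Theta_1,\Theta_2) &\leq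 -\tfrac1n \log[p(1-p)] + \tilde D^{\infty}_{1/2}(\Theta_1 \| \Theta_2 ), \\ \xi_{sa}^n(p,\Theta_1,\Theta_2) &\leq -\tfrac1n \log[p(1-p)] + \tilde D^{sA}_{1/2}(\Theta_1 \| \Theta_2 ), \\ \xi_{na}^n(p,\Theta_1,\Theta_2) &\leq -\tfrac1n \log[p(1-p)] + \tilde D^{A}_{1/2}(\Theta_1 \| \Theta_2 ), \\ \xi_{fg}^n(p,\Theta_1,\Theta_2) &\leq -\tfrac1n \log[p(1-p)] + \tilde D^{A^*}_{1/2}(\Theta_1 \| \Theta_2 ). \end{align*} -/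

import Mathlib

namespace QND

/-! Finite-dimensional quantum systems are finite types `X : Type`, the associated Hilbert space is
`ℂ^X`, and the composite of `X` and `Y` is `X × Y`. Logarithms are to base two. -/

section Basics

open scoped ComplexOrder

variable {X Y : Type} [Fintype X] [DecidableEq X] [Fintype Y] [DecidableEq Y]

/-- Linear operators on the system `X`. -/
abbrev Op (X : Type) : Type := Matrix X X ℂ

/-- Linear maps from operators on `X` to operators on `Y`. -/
abbrev SuperOp (X Y : Type) : Type := Op X →ₗ[ℂ] Op Y

/-- Quantum states (density operators) of the system `X`. -/
def IsState (ρ : Op X) : Prop := ρ.PosSemidef ∧ ρ.trace = 1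

/-- The map `Φ ⊗ id_R`. -/
def tensorId (Φ : SuperOp X Y) (R : Type) : SuperOp (X × R) (Y × R) where
  toFun M := Matrix.of fun y y' => Φ (Matrix.of fun x x' => M (x, y.2) (x', y'.2)) y.1 y'.1
  map_add' M N := by
    ext y y'
    exact congrFun₂ (map_add Φ (Matrix.of fun x x' => M (x, y.2) (x', y'.2))
      (Matrix.of fun x x' => N (x, y.2) (x', y'.2))) y.1 y'.1
  map_smul' c M := by
    ext y y'
    exact congrFun₂ (map_smul Φ c (Matrix.of fun x x' => M (x, y.2) (x', y'.2))) y.1 y'.1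

/-- Quantum channels: completely positive and trace-preserving linear maps. -/
def IsChannel (Φ : SuperOp X Y) : Prop :=
  (∀ (k : ℕ) (M : Op (X × Fin k)), M.PosSemidef → (tensorId Φ (Fin k) M).PosSemidef) ∧
    ∀ M : Op X, (Φ M).trace = M.trace

/-- Relabelling of the basis of a system, as a map on operators. -/
def relabel (e : X ≃ Y) : SuperOp X Y := (Matrix.reindexLinearEquiv ℂ ℂ e e).toLinearMap

/-- The map `Φ ⊗ ⋯ ⊗ Φ` (`n` factors); the `n`-fold power of the system `X` is `Fin n → X`. -/
def tensorPow (Φ : SuperOp X Y) (n : ℕ) : SuperOp (Fin n → X) (Fin n → Y) where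
  toFun M := Matrix.of fun y y' => ∑ x : Fin n → X, ∑ x' : Fin n → X,
    M x x' * ∏ i, Φ (Matrix.single (x i) (x' i) 1) (y i) (y' i)
  map_add' M N := by
    ext y y'
    simp only [Matrix.of_apply, Matrix.add_apply, add_mul, Finset.sum_add_distrib]
  map_smul' c M := by
    ext y y'
    simp only [Matrix.of_apply, Matrix.smul_apply, smul_eq_mul, RingHom.id_apply, Finset.mul_sum,
      mul_assoc]

/-- The operator `ρ ⊗ ⋯ ⊗ ρ` (`n` factors). -/
def opPow (ρ : Op X) (n : ℕ) : Op (Fin n → X) := Matrix.of fun x x' => ∏ i, ρ (x i) (x' i)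

/-- `-log₂ t` for `t ≥ 0`, with the value `+∞` at `t = 0`. -/
noncomputable def negLog (t : ℝ) : EReal :=
  if t ≤ 0 then ⊤ else ((-Real.logb 2 t : ℝ) : EReal)

/-- The square root of a positive semidefinite operator. -/
noncomputable def opSqrt (M : Op X) : Op X := cfc Real.sqrt M

/-- The sandwiched Rényi divergence `(1/(α-1)) log tr[(σ^((1-α)/(2α)) ρ σ^((1-α)/(2α)))^α]` at
`α = 1/2`, which is `-2 log tr[(σ^(1/2) ρ σ^(1/2))^(1/2)]`; it is `+∞` for orthogonal states. -/
noncomputable def stateDiv (ρ σ : Op X) : EReal :=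
  if (ρ * σ).trace = 0 then ⊤
  else ((-2 * Real.logb 2 (opSqrt (opSqrt σ * ρ * opSqrt σ)).trace.re : ℝ) : EReal)

/-- The channel divergence `D(Φ‖Ψ) = sup_ρ D((Φ ⊗ id_R)(ρ) ‖ (Ψ ⊗ id_R)(ρ))`. -/
noncomputable def chanDiv (Φ Ψ : SuperOp X Y) : EReal :=
  ⨆ (R : Type) (_ : Fintype R) (_ : DecidableEq R) (ρ : Op (X × R)) (_ : IsState ρ),
    stateDiv (tensorId Φ R ρ) (tensorId Ψ R ρ)

/-- The amortized channel divergence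
`D^A(Φ‖Ψ) = sup_{ρ,τ} D((Φ ⊗ id_R)(ρ) ‖ (Ψ ⊗ id_R)(τ)) - D(ρ‖τ)`. The difference is meaningful
only for finite `D(ρ‖τ)`; the supremum is over these pairs. -/
noncomputable def chanDivA (Φ Ψ : SuperOp X Y) : EReal :=
  ⨆ (R : Type) (_ : Fintype R) (_ : DecidableEq R) (ρ : Op (X × R)) (τ : Op (X × R))
    (_ : IsState ρ) (_ : IsState τ) (_ : stateDiv ρ τ ≠ ⊤),
    stateDiv (tensorId Φ R ρ) (tensorId Ψ R τ) - stateDiv ρ τ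

/-- The best symmetric error exponent that a final binary measurement `{Q, 1 - Q}` achieves for
`n` uses that end in `ρ₁` (first hypothesis, prior `p`) or in `ρ₂` (second hypothesis): the
supremum over `Q` of `-(1/n) log (p α + (1-p) β)`, with `α = tr((1-Q) ρ₁)` and `β = tr(Q ρ₂)`. -/
noncomputable def bestExponent (n : ℕ) (p : ℝ) (ρ₁ ρ₂ : Op X) : EReal :=
  ⨆ (Q : Op X) (_ : Q.PosSemidef) (_ : (1 - Q).PosSemidef),
    ((1 / (n : ℝ) : ℝ) : EReal) *
      negLog (p * ((1 - Q) * ρ₁).trace.re + (1 - p) * (Q * ρ₂).trace.re)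

/-- Interchange of the last two of three systems. -/
def swapLast (X Y Z : Type) : (X × Y) × Z ≃ (X × Z) × Y where
  toFun x := ((x.1.1, x.2), x.1.2)
  invFun x := ((x.1.1, x.2), x.1.2)
  left_inv _ := rfl
  right_inv _ := rfl

/-- Outcome of a successive use of the map `Φ : X → Y` on the initial state `ρ` with memory `M`
and intermediate maps `𝒜 0, 𝒜 1, …`: the value at `k` is the operator after `k + 1` uses
of `Φ`. -/
def seqOutput {M : Type} (Φ : SuperOp X Y) (ρ : Op (X × M)) (𝒜 : ℕ → SuperOp (Y × M) (X × M)) :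
    ℕ → Op (Y × M)
  | 0 => tensorId Φ M ρ
  | k + 1 => tensorId Φ M (𝒜 k (seqOutput Φ ρ 𝒜 k))

end Basics

/-- The data of a superchannel given by `enc : C → A S` and `dec : B S → D`, with
memory `S`. -/
structure Superchannel (C A B D S : Type) where
  enc : SuperOp C (A × S)
  dec : SuperOp (B × S) D

namespace Superchannel

section

variable {C A B D S : Type} [Fintype C] [DecidableEq C] [Fintype A] [DecidableEq A]
  [Fintype B] [DecidableEq B] [Fintype D] [DecidableEq D] [Fintype S] [DecidableEq S]

/-- Both components of a superchannel are quantum channels. -/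
def IsValid (Θ : Superchannel C A B D S) : Prop := IsChannel Θ.enc ∧ IsChannel Θ.dec

/-- The map `N ∘ enc : C R → B R' S`, for `N : A R → B R'`. -/
def applyEnc (Θ : Superchannel C A B D S) {R R' : Type}
    (N : SuperOp (A × R) (B × R')) : SuperOp (C × R) ((B × R') × S) :=
  tensorId N S ∘ₗ relabel (swapLast A S R) ∘ₗ tensorId Θ.enc R

/-- The map `(Θ ⊗ id)(N) = dec ∘ N ∘ enc : C R → D R'`, for `N : A R → B R'`. -/
def apply (Θ : Superchannel C A B D S) {R R' : Type}
    (N : SuperOp (A × R) (B × R')) : SuperOp (C × R) (D × R') :=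
  tensorId Θ.dec R' ∘ₗ relabel (swapLast B R' S) ∘ₗ Θ.applyEnc N

/-- The superchannel `Θ ⊗ ⋯ ⊗ Θ` (`n` factors), from channels `A^n → B^n` to
channels `C^n → D^n`. -/
def pow (Θ : Superchannel C A B D S) (n : ℕ) :
    Superchannel (Fin n → C) (Fin n → A) (Fin n → B) (Fin n → D) (Fin n → S) where
  enc := relabel (Equiv.arrowProdEquivProdArrow (Fin n) (fun _ => A) (fun _ => S)) ∘ₗ
    tensorPow Θ.enc n
  dec := tensorPow Θ.dec n ∘ₗ
    relabel (Equiv.arrowProdEquivProdArrow (Fin n) (fun _ => B) (fun _ => S)).symm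

/-- The channel obtained from `n` nested uses of the superchannel: the value at `0` is `Θ(mid)`,
and the value at `k + 1` is `Θ(post k ∘ N ∘ pre k)` for the value `N` at `k`. -/
def nested (Θ : Superchannel C A B D S) {R : Type} (mid : SuperOp (A × R) (B × R))
    (pre : ℕ → SuperOp (A × R) (C × R)) (post : ℕ → SuperOp (D × R) (B × R)) :
    ℕ → SuperOp (C × R) (D × R)
  | 0 => Θ.apply mid
  | k + 1 => Θ.apply (post k ∘ₗ nested Θ mid pre post k ∘ₗ pre k)

end

end Superchannel

/-! The divergences of two superchannels. The reference systems `R`, `R'` are arbitrary. -/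

section Divergences

variable {C A B D S₁ S₂ : Type} [Fintype C] [DecidableEq C] [Fintype A] [DecidableEq A]
  [Fintype B] [DecidableEq B] [Fintype D] [DecidableEq D] [Fintype S₁] [DecidableEq S₁]
  [Fintype S₂] [DecidableEq S₂]

/-- `D(Θ₁‖Θ₂) = sup_{ρ,N} D(Θ₁(N)(ρ) ‖ Θ₂(N)(ρ))`. -/
noncomputable def superDiv (Θ₁ : Superchannel C A B D S₁) (Θ₂ : Superchannel C A B D S₂) : EReal :=
  ⨆ (R : Type) (_ : Fintype R) (_ : DecidableEq R) (R' : Type) (_ : Fintype R')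
    (_ : DecidableEq R') (N : SuperOp (A × R) (B × R')) (_ : IsChannel N) (ρ : Op (C × R))
    (_ : IsState ρ), stateDiv (Θ₁.apply N ρ) (Θ₂.apply N ρ)

/-- `(1/n) D(Θ₁^{⊗n}‖Θ₂^{⊗n})`. -/
noncomputable def superDivSeq (Θ₁ : Superchannel C A B D S₁) (Θ₂ : Superchannel C A B D S₂)
    (n : ℕ) : EReal :=
  ((1 / (n : ℝ) : ℝ) : EReal) * superDiv (Θ₁.pow n) (Θ₂.pow n)

/-- `(1/n) sup_N D(Θ₁(N)^{⊗n}‖Θ₂(N)^{⊗n})`. -/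
noncomputable def superDivStateSeq (Θ₁ : Superchannel C A B D S₁)
    (Θ₂ : Superchannel C A B D S₂) (n : ℕ) : EReal :=
  ((1 / (n : ℝ) : ℝ) : EReal) *
    ⨆ (R : Type) (_ : Fintype R) (_ : DecidableEq R) (R' : Type) (_ : Fintype R')
      (_ : DecidableEq R') (N : SuperOp (A × R) (B × R')) (_ : IsChannel N),
      chanDiv (tensorPow (Θ₁.apply N) n) (tensorPow (Θ₂.apply N) n)

/-- The output of `n` parallel uses of `Θ`, on the product input `ρ^{⊗n}` and with the joint
channel `N : A^n R^n → B^n R'`. -/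
def productStateOutput {S : Type} [Fintype S] [DecidableEq S] (Θ : Superchannel C A B D S) (n : ℕ)
    {R R' : Type}
    (N : SuperOp ((Fin n → A) × (Fin n → R)) ((Fin n → B) × R')) (ρ : Op (C × R)) :
    Op ((Fin n → D) × R') :=
  (Θ.pow n).apply N
    (relabel (Equiv.arrowProdEquivProdArrow (Fin n) (fun _ => C) (fun _ => R)) (opPow ρ n))

/-- `(1/n) sup_{ρ,N} D(Θ₁^{⊗n}(N)(ρ^{⊗n}) ‖ Θ₂^{⊗n}(N)(ρ^{⊗n}))`. -/
noncomputable def superDivChanSeq (Θ₁ : Superchannel C A B D S₁)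
    (Θ₂ : Superchannel C A B D S₂) (n : ℕ) : EReal :=
  ((1 / (n : ℝ) : ℝ) : EReal) *
    ⨆ (R : Type) (_ : Fintype R) (_ : DecidableEq R) (R' : Type) (_ : Fintype R')
      (_ : DecidableEq R') (N : SuperOp ((Fin n → A) × (Fin n → R)) ((Fin n → B) × R'))
      (_ : IsChannel N) (ρ : Op (C × R)) (_ : IsState ρ),
      stateDiv (productStateOutput Θ₁ n N ρ) (productStateOutput Θ₂ n N ρ)

/-- The regularized divergence: the limit of `superDivSeq`, written as the lower limit (the two
agree whenever the limit exists). -/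
noncomputable def superDivReg (Θ₁ : Superchannel C A B D S₁) (Θ₂ : Superchannel C A B D S₂) :
    EReal := Filter.liminf (superDivSeq Θ₁ Θ₂) Filter.atTop

/-- The state-regularized divergence: the limit of `superDivStateSeq`. -/
noncomputable def superDivStateReg (Θ₁ : Superchannel C A B D S₁)
    (Θ₂ : Superchannel C A B D S₂) : EReal :=
  Filter.liminf (superDivStateSeq Θ₁ Θ₂) Filter.atTop

/-- The channel-regularized divergence: the limit of `superDivChanSeq`. -/
noncomputable def superDivChanReg (Θ₁ : Superchannel C A B D S₁)
    (Θ₂ : Superchannel C A B D S₂) : EReal :=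
  Filter.liminf (superDivChanSeq Θ₁ Θ₂) Filter.atTop

/-- The state-amortized divergence `D^{sA}(Θ₁‖Θ₂) = sup_N D^A(Θ₁(N)‖Θ₂(N))`. -/
noncomputable def superDivStateA (Θ₁ : Superchannel C A B D S₁)
    (Θ₂ : Superchannel C A B D S₂) : EReal :=
  ⨆ (R : Type) (_ : Fintype R) (_ : DecidableEq R) (R' : Type) (_ : Fintype R')
    (_ : DecidableEq R') (N : SuperOp (A × R) (B × R')) (_ : IsChannel N),
    chanDivA (Θ₁.apply N) (Θ₂.apply N)

/-- The amortized divergence `D^A(Θ₁‖Θ₂) = sup_{N,M} D^A(Θ₁(N)‖Θ₂(M)) - D^A(N‖M)`, over the pairs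
with `D^A(N‖M) < ∞`. -/
noncomputable def superDivA (Θ₁ : Superchannel C A B D S₁) (Θ₂ : Superchannel C A B D S₂) :
    EReal :=
  ⨆ (R : Type) (_ : Fintype R) (_ : DecidableEq R) (R' : Type) (_ : Fintype R')
    (_ : DecidableEq R') (N : SuperOp (A × R) (B × R')) (M : SuperOp (A × R) (B × R'))
    (_ : IsChannel N) (_ : IsChannel M) (_ : chanDivA N M ≠ ⊤),
    chanDivA (Θ₁.apply N) (Θ₂.apply M) - chanDivA N M

/-- The fully amortized divergence `D^{A*}(Θ₁‖Θ₂)`: the supremum over channels `N`, `M`, `N'`, `M'`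
of `D^A(Θ₁(N) ∘ N' ‖ Θ₂(M) ∘ M') - D^A(N ∘ enc₁ ∘ N' ‖ M ∘ enc₁ ∘ M')`, over the choices for
which the second term is finite. The first component `enc₁` of `Θ₁` appears twice. -/
noncomputable def superDivAStar (Θ₁ : Superchannel C A B D S₁) (Θ₂ : Superchannel C A B D S₂) :
    EReal :=
  ⨆ (R : Type) (_ : Fintype R) (_ : DecidableEq R) (R' : Type) (_ : Fintype R')
    (_ : DecidableEq R') (X : Type) (_ : Fintype X) (_ : DecidableEq X)
    (N : SuperOp (A × R) (B × R')) (M : SuperOp (A × R) (B × R'))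
    (N' : SuperOp X (C × R)) (M' : SuperOp X (C × R))
    (_ : IsChannel N) (_ : IsChannel M) (_ : IsChannel N') (_ : IsChannel M')
    (_ : chanDivA (Θ₁.applyEnc N ∘ₗ N') (Θ₁.applyEnc M ∘ₗ M') ≠ ⊤),
    chanDivA (Θ₁.apply N ∘ₗ N') (Θ₂.apply M ∘ₗ M')
      - chanDivA (Θ₁.applyEnc N ∘ₗ N') (Θ₁.applyEnc M ∘ₗ M')

end Divergences

/-! Fully general adaptive strategies. -/

/-- `Protocol C A B D m k X`: an adaptive protocol (before the final measurement) that has started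
`m` superchannels, `k` of which are still open (their first component has been used, their second
one has not), and in which the experimenter holds the system `X`. The open copies keep their
memories, which the experimenter cannot touch. -/
inductive Protocol (C A B D : Type) : ℕ → ℕ → Type → Type 1
  /-- Prepare the state `ρ`. -/
  | prepare {X : Type} [Fintype X] [DecidableEq X] (ρ : Op X) (hρ : IsState ρ) :
      Protocol C A B D 0 0 X
  /-- Apply the channel `𝒜 : X → C R` and use the first component of a new superchannel. -/
  | useEnc {m k : ℕ} {X R : Type} [Fintype X] [DecidableEq X] [Fintype R] [DecidableEq R]
      [Fintype C] [DecidableEq C] (P : Protocol C A B D m k X)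
      (𝒜 : SuperOp X (C × R)) (h𝒜 : IsChannel 𝒜) : Protocol C A B D (m + 1) (k + 1) (A × R)
  /-- Apply the channel `𝒜 : X → B R` and use the second component of the `j`-th open
  superchannel, which is then complete. -/
  | useDec {m k : ℕ} {X R : Type} [Fintype X] [DecidableEq X] [Fintype R] [DecidableEq R]
      [Fintype B] [DecidableEq B] (P : Protocol C A B D m (k + 1) X)
      (𝒜 : SuperOp X (B × R)) (h𝒜 : IsChannel 𝒜) (j : Fin (k + 1)) :
      Protocol C A B D m k (D × R)

namespace Protocol

section

variable {C A B D S : Type}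

/-- Regrouping after the first component of a new superchannel has been used: its memory joins
those of the `k` superchannels that were already open. -/
def openEquiv (A R S : Type) (k : ℕ) :
    (A × S) × (R × (Fin k → S)) ≃ (A × R) × (Fin (k + 1) → S) :=
  (Equiv.prodProdProdComm A S R (Fin k → S)).trans
    ((Equiv.refl (A × R)).prodCongr (Fin.insertNthEquiv (fun _ => S) 0))

/-- Regrouping before the second component of the `j`-th open superchannel is used: its memory is
taken out of the list of memories. -/
def closeEquiv (B R S : Type) (k : ℕ) (j : Fin (k + 1)) :
    (B × R) × (Fin (k + 1) → S) ≃ (B × S) × (R × (Fin k → S)) :=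
  ((Equiv.refl (B × R)).prodCongr (Fin.insertNthEquiv (fun _ => S) j).symm).trans
    (Equiv.prodProdProdComm B R S (Fin k → S))

/-- The joint state of the experimenter's system `X` and the memories of the `k` open
superchannels, when the protocol is carried out with `Θ`. -/
def run (Θ : Superchannel C A B D S) {m k : ℕ} {X : Type} :
    Protocol C A B D m k X → Op (X × (Fin k → S))
  | prepare ρ _ => relabel (Equiv.prodUnique _ (Fin 0 → S)).symm ρ
  | @useEnc _ _ _ _ _ k _ R _ _ _ _ _ _ P 𝒜 _ =>
      relabel (openEquiv A R S k)
        (tensorId Θ.enc (R × (Fin k → S))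
          (relabel (Equiv.prodAssoc C R (Fin k → S))
            (tensorId 𝒜 (Fin k → S) (run Θ P))))
  | @useDec _ _ _ _ _ k _ R _ _ _ _ _ _ P 𝒜 _ j =>
      relabel (Equiv.prodAssoc D R (Fin k → S)).symm
        (tensorId Θ.dec (R × (Fin k → S))
          (relabel (closeEquiv B R S k j)
            (tensorId 𝒜 (Fin (k + 1) → S) (run Θ P))))

/-- The final state of a protocol in which every superchannel has been completed. -/
def output (Θ : Superchannel C A B D S) {m : ℕ} {X : Type} (P : Protocol C A B D m 0 X) : Op X :=
  relabel (Equiv.prodUnique X (Fin 0 → S)) (run Θ P)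

end

end Protocol

/-! The non-asymptotic symmetric error exponents `ξ^n(p, Θ₁, Θ₂)`: the supremum of
`-(1/n) log (p α_n + (1-p) β_n)` over the strategies of each class, with `n ≥ 1` uses. -/

section Exponents

variable {C A B D S₁ S₂ : Type} [Fintype C] [DecidableEq C] [Fintype A] [DecidableEq A]
  [Fintype B] [DecidableEq B] [Fintype D] [DecidableEq D] [Fintype S₁] [DecidableEq S₁]
  [Fintype S₂] [DecidableEq S₂]

/-- Product strategies: `n` copies of a state `ρ` and of a channel `N`. -/
noncomputable def xiProduct (n : ℕ) (p : ℝ) (Θ₁ : Superchannel C A B D S₁)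
    (Θ₂ : Superchannel C A B D S₂) : EReal :=
  ⨆ (R : Type) (_ : Fintype R) (_ : DecidableEq R) (R' : Type) (_ : Fintype R')
    (_ : DecidableEq R') (N : SuperOp (A × R) (B × R')) (_ : IsChannel N) (ρ : Op (C × R))
    (_ : IsState ρ), bestExponent n p (opPow (Θ₁.apply N ρ) n) (opPow (Θ₂.apply N ρ) n)

/-- Parallel strategies with product channels: `n` copies of a channel `N`, joint input state. -/
noncomputable def xiParallelProductChannel (n : ℕ) (p : ℝ) (Θ₁ : Superchannel C A B D S₁)
    (Θ₂ : Superchannel C A B D S₂) : EReal :=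
  ⨆ (R : Type) (_ : Fintype R) (_ : DecidableEq R) (R' : Type) (_ : Fintype R')
    (_ : DecidableEq R') (E : Type) (_ : Fintype E) (_ : DecidableEq E)
    (N : SuperOp (A × R) (B × R')) (_ : IsChannel N) (ρ : Op ((Fin n → C × R) × E))
    (_ : IsState ρ), bestExponent n p (tensorId (tensorPow (Θ₁.apply N) n) E ρ)
      (tensorId (tensorPow (Θ₂.apply N) n) E ρ)

/-- Parallel strategies with product states: `n` copies of a state `ρ`, joint channel. -/
noncomputable def xiParallelProductState (n : ℕ) (p : ℝ) (Θ₁ : Superchannel C A B D S₁)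
    (Θ₂ : Superchannel C A B D S₂) : EReal :=
  ⨆ (R : Type) (_ : Fintype R) (_ : DecidableEq R) (R' : Type) (_ : Fintype R')
    (_ : DecidableEq R') (N : SuperOp ((Fin n → A) × (Fin n → R)) ((Fin n → B) × R'))
    (_ : IsChannel N) (ρ : Op (C × R)) (_ : IsState ρ),
    bestExponent n p (productStateOutput Θ₁ n N ρ) (productStateOutput Θ₂ n N ρ)

/-- General parallel strategies: joint channel and joint input state. -/
noncomputable def xiParallel (n : ℕ) (p : ℝ) (Θ₁ : Superchannel C A B D S₁)
    (Θ₂ : Superchannel C A B D S₂) : EReal :=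
  ⨆ (R : Type) (_ : Fintype R) (_ : DecidableEq R) (R' : Type) (_ : Fintype R')
    (_ : DecidableEq R') (N : SuperOp ((Fin n → A) × R) ((Fin n → B) × R')) (_ : IsChannel N)
    (ρ : Op ((Fin n → C) × R)) (_ : IsState ρ),
    bestExponent n p ((Θ₁.pow n).apply N ρ) ((Θ₂.pow n).apply N ρ)

/-- Successive adaptive strategies: a channel `N` is fixed, and the channel `Θ(N)` is used `n`
times, with adaptive channels `𝒜 0, …, 𝒜 (n - 2)` in between. -/
noncomputable def xiSuccessive (n : ℕ) (p : ℝ) (Θ₁ : Superchannel C A B D S₁)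
    (Θ₂ : Superchannel C A B D S₂) : EReal :=
  ⨆ (R : Type) (_ : Fintype R) (_ : DecidableEq R) (R' : Type) (_ : Fintype R')
    (_ : DecidableEq R') (M : Type) (_ : Fintype M) (_ : DecidableEq M)
    (N : SuperOp (A × R) (B × R')) (_ : IsChannel N) (ρ : Op ((C × R) × M)) (_ : IsState ρ)
    (𝒜 : ℕ → SuperOp ((D × R') × M) ((C × R) × M)) (_ : ∀ k, IsChannel (𝒜 k)),
    bestExponent n p (seqOutput (Θ₁.apply N) ρ 𝒜 (n - 1)) (seqOutput (Θ₂.apply N) ρ 𝒜 (n - 1))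

/-- Nested adaptive strategies: an input state `ρ` and `2n - 1` adaptive channels `mid`,
`pre 0, …, pre (n - 2)`, `post 0, …, post (n - 2)`. -/
noncomputable def xiNested (n : ℕ) (p : ℝ) (Θ₁ : Superchannel C A B D S₁)
    (Θ₂ : Superchannel C A B D S₂) : EReal :=
  ⨆ (R : Type) (_ : Fintype R) (_ : DecidableEq R) (ρ : Op (C × R)) (_ : IsState ρ)
    (mid : SuperOp (A × R) (B × R)) (_ : IsChannel mid)
    (pre : ℕ → SuperOp (A × R) (C × R)) (_ : ∀ k, IsChannel (pre k))
    (post : ℕ → SuperOp (D × R) (B × R)) (_ : ∀ k, IsChannel (post k)),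
    bestExponent n p (Θ₁.nested mid pre post (n - 1) ρ) (Θ₂.nested mid pre post (n - 1) ρ)

/-- Fully general adaptive strategies. -/
noncomputable def xiGeneral (n : ℕ) (p : ℝ) (Θ₁ : Superchannel C A B D S₁)
    (Θ₂ : Superchannel C A B D S₂) : EReal :=
  ⨆ (X : Type) (_ : Fintype X) (_ : DecidableEq X) (P : Protocol C A B D n 0 X),
    bestExponent n p (P.output Θ₁) (P.output Θ₂)

end Exponents

end QND

open QND

/-! A test between states with fidelity `F` errs with probability at least `p (1 - p) F ^ 2`, so the
exponent of every strategy is at most `-(1 / n) log (p (1 - p)) + (1 / n) D(ρ₁ ‖ ρ₂)`, where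
`ρ₁, ρ₂` are its output states; it remains to bound `D(ρ₁ ‖ ρ₂)`. The fidelity is multiplicative,
monotone under channels, and has the variational form `max Re tr Z` over the `Z` for which
`[[ρ, Z], [Z†, σ]]` is positive semidefinite.

For the parallel classes, repeating an `n`-copy strategy `k` times and ignoring the remaining copies
shows that the optimal divergences `a` satisfy `k a n ≤ a (k n + r)`; hence `a n / n` converges and
its limit dominates every term.

For the successive and nested classes, an amortized divergence bounds the increase of the
divergence caused by one use of the superchannel. For the fully general class the two superchannels
first get a common memory, and their outputs are compared through hybrid runs in which the
superchannels that have not been completed use the encoder of `Θ₁` on both sides. Then encoding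
steps do not increase the divergence. In a decoding step the superchannel that is completed takes
the form of a comb, and exchanging both its encoder and its decoder costs at most
`superDivAStar Θ₁ Θ₂`. -/

namespace QND

open scoped ComplexOrder Kronecker Matrix

section Coupling

theorem norm_sq_le_of_posSemidef {a b z : ℂ} (h : !![a, z; star z, b].PosSemidef) :
    ‖z‖ ^ 2 ≤ a.re * b.re := by
  have ha : a = a.re := Complex.eq_re_of_ofReal_le (h.diag_nonneg (i := 0))
  have hdet := h.det_nonneg
  rw [Matrix.det_fin_two_of, Complex.star_def, Complex.mul_conj, Complex.normSq_eq_norm_sq, ha]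
    at hdet
  simpa only [Complex.zero_re, Complex.sub_re, Complex.re_ofReal_mul, Complex.ofReal_re,
    sub_nonneg] using (Complex.le_def.1 hdet).1

variable {X : Type} {ρ σ Z e : Op X}

/-- The operators `Z` for which `[[ρ, Z], [Z†, σ]]` is positive semidefinite. The fidelity is the
largest real part of their traces; in this form it is visibly monotone under channels. -/
def IsCoupling (ρ σ Z : Op X) : Prop := (Matrix.fromBlocks ρ Z Zᴴ σ).PosSemidef

theorem IsCoupling.symm (h : IsCoupling ρ σ Z) : IsCoupling σ ρ Zᴴ := by
  convert h.submatrix Sum.swap using 1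
  rw [IsCoupling]
  congr! 1
  ext (i | i) (j | j) <;> simp

theorem IsCoupling.conj [Fintype X] (h : IsCoupling ρ σ Z) (L N : Op X) :
    IsCoupling (L * ρ * Lᴴ) (N * σ * Nᴴ) (L * Z * Nᴴ) := by
  have := h.mul_mul_conjTranspose_same (Matrix.fromBlocks L 0 0 N)
  simpa [IsCoupling, Matrix.fromBlocks_multiply, Matrix.fromBlocks_conjTranspose,
    Matrix.mul_assoc] using this

theorem IsCoupling.norm_trace_sq_le [Fintype X] (h : IsCoupling ρ σ Z) :
    ‖Z.trace‖ ^ 2 ≤ ρ.trace.re * σ.trace.re := by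
  refine norm_sq_le_of_posSemidef ?_
  convert Matrix.posSemidef_sum Finset.univ
    (fun (x : X) _ => h.submatrix ![Sum.inl x, Sum.inr x]) using 1
  ext i j
  rw [Matrix.sum_apply]
  fin_cases i <;> fin_cases j <;> simp [Matrix.trace]

theorem IsCoupling.eq_zero [Finite X] (h : IsCoupling ρ 0 Z) : Z = 0 := by
  classical
  have := Fintype.ofFinite X
  have hle := (h.conj Zᴴ 1).norm_trace_sq_le
  simp only [Matrix.conjTranspose_one, mul_one, Matrix.trace_zero, Complex.zero_re, mul_zero]
    at hle
  exact Matrix.trace_conjTranspose_mul_self_eq_zero_iff.1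
    (norm_eq_zero.1 (pow_eq_zero_iff two_ne_zero |>.1 (le_antisymm hle (sq_nonneg _))))

theorem IsCoupling.mul_eq [Fintype X] (h : IsCoupling ρ σ Z) (he : σ * e = σ) : Z * e = Z := by
  classical
  have hZ := h.conj 1 (1 - e)ᴴ
  rw [Matrix.conjTranspose_conjTranspose, mul_assoc _ σ, mul_sub, mul_one, he, sub_self, mul_zero]
    at hZ
  have h0 := hZ.eq_zero
  rw [one_mul, mul_sub, mul_one, sub_eq_zero] at h0
  exact h0.symm

theorem IsCoupling.mul_eq_left [Fintype X] (h : IsCoupling ρ σ Z) (he : e * ρ = ρ) : e * Z = Z := by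
  have hρ : ρᴴ = ρ := (Matrix.isHermitian_fromBlocks_iff.1 h.1).1
  have h' := h.symm.mul_eq (e := eᴴ) (by rw [← hρ, ← Matrix.conjTranspose_mul, he])
  rw [← Matrix.conjTranspose_mul] at h'
  exact Matrix.conjTranspose_injective h'

theorem isCoupling_one_one [Fintype X] [DecidableEq X] (h : (1 - Zᴴ * Z).PosSemidef) :
    IsCoupling 1 1 Z := by
  have : Invertible (1 : Op X) := invertibleOne
  exact (Matrix.PosDef.fromBlocks₁₁ (A := (1 : Op X)) Z 1 Matrix.PosDef.one).2
    (by rwa [inv_one, mul_one])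

end Coupling

section Fidelity

variable {X : Type} [Fintype X] [DecidableEq X] {M ρ σ Z : Op X}

theorem cfc_mul_cfc (f g : ℝ → ℝ) (M : Op X) : cfc f M * cfc g M = cfc (fun x => f x * g x) M :=
  (cfc_mul f g M (M.finite_real_spectrum.continuousOn f)
    (M.finite_real_spectrum.continuousOn g)).symm

theorem conjTranspose_cfc (f : ℝ → ℝ) (M : Op X) : (cfc f M)ᴴ = cfc f M :=
  (cfc_predicate f M : IsSelfAdjoint _)

open scoped MatrixOrder in
theorem posSemidef_cfc {f : ℝ → ℝ} (hf : ∀ x, 0 ≤ f x) (M : Op X) : (cfc f M).PosSemidef :=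
  Matrix.nonneg_iff_posSemidef.1 (cfc_nonneg fun x _ => hf x)

open scoped MatrixOrder in
theorem cfc_eq_self_of_posSemidef (hM : M.PosSemidef) {f : ℝ → ℝ}
    (hf : ∀ x, 0 ≤ x → f x = x) : cfc f M = M :=
  (cfc_congr fun x hx => hf x (spectrum_nonneg_of_nonneg hM.nonneg hx)).trans
    (cfc_id' ℝ M hM.1.isSelfAdjoint)

theorem opSqrt_posSemidef (M : Op X) : (opSqrt M).PosSemidef :=
  posSemidef_cfc Real.sqrt_nonneg M

theorem conjTranspose_opSqrt (M : Op X) : (opSqrt M)ᴴ = opSqrt M :=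
  conjTranspose_cfc _ M

theorem opSqrt_mul_self (hM : M.PosSemidef) : opSqrt M * opSqrt M = M := by
  rw [opSqrt, cfc_mul_cfc, cfc_eq_self_of_posSemidef hM fun x hx => Real.mul_self_sqrt hx]

theorem opSqrt_mul_self_eq (hM : M.PosSemidef) : opSqrt (M * M) = M := by
  have hMM : M * M = cfc (fun x : ℝ => x * x) M := by
    rw [← cfc_mul_cfc, cfc_id' ℝ M hM.1.isSelfAdjoint]
  rw [opSqrt, hMM, ← cfc_comp (R := ℝ) Real.sqrt (fun x : ℝ => x * x) M hM.1.isSelfAdjoint]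
  exact cfc_eq_self_of_posSemidef hM fun x hx => Real.sqrt_mul_self hx

/-- The inverse square root of a positive semidefinite operator on its support, extended by zero
to its kernel. -/
noncomputable def pinvSqrt (M : Op X) : Op X := cfc (fun x => (√x)⁻¹) M

/-- The orthogonal projection onto the support of a positive semidefinite operator. -/
noncomputable def supportProj (M : Op X) : Op X := cfc (fun x => √x * (√x)⁻¹) M

theorem conjTranspose_pinvSqrt (M : Op X) : (pinvSqrt M)ᴴ = pinvSqrt M :=
  conjTranspose_cfc _ M

theorem opSqrt_mul_pinvSqrt (M : Op X) : opSqrt M * pinvSqrt M = supportProj M :=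
  cfc_mul_cfc _ _ M

theorem pinvSqrt_mul_opSqrt (M : Op X) : pinvSqrt M * opSqrt M = supportProj M := by
  simp only [pinvSqrt, opSqrt, supportProj, cfc_mul_cfc, mul_comm]

theorem opSqrt_mul_supportProj (M : Op X) : opSqrt M * supportProj M = opSqrt M := by
  simp only [opSqrt, supportProj, cfc_mul_cfc, ← mul_assoc, mul_self_mul_inv]

theorem supportProj_mul_opSqrt (M : Op X) : supportProj M * opSqrt M = opSqrt M := by
  simp only [opSqrt, supportProj, cfc_mul_cfc, mul_inv_mul_cancel]

theorem mul_supportProj (hM : M.PosSemidef) : M * supportProj M = M := by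
  nth_rw 1 3 [← opSqrt_mul_self hM]
  rw [mul_assoc, opSqrt_mul_supportProj]

theorem supportProj_mul (hM : M.PosSemidef) : supportProj M * M = M := by
  nth_rw 2 3 [← opSqrt_mul_self hM]
  rw [← mul_assoc, supportProj_mul_opSqrt]

theorem mul_pinvSqrt (hM : M.PosSemidef) : M * pinvSqrt M = opSqrt M := by
  nth_rw 1 [← opSqrt_mul_self hM]
  rw [mul_assoc, opSqrt_mul_pinvSqrt, opSqrt_mul_supportProj]

theorem pinvSqrt_mul (hM : M.PosSemidef) : pinvSqrt M * M = opSqrt M := by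
  nth_rw 2 [← opSqrt_mul_self hM]
  rw [← mul_assoc, pinvSqrt_mul_opSqrt, supportProj_mul_opSqrt]

theorem one_sub_supportProj_posSemidef (hM : M.PosSemidef) : (1 - supportProj M).PosSemidef := by
  rw [← cfc_one ℝ M hM.1.isSelfAdjoint, supportProj,
    ← cfc_sub _ _ _ (M.finite_real_spectrum.continuousOn _) (M.finite_real_spectrum.continuousOn _)]
  exact posSemidef_cfc (fun x => sub_nonneg.2 mul_inv_le_one) M

/-- The square root fidelity `‖√ρ√σ‖₁`. -/
noncomputable def fid (ρ σ : Op X) : ℝ := (opSqrt (opSqrt σ * ρ * opSqrt σ)).trace.re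

theorem fid_nonneg (ρ σ : Op X) : 0 ≤ fid ρ σ :=
  (Complex.le_def.1 (opSqrt_posSemidef _).trace_nonneg).1

theorem opSqrt_mul_mul_opSqrt_posSemidef (hρ : ρ.PosSemidef) (σ : Op X) :
    (opSqrt σ * ρ * opSqrt σ).PosSemidef := by
  simpa only [conjTranspose_opSqrt] using hρ.mul_mul_conjTranspose_same (opSqrt σ)

theorem exists_isCoupling_re_trace_eq_fid (hρ : ρ.PosSemidef) (hσ : σ.PosSemidef) :
    ∃ Z, IsCoupling ρ σ Z ∧ Z.trace.re = fid ρ σ := by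
  set r := opSqrt ρ
  set s := opSqrt σ
  set P := s * ρ * s with hP
  have hPp : P.PosSemidef := opSqrt_mul_mul_opSqrt_posSemidef hρ σ
  have hrr : r * r = ρ := opSqrt_mul_self hρ
  set W := r * s * pinvSqrt P with hW
  have hrW : s * (r * W) = opSqrt P := by
    rw [← mul_pinvSqrt hPp, hW, hP, ← hrr]
    simp only [mul_assoc]
  have hWW : Wᴴ * W = supportProj P := by
    rw [← pinvSqrt_mul_opSqrt, ← hrW]
    nth_rw 1 [hW]
    simp only [Matrix.conjTranspose_mul, conjTranspose_pinvSqrt, conjTranspose_opSqrt, r, s,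
      mul_assoc]
  refine ⟨r * W * s, ?_, ?_⟩
  · have hWc : IsCoupling 1 1 W :=
      isCoupling_one_one (by rw [hWW]; exact one_sub_supportProj_posSemidef hPp)
    simpa only [r, s, conjTranspose_opSqrt, mul_one, opSqrt_mul_self hρ, opSqrt_mul_self hσ]
      using hWc.conj r s
  · rw [Matrix.trace_mul_comm, hrW, fid]

theorem trace_opSqrt_mul_mul_opSqrt (hM : M.PosSemidef) (K : Op X) :
    (opSqrt M * K * opSqrt M).trace = (M * K).trace := by
  rw [Matrix.trace_mul_comm, ← mul_assoc, opSqrt_mul_self hM]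

theorem IsCoupling.trace_conj_eq (h : IsCoupling ρ σ Z) (hρ : ρ.PosSemidef)
    (hσ : σ.PosSemidef) {Q : Op X} (hQ : Q = opSqrt (opSqrt σ * ρ * opSqrt σ)) :
    (pinvSqrt Q * opSqrt σ * Z * (pinvSqrt σ * opSqrt Q)).trace = Z.trace := by
  have hPp := opSqrt_mul_mul_opSqrt_posSemidef hρ σ
  have hQp : Q.PosSemidef := hQ ▸ opSqrt_posSemidef _
  have hQQ : Q * Q = opSqrt σ * ρ * opSqrt σ := by rw [hQ, opSqrt_mul_self hPp]
  have hσZ : supportProj Q * (opSqrt σ * Z) = opSqrt σ * Z := by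
    have hc := h.conj (opSqrt σ) 1
    simp only [Matrix.conjTranspose_one, mul_one, conjTranspose_opSqrt] at hc
    refine hc.mul_eq_left ?_
    rw [← hQQ, ← mul_assoc, supportProj_mul hQp]
  have hZσ : Z * supportProj σ = Z := h.mul_eq (mul_supportProj hσ)
  calc (pinvSqrt Q * opSqrt σ * Z * (pinvSqrt σ * opSqrt Q)).trace
      = (opSqrt Q * pinvSqrt Q * (opSqrt σ * Z) * pinvSqrt σ).trace := by
        rw [← mul_assoc _ (pinvSqrt σ), Matrix.trace_mul_comm]
        simp only [mul_assoc]
    _ = (Z * (pinvSqrt σ * opSqrt σ)).trace := by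
        rw [opSqrt_mul_pinvSqrt, hσZ, mul_assoc, Matrix.trace_mul_comm, mul_assoc]
    _ = Z.trace := by rw [pinvSqrt_mul_opSqrt, hZσ]

theorem IsCoupling.re_trace_le_fid (h : IsCoupling ρ σ Z) (hρ : ρ.PosSemidef)
    (hσ : σ.PosSemidef) : Z.trace.re ≤ fid ρ σ := by
  set s := opSqrt σ with hs
  set t := pinvSqrt σ with ht
  set P := s * ρ * s with hP
  have hPp : P.PosSemidef := opSqrt_mul_mul_opSqrt_posSemidef hρ σ
  set Q := opSqrt P with hQ
  have hQp : Q.PosSemidef := opSqrt_posSemidef P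
  have hQQ : Q * Q = P := opSqrt_mul_self hPp
  -- Cauchy–Schwarz is sharp for the coupling conjugated by `Q^(-1/2) s` and `Q^(1/2) s⁻¹`.
  have key := (h.conj (pinvSqrt Q * s) (opSqrt Q * t)).norm_trace_sq_le
  simp only [Matrix.conjTranspose_mul, conjTranspose_pinvSqrt, conjTranspose_opSqrt, s, t] at key
  rw [← hs, ← ht] at key
  have hρ_trace : (pinvSqrt Q * s * ρ * (s * pinvSqrt Q)).trace = Q.trace := by
    have : pinvSqrt Q * s * ρ * (s * pinvSqrt Q) = pinvSqrt Q * Q * (Q * pinvSqrt Q) := by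
      rw [mul_assoc (pinvSqrt Q) Q, ← mul_assoc Q, hQQ, hP]
      simp only [mul_assoc]
    rw [this, pinvSqrt_mul hQp, mul_pinvSqrt hQp, opSqrt_mul_self hQp]
  have hσ_trace : (opSqrt Q * t * σ * (t * opSqrt Q)).trace = Q.trace := by
    have hQσ : Q * supportProj σ = Q := by
      rw [hQ, ← pinvSqrt_mul hPp, hP]
      simp only [mul_assoc, s, opSqrt_mul_supportProj]
    have : opSqrt Q * t * σ * (t * opSqrt Q) = opSqrt Q * supportProj σ * opSqrt Q := by
      rw [← opSqrt_mul_pinvSqrt, ← pinvSqrt_mul hσ]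
      simp only [t, mul_assoc]
    rw [this, trace_opSqrt_mul_mul_opSqrt hQp, hQσ]
  rw [hρ_trace, hσ_trace, h.trace_conj_eq hρ hσ hQ, ← sq] at key
  exact (Complex.re_le_norm _).trans (le_of_sq_le_sq key (fid_nonneg ρ σ))

end Fidelity

section Channels

variable {X Y Z R : Type}

theorem tensorId_apply (Φ : SuperOp X Y) (R : Type) (M : Op (X × R)) (y y' : Y × R) :
    tensorId Φ R M y y' = Φ (Matrix.of fun x x' => M (x, y.2) (x', y'.2)) y.1 y'.1 := rfl

theorem relabel_apply (e : X ≃ Y) (M : Op X) (y y' : Y) :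
    relabel e M y y' = M (e.symm y) (e.symm y') := rfl

theorem relabel_symm_apply_relabel (e : X ≃ Y) (M : Op X) : relabel e.symm (relabel e M) = M := by
  ext
  simp [relabel_apply]

theorem tensorId_kronecker (Φ : SuperOp X Y) (M : Op X) (N : Op R) :
    tensorId Φ R (M ⊗ₖ N) = Φ M ⊗ₖ N := by
  ext y y'
  have hslice : (Matrix.of fun x x' => (M ⊗ₖ N) (x, y.2) (x', y'.2)) = N y.2 y'.2 • M := by
    ext x x'
    simp [mul_comm]
  rw [tensorId_apply, hslice, map_smul, Matrix.smul_apply, smul_eq_mul, mul_comm,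
    Matrix.kronecker_apply]

theorem superOp_ext_single [Finite X] [DecidableEq X] {Φ Ψ : SuperOp X Y}
    (h : ∀ i j, Φ (Matrix.single i j 1) = Ψ (Matrix.single i j 1)) : Φ = Ψ := by
  refine Matrix.ext_linearMap _ fun i j => ?_
  ext1
  simpa using h i j

theorem superOp_ext_kronecker [Finite X] [Finite Y] {Φ Ψ : SuperOp (X × Y) Z}
    (h : ∀ (M : Op X) (N : Op Y), Φ (M ⊗ₖ N) = Ψ (M ⊗ₖ N)) : Φ = Ψ := by
  classical
  refine superOp_ext_single fun i j => ?_
  have := h (Matrix.single i.1 j.1 1) (Matrix.single i.2 j.2 1)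
  rwa [Matrix.single_kronecker_single, mul_one] at this

/-- The map that discards its input and prepares `τ`. -/
def replacement (X : Type) [Fintype X] (τ : Op Y) : SuperOp X Y :=
  (Matrix.traceLinearMap X ℂ ℂ).smulRight τ

theorem replacement_apply [Fintype X] (τ : Op Y) (M : Op X) : replacement X τ M = M.trace • τ := rfl

theorem tensorId_replacement [Fintype X] (τ : Op Y) (M : Op (X × R)) :
    tensorId (replacement X τ) R M
      = τ ⊗ₖ ∑ x : X, M.submatrix (fun r : R => (x, r)) (fun r => (x, r)) := by
  ext y y'
  rw [tensorId_apply, replacement_apply, Matrix.kronecker_apply, Matrix.sum_apply]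
  simp [Matrix.trace, mul_comm]

variable [Fintype X] [Fintype Y] [Fintype Z]

theorem IsChannel.tensorId_posSemidef [Finite R] {Φ : SuperOp X Y} (hΦ : IsChannel Φ)
    {M : Op (X × R)} (hM : M.PosSemidef) : (tensorId Φ R M).PosSemidef := by
  let e := Finite.equivFin R
  have h := (hΦ.1 _ _ (hM.submatrix (Prod.map id e.symm))).submatrix (Prod.map id e)
  convert h using 1
  ext y y'
  simp only [Matrix.submatrix_apply, tensorId_apply, Prod.map, id, Equiv.symm_apply_apply]

theorem IsChannel.posSemidef {Φ : SuperOp X Y} (hΦ : IsChannel Φ) {M : Op X}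
    (hM : M.PosSemidef) : (Φ M).PosSemidef :=
  (hΦ.tensorId_posSemidef (R := Unit) (hM.submatrix Prod.fst)).submatrix fun y => (y, ())

theorem IsChannel.map_isState {Φ : SuperOp X Y} (hΦ : IsChannel Φ) {ρ : Op X} (hρ : IsState ρ) :
    IsState (Φ ρ) := ⟨hΦ.posSemidef hρ.1, (hΦ.2 ρ).trans hρ.2⟩

theorem IsChannel.comp {Φ : SuperOp X Y} {Ψ : SuperOp Y Z} (hΨ : IsChannel Ψ) (hΦ : IsChannel Φ) :
    IsChannel (Ψ ∘ₗ Φ) :=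
  ⟨fun k _ hM => hΨ.1 k _ (hΦ.1 k _ hM), fun M => (hΨ.2 _).trans (hΦ.2 M)⟩

theorem IsChannel.tensorId {Φ : SuperOp X Y} (hΦ : IsChannel Φ) (R : Type) [Fintype R] :
    IsChannel (tensorId Φ R) := by
  refine ⟨fun k M hM => ?_, fun M => ?_⟩
  · exact (hΦ.tensorId_posSemidef (hM.submatrix (Equiv.prodAssoc X R (Fin k)).symm)).submatrix
      (Equiv.prodAssoc Y R (Fin k))
  · simp only [Matrix.trace, Matrix.diag, Fintype.sum_prod_type_right, tensorId_apply]
    exact Finset.sum_congr rfl fun r _ => hΦ.2 (Matrix.of fun x x' => M (x, r) (x', r))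

theorem isChannel_relabel (e : X ≃ Y) : IsChannel (relabel e) :=
  ⟨fun k _ hM => hM.submatrix fun y : Y × Fin k => (e.symm y.1, y.2),
    fun M => Equiv.sum_comp e.symm fun x => M x x⟩

theorem IsState.relabel {ρ : Op X} (hρ : IsState ρ) (e : X ≃ Y) : IsState (relabel e ρ) :=
  (isChannel_relabel e).map_isState hρ

theorem IsState.kronecker {ρ : Op X} {σ : Op Y} (hρ : IsState ρ) (hσ : IsState σ) :
    IsState (ρ ⊗ₖ σ) :=
  ⟨hρ.1.kronecker hσ.1, by rw [Matrix.trace_kronecker, hρ.2, hσ.2, one_mul]⟩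

theorem isChannel_replacement {τ : Op Y} (hτ : IsState τ) : IsChannel (replacement X τ) := by
  refine ⟨fun k M hM => ?_, fun M => ?_⟩
  · rw [tensorId_replacement]
    exact hτ.1.kronecker (Matrix.posSemidef_sum _ fun x _ => hM.submatrix _)
  · rw [replacement_apply, Matrix.trace_smul, hτ.2, smul_eq_mul, mul_one]

theorem isState_single [DecidableEq X] (x : X) : IsState (Matrix.single x x (1 : ℂ)) := by
  refine ⟨?_, by simp⟩
  rw [← Matrix.diagonal_single]
  exact Matrix.PosSemidef.diagonal (Pi.single_nonneg.2 zero_le_one)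

theorem IsState.nonempty {ρ : Op X} (hρ : IsState ρ) : Nonempty X := by
  by_contra h
  have := not_nonempty_iff.1 h
  simpa [Matrix.trace] using hρ.2

end Channels

section FidelityOfStates

variable {X Y : Type} [Fintype X] [Fintype Y]

theorem IsCoupling.map {ρ σ Z : Op X} (h : IsCoupling ρ σ Z) {Φ : SuperOp X Y}
    (hΦ : IsChannel Φ) : IsCoupling (Φ ρ) (Φ σ) (Φ Z) := by
  -- `fromBlocks` is `Φ ⊗ id` on `X ⊗ ℂ²`, so that complete positivity applies.
  have hblocks : (Matrix.fromBlocks (Φ ρ) (Φ Z) (Φ Zᴴ) (Φ σ)).PosSemidef := by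
    convert (hΦ.1 2 _ (h.submatrix fun x : X × Fin 2 => ![Sum.inl x.1, Sum.inr x.1] x.2)).submatrix
      (Sum.elim (fun y => (y, 0)) (fun y => (y, 1)) : Y ⊕ Y → Y × Fin 2) using 1
    ext (i | i) (j | j) <;> rfl
  have hstar : Φ Zᴴ = (Φ Z)ᴴ := (Matrix.isHermitian_fromBlocks_iff.1 hblocks.1).2.1.symm
  rwa [hstar] at hblocks

variable [DecidableEq X] [DecidableEq Y]

theorem fid_le_fid_map {ρ σ : Op X} (hρ : ρ.PosSemidef) (hσ : σ.PosSemidef) {Φ : SuperOp X Y}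
    (hΦ : IsChannel Φ) : fid ρ σ ≤ fid (Φ ρ) (Φ σ) := by
  obtain ⟨Z, hZ, hF⟩ := exists_isCoupling_re_trace_eq_fid hρ hσ
  rw [← hF, ← hΦ.2 Z]
  exact (hZ.map hΦ).re_trace_le_fid (hΦ.posSemidef hρ) (hΦ.posSemidef hσ)

theorem opSqrt_kronecker {ρ : Op X} {σ : Op Y} (hρ : ρ.PosSemidef) (hσ : σ.PosSemidef) :
    opSqrt (ρ ⊗ₖ σ) = opSqrt ρ ⊗ₖ opSqrt σ := by
  rw [← opSqrt_mul_self_eq ((opSqrt_posSemidef ρ).kronecker (opSqrt_posSemidef σ)),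
    ← Matrix.mul_kronecker_mul, opSqrt_mul_self hρ, opSqrt_mul_self hσ]

theorem ofReal_fid (ρ σ : Op X) :
    (fid ρ σ : ℂ) = (opSqrt (opSqrt σ * ρ * opSqrt σ)).trace :=
  (Complex.eq_re_of_ofReal_le (opSqrt_posSemidef _).trace_nonneg).symm

theorem fid_kronecker {ρ₁ σ₁ : Op X} {ρ₂ σ₂ : Op Y} (hρ₁ : ρ₁.PosSemidef) (hσ₁ : σ₁.PosSemidef)
    (hρ₂ : ρ₂.PosSemidef) (hσ₂ : σ₂.PosSemidef) :
    fid (ρ₁ ⊗ₖ ρ₂) (σ₁ ⊗ₖ σ₂) = fid ρ₁ σ₁ * fid ρ₂ σ₂ := by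
  rw [← Complex.ofReal_inj, Complex.ofReal_mul, ofReal_fid, ofReal_fid, ofReal_fid,
    opSqrt_kronecker hσ₁ hσ₂, ← Matrix.mul_kronecker_mul, ← Matrix.mul_kronecker_mul,
    opSqrt_kronecker (opSqrt_mul_mul_opSqrt_posSemidef hρ₁ _)
      (opSqrt_mul_mul_opSqrt_posSemidef hρ₂ _), Matrix.trace_kronecker]

theorem fid_le_one {ρ σ : Op X} (hρ : IsState ρ) (hσ : IsState σ) : fid ρ σ ≤ 1 := by
  obtain ⟨Z, hZ, hF⟩ := exists_isCoupling_re_trace_eq_fid hρ.1 hσ.1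
  have hZ1 := hZ.norm_trace_sq_le
  rw [hρ.2, hσ.2, Complex.one_re, mul_one, sq_le_one_iff₀ (norm_nonneg _)] at hZ1
  exact hF.symm.trans_le ((Complex.re_le_norm _).trans hZ1)

theorem fid_self {ρ : Op X} (hρ : IsState ρ) : fid ρ ρ = 1 := by
  have hsq : opSqrt ρ * ρ * opSqrt ρ = ρ * ρ := by
    nth_rw 2 4 5 [← opSqrt_mul_self hρ.1]
    simp only [mul_assoc]
  rw [fid, hsq, opSqrt_mul_self_eq hρ.1, hρ.2, Complex.one_re]

theorem fid_eq_zero_iff {ρ σ : Op X} (hρ : ρ.PosSemidef) (hσ : σ.PosSemidef) :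
    fid ρ σ = 0 ↔ (ρ * σ).trace = 0 := by
  have hP := opSqrt_mul_mul_opSqrt_posSemidef hρ σ
  rw [← Complex.ofReal_eq_zero, ofReal_fid, (opSqrt_posSemidef _).trace_eq_zero_iff,
    ← Matrix.trace_conjTranspose_mul_self_eq_zero_iff, conjTranspose_opSqrt, opSqrt_mul_self hP,
    trace_opSqrt_mul_mul_opSqrt hσ, Matrix.trace_mul_comm]

end FidelityOfStates

section StateDivergence

variable {X Y : Type} [Fintype X] [DecidableEq X] [Fintype Y] [DecidableEq Y]

theorem negLog_antitone : Antitone negLog := by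
  intro s t h
  unfold negLog
  split_ifs with ht hs hs
  · exact le_rfl
  · exact absurd (h.trans ht) hs
  · exact le_top
  · exact EReal.coe_le_coe_iff.2
      (neg_le_neg (Real.logb_le_logb_of_le one_lt_two (not_le.1 hs) h))

theorem negLog_of_pos {t : ℝ} (h : 0 < t) : negLog t = ((-Real.logb 2 t : ℝ) : EReal) :=
  if_neg (not_le.2 h)

theorem negLog_zero : negLog 0 = ⊤ := if_pos le_rfl

theorem negLog_one : negLog 1 = 0 := by simp [negLog_of_pos one_pos]

theorem negLog_ne_bot (t : ℝ) : negLog t ≠ ⊥ := by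
  unfold negLog
  split_ifs <;> simp

theorem negLog_mul {s t : ℝ} (hs : 0 ≤ s) (ht : 0 ≤ t) :
    negLog (s * t) = negLog s + negLog t := by
  rcases hs.eq_or_lt with rfl | hs
  · rw [zero_mul, negLog_zero, EReal.top_add_of_ne_bot (negLog_ne_bot _)]
  rcases ht.eq_or_lt with rfl | ht
  · rw [mul_zero, negLog_zero, EReal.add_top_of_ne_bot (negLog_ne_bot _)]
  rw [negLog_of_pos hs, negLog_of_pos ht, negLog_of_pos (mul_pos hs ht),
    Real.logb_mul hs.ne' ht.ne', ← EReal.coe_add, neg_add]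

theorem negLog_nonneg {t : ℝ} (ht : t ≤ 1) : 0 ≤ negLog t :=
  negLog_one.symm.le.trans (negLog_antitone ht)

theorem stateDiv_eq_negLog {ρ σ : Op X} (hρ : ρ.PosSemidef) (hσ : σ.PosSemidef) :
    stateDiv ρ σ = negLog (fid ρ σ ^ 2) := by
  unfold stateDiv
  split_ifs with h
  · rw [(fid_eq_zero_iff hρ hσ).2 h, zero_pow two_ne_zero, negLog_zero]
  · have hpos : 0 < fid ρ σ := (fid_nonneg ρ σ).lt_of_ne' (mt (fid_eq_zero_iff hρ hσ).1 h)
    rw [negLog_of_pos (pow_pos hpos 2), Real.logb_pow, Nat.cast_ofNat, ← neg_mul, fid]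

theorem stateDiv_nonneg {ρ σ : Op X} (hρ : IsState ρ) (hσ : IsState σ) : 0 ≤ stateDiv ρ σ := by
  rw [stateDiv_eq_negLog hρ.1 hσ.1]
  exact negLog_nonneg (pow_le_one₀ (fid_nonneg ρ σ) (fid_le_one hρ hσ))

theorem stateDiv_self {ρ : Op X} (hρ : IsState ρ) : stateDiv ρ ρ = 0 := by
  rw [stateDiv_eq_negLog hρ.1 hρ.1, fid_self hρ, one_pow, negLog_one]

theorem stateDiv_kronecker {ρ₁ σ₁ : Op X} {ρ₂ σ₂ : Op Y} (hρ₁ : ρ₁.PosSemidef)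
    (hσ₁ : σ₁.PosSemidef) (hρ₂ : ρ₂.PosSemidef) (hσ₂ : σ₂.PosSemidef) :
    stateDiv (ρ₁ ⊗ₖ ρ₂) (σ₁ ⊗ₖ σ₂) = stateDiv ρ₁ σ₁ + stateDiv ρ₂ σ₂ := by
  rw [stateDiv_eq_negLog (hρ₁.kronecker hρ₂) (hσ₁.kronecker hσ₂), stateDiv_eq_negLog hρ₁ hσ₁,
    stateDiv_eq_negLog hρ₂ hσ₂, fid_kronecker hρ₁ hσ₁ hρ₂ hσ₂, mul_pow,
    negLog_mul (sq_nonneg _) (sq_nonneg _)]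

theorem stateDiv_map_le {ρ σ : Op X} (hρ : ρ.PosSemidef) (hσ : σ.PosSemidef) {Φ : SuperOp X Y}
    (hΦ : IsChannel Φ) : stateDiv (Φ ρ) (Φ σ) ≤ stateDiv ρ σ := by
  rw [stateDiv_eq_negLog hρ hσ, stateDiv_eq_negLog (hΦ.posSemidef hρ) (hΦ.posSemidef hσ)]
  exact negLog_antitone (pow_le_pow_left₀ (fid_nonneg _ _) (fid_le_fid_map hρ hσ hΦ) 2)

theorem stateDiv_relabel {ρ σ : Op X} (hρ : ρ.PosSemidef) (hσ : σ.PosSemidef) (e : X ≃ Y) :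
    stateDiv (relabel e ρ) (relabel e σ) = stateDiv ρ σ := by
  refine le_antisymm (stateDiv_map_le hρ hσ (isChannel_relabel e)) ?_
  simpa only [relabel_symm_apply_relabel] using
    stateDiv_map_le ((isChannel_relabel e).posSemidef hρ) ((isChannel_relabel e).posSemidef hσ)
      (isChannel_relabel e.symm)

end StateDivergence

section BinaryMeasurement

variable {X : Type} [Fintype X] {ρ σ Z Q : Op X}

theorem re_trace_mul_nonneg {Q M : Op X} (hQ : Q.PosSemidef) (hM : M.PosSemidef) :
    0 ≤ (Q * M).trace.re := by
  classical
  rw [← trace_opSqrt_mul_mul_opSqrt hQ]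
  exact (Complex.le_def.1 (opSqrt_mul_mul_opSqrt_posSemidef hM Q).trace_nonneg).1

theorem IsCoupling.norm_trace_mul_sq_le (h : IsCoupling ρ σ Z) (hQ : Q.PosSemidef) :
    ‖(Q * Z).trace‖ ^ 2 ≤ (Q * ρ).trace.re * (Q * σ).trace.re := by
  classical
  simpa only [conjTranspose_opSqrt, trace_opSqrt_mul_mul_opSqrt hQ] using
    (h.conj (opSqrt Q) (opSqrt Q)).norm_trace_sq_le

variable [DecidableEq X]

theorem re_trace_mul_le_one (hρ : IsState ρ) (hQ : (1 - Q).PosSemidef) :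
    (Q * ρ).trace.re ≤ 1 := by
  have h := re_trace_mul_nonneg hQ hρ.1
  rwa [sub_mul, one_mul, Matrix.trace_sub, Complex.sub_re, hρ.2, Complex.one_re, sub_nonneg] at h

theorem fid_le_sqrt_add_sqrt (hρ : IsState ρ) (hσ : IsState σ) (hQ : Q.PosSemidef)
    (hQ' : (1 - Q).PosSemidef) :
    fid ρ σ ≤ √(((1 - Q) * ρ).trace.re) + √((Q * σ).trace.re) := by
  obtain ⟨Z, hZ, hF⟩ := exists_isCoupling_re_trace_eq_fid hρ.1 hσ.1
  have hsum : Z.trace = ((1 - Q) * Z).trace + (Q * Z).trace := by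
    rw [← Matrix.trace_add, ← add_mul, sub_add_cancel, one_mul]
  have hσ1 : ((1 - Q) * σ).trace.re ≤ 1 := re_trace_mul_le_one hσ (by rwa [sub_sub_cancel])
  rw [← hF, hsum, Complex.add_re]
  refine add_le_add ((Complex.re_le_norm _).trans (Real.le_sqrt_of_sq_le ?_))
    ((Complex.re_le_norm _).trans (Real.le_sqrt_of_sq_le ?_))
  · exact (hZ.norm_trace_mul_sq_le hQ').trans
      (mul_le_of_le_one_right (re_trace_mul_nonneg hQ' hρ.1) hσ1)
  · exact (hZ.norm_trace_mul_sq_le hQ).trans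
      (mul_le_of_le_one_left (re_trace_mul_nonneg hQ hσ.1) (re_trace_mul_le_one hρ hQ'))

theorem mul_fid_sq_le_error (hρ : IsState ρ) (hσ : IsState σ) (hQ : Q.PosSemidef)
    (hQ' : (1 - Q).PosSemidef) {p : ℝ} (hp : 0 ≤ p) (hp' : p ≤ 1) :
    p * (1 - p) * fid ρ σ ^ 2
      ≤ p * ((1 - Q) * ρ).trace.re + (1 - p) * (Q * σ).trace.re := by
  have hF := fid_le_sqrt_add_sqrt hρ hσ hQ hQ'
  have hα := Real.sq_sqrt (re_trace_mul_nonneg hQ' hρ.1)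
  have hβ := Real.sq_sqrt (re_trace_mul_nonneg hQ hσ.1)
  set a := √(((1 - Q) * ρ).trace.re)
  set b := √((Q * σ).trace.re)
  have : 0 ≤ 1 - p := sub_nonneg.2 hp'
  calc p * (1 - p) * fid ρ σ ^ 2 ≤ p * (1 - p) * (a + b) ^ 2 := by
        gcongr
        exact fid_nonneg ρ σ
    _ = p * a ^ 2 + (1 - p) * b ^ 2 - (p * a - (1 - p) * b) ^ 2 := by ring
    _ ≤ p * a ^ 2 + (1 - p) * b ^ 2 := sub_le_self _ (sq_nonneg _)
    _ = p * ((1 - Q) * ρ).trace.re + (1 - p) * (Q * σ).trace.re := by rw [hα, hβ]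

theorem bestExponent_le (hρ : IsState ρ) (hσ : IsState σ) {p : ℝ} (hp : 0 < p) (hp' : p < 1)
    (n : ℕ) :
    bestExponent n p ρ σ ≤ ((-(1 / (n : ℝ)) * Real.logb 2 (p * (1 - p)) : ℝ) : EReal)
      + ((1 / (n : ℝ) : ℝ) : EReal) * stateDiv ρ σ := by
  refine iSup_le fun Q => iSup_le fun hQ => iSup_le fun hQ' => ?_
  have hn : (0 : EReal) ≤ ((1 / (n : ℝ) : ℝ) : EReal) := by
    rw [EReal.coe_nonneg]
    positivity
  have hpp : 0 < p * (1 - p) := mul_pos hp (sub_pos.2 hp')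
  refine (mul_le_mul_of_nonneg_left
    (negLog_antitone (mul_fid_sq_le_error hρ hσ hQ hQ' hp.le hp'.le)) hn).trans ?_
  rw [negLog_mul hpp.le (sq_nonneg _), ← stateDiv_eq_negLog hρ.1 hσ.1,
    EReal.left_distrib_of_nonneg_of_ne_top hn (EReal.coe_ne_top _), negLog_of_pos hpp,
    ← EReal.coe_mul, neg_mul, mul_neg]

end BinaryMeasurement

section TensorMap

variable {X Y Z X₁ X₂ Y₁ Y₂ Z₁ Z₂ R R₁ R₂ : Type}

/-- The map `Φ ⊗ Ψ`. -/
def tensorMap (Φ : SuperOp X₁ Y₁) (Ψ : SuperOp X₂ Y₂) : SuperOp (X₁ × X₂) (Y₁ × Y₂) :=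
  relabel (Equiv.prodComm Y₂ Y₁) ∘ₗ tensorId Ψ Y₁ ∘ₗ relabel (Equiv.prodComm Y₁ X₂) ∘ₗ
    tensorId Φ X₂

theorem relabel_prodComm_kronecker (M : Op X) (N : Op Y) :
    relabel (Equiv.prodComm X Y) (M ⊗ₖ N) = N ⊗ₖ M := by
  ext
  simp [relabel_apply, mul_comm]

theorem tensorMap_kronecker (Φ : SuperOp X₁ Y₁) (Ψ : SuperOp X₂ Y₂) (M : Op X₁) (N : Op X₂) :
    tensorMap Φ Ψ (M ⊗ₖ N) = Φ M ⊗ₖ Ψ N := by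
  simp only [tensorMap, LinearMap.comp_apply, tensorId_kronecker, relabel_prodComm_kronecker]

theorem IsChannel.tensorMap [Fintype X₁] [Fintype X₂] [Fintype Y₁] [Fintype Y₂]
    {Φ : SuperOp X₁ Y₁} {Ψ : SuperOp X₂ Y₂} (hΦ : IsChannel Φ) (hΨ : IsChannel Ψ) :
    IsChannel (tensorMap Φ Ψ) :=
  (isChannel_relabel _).comp ((hΨ.tensorId _).comp ((isChannel_relabel _).comp (hΦ.tensorId _)))

theorem relabel_trans (e : X ≃ Y) (f : Y ≃ Z) : relabel (e.trans f) = relabel f ∘ₗ relabel e := rfl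

theorem relabel_prodCongr_kronecker (e : X₁ ≃ Y₁) (f : X₂ ≃ Y₂) (M : Op X₁) (N : Op X₂) :
    relabel (e.prodCongr f) (M ⊗ₖ N) = relabel e M ⊗ₖ relabel f N := rfl

/-- `Φ` is `Φ₁ ⊗ Φ₂`, up to the identifications `j` and `j'`. -/
def Splits (j : X₁ × X₂ ≃ X) (j' : Y₁ × Y₂ ≃ Y) (Φ : SuperOp X Y) (Φ₁ : SuperOp X₁ Y₁)
    (Φ₂ : SuperOp X₂ Y₂) : Prop :=
  Φ ∘ₗ relabel j = relabel j' ∘ₗ tensorMap Φ₁ Φ₂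

/-- The map that is `Φ₁ ⊗ Φ₂` up to the identifications `j` and `j'`. -/
def joinMap (j : X₁ × X₂ ≃ X) (j' : Y₁ × Y₂ ≃ Y) (Φ₁ : SuperOp X₁ Y₁) (Φ₂ : SuperOp X₂ Y₂) :
    SuperOp X Y := relabel j' ∘ₗ tensorMap Φ₁ Φ₂ ∘ₗ relabel j.symm

/-- The identification `(X₁ × R₁) × (X₂ × R₂) ≃ X × R` for given identifications
`X₁ × X₂ ≃ X` and `R₁ × R₂ ≃ R`. -/
def joinEquiv (j : X₁ × X₂ ≃ X) (e : R₁ × R₂ ≃ R) : (X₁ × R₁) × (X₂ × R₂) ≃ X × R :=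
  (Equiv.prodProdProdComm X₁ R₁ X₂ R₂).trans (j.prodCongr e)

theorem relabel_joinEquiv_kronecker (j : X₁ × X₂ ≃ X) (e : R₁ × R₂ ≃ R) (M₁ : Op X₁) (N₁ : Op R₁)
    (M₂ : Op X₂) (N₂ : Op R₂) : relabel (joinEquiv j e) ((M₁ ⊗ₖ N₁) ⊗ₖ (M₂ ⊗ₖ N₂))
      = relabel j (M₁ ⊗ₖ M₂) ⊗ₖ relabel e (N₁ ⊗ₖ N₂) := by
  ext x x'
  simp only [relabel_apply]
  exact mul_mul_mul_comm _ _ _ _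

variable {j : X₁ × X₂ ≃ X} {j' : Y₁ × Y₂ ≃ Y} {j'' : Z₁ × Z₂ ≃ Z} {Φ : SuperOp X Y}
  {Φ₁ : SuperOp X₁ Y₁} {Φ₂ : SuperOp X₂ Y₂}

theorem Splits.apply_kronecker (h : Splits j j' Φ Φ₁ Φ₂) (M : Op X₁) (N : Op X₂) :
    Φ (relabel j (M ⊗ₖ N)) = relabel j' (Φ₁ M ⊗ₖ Φ₂ N) := by
  rw [← tensorMap_kronecker]
  exact LinearMap.congr_fun h (M ⊗ₖ N)

theorem splits_joinMap (j : X₁ × X₂ ≃ X) (j' : Y₁ × Y₂ ≃ Y) (Φ₁ : SuperOp X₁ Y₁)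
    (Φ₂ : SuperOp X₂ Y₂) : Splits j j' (joinMap j j' Φ₁ Φ₂) Φ₁ Φ₂ := by
  ext1 M
  simp only [joinMap, LinearMap.comp_apply, relabel_symm_apply_relabel]

theorem Splits.eq_joinMap (h : Splits j j' Φ Φ₁ Φ₂) : Φ = joinMap j j' Φ₁ Φ₂ := by
  have hj : relabel j ∘ₗ relabel j.symm = LinearMap.id :=
    LinearMap.ext (relabel_symm_apply_relabel j.symm)
  rw [joinMap, ← LinearMap.comp_assoc, ← h, LinearMap.comp_assoc, hj, LinearMap.comp_id]

theorem isChannel_joinMap [Fintype X] [Fintype Y] [Fintype X₁] [Fintype X₂] [Fintype Y₁]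
    [Fintype Y₂] (j : X₁ × X₂ ≃ X) (j' : Y₁ × Y₂ ≃ Y) (h₁ : IsChannel Φ₁) (h₂ : IsChannel Φ₂) :
    IsChannel (joinMap j j' Φ₁ Φ₂) :=
  (isChannel_relabel _).comp ((h₁.tensorMap h₂).comp (isChannel_relabel _))

variable [Finite X₁] [Finite X₂]

theorem superOp_ext_kronecker₄ [Finite R₁] [Finite R₂]
    {Φ Ψ : SuperOp ((X₁ × R₁) × (X₂ × R₂)) Z}
    (h : ∀ (M₁ : Op X₁) (N₁ : Op R₁) (M₂ : Op X₂) (N₂ : Op R₂),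
      Φ ((M₁ ⊗ₖ N₁) ⊗ₖ (M₂ ⊗ₖ N₂)) = Ψ ((M₁ ⊗ₖ N₁) ⊗ₖ (M₂ ⊗ₖ N₂))) : Φ = Ψ := by
  classical
  refine superOp_ext_single fun i j => ?_
  have := h (Matrix.single i.1.1 j.1.1 1) (Matrix.single i.1.2 j.1.2 1)
    (Matrix.single i.2.1 j.2.1 1) (Matrix.single i.2.2 j.2.2 1)
  simpa only [Matrix.single_kronecker_single, mul_one] using this

theorem tensorMap_comp (Φ : SuperOp X₁ Y₁) (Ψ : SuperOp X₂ Y₂) (Φ' : SuperOp Y₁ Z₁)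
    (Ψ' : SuperOp Y₂ Z₂) :
    tensorMap (Φ' ∘ₗ Φ) (Ψ' ∘ₗ Ψ) = tensorMap Φ' Ψ' ∘ₗ tensorMap Φ Ψ :=
  superOp_ext_kronecker fun M N => by simp only [LinearMap.comp_apply, tensorMap_kronecker]

theorem tensorMap_relabel (e : X₁ ≃ Y₁) (f : X₂ ≃ Y₂) :
    tensorMap (relabel e) (relabel f) = relabel (e.prodCongr f) :=
  superOp_ext_kronecker fun M N => by rw [tensorMap_kronecker, relabel_prodCongr_kronecker]

theorem Splits.comp {Ψ : SuperOp Y Z} {Ψ₁ : SuperOp Y₁ Z₁} {Ψ₂ : SuperOp Y₂ Z₂}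
    (h' : Splits j' j'' Ψ Ψ₁ Ψ₂) (h : Splits j j' Φ Φ₁ Φ₂) :
    Splits j j'' (Ψ ∘ₗ Φ) (Ψ₁ ∘ₗ Φ₁) (Ψ₂ ∘ₗ Φ₂) := by
  unfold Splits at *
  rw [LinearMap.comp_assoc, h, ← LinearMap.comp_assoc, h', tensorMap_comp, LinearMap.comp_assoc]

theorem splits_relabel {e : X ≃ Y} {e₁ : X₁ ≃ Y₁} {e₂ : X₂ ≃ Y₂}
    (h : ∀ x, e (j x) = j' (e₁ x.1, e₂ x.2)) :
    Splits j j' (relabel e) (relabel e₁) (relabel e₂) := by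
  unfold Splits
  rw [tensorMap_relabel, ← relabel_trans, ← relabel_trans]
  exact congrArg relabel (Equiv.ext h)

theorem Splits.tensorId [Finite R₁] [Finite R₂] (h : Splits j j' Φ Φ₁ Φ₂) (e : R₁ × R₂ ≃ R) :
    Splits (joinEquiv j e) (joinEquiv j' e) (tensorId Φ R) (tensorId Φ₁ R₁) (tensorId Φ₂ R₂) :=
  superOp_ext_kronecker₄ fun M₁ N₁ M₂ N₂ => by
    simp only [LinearMap.comp_apply, relabel_joinEquiv_kronecker, tensorId_kronecker,
      tensorMap_kronecker, h.apply_kronecker]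

end TensorMap

section TensorPower

variable {X Y : Type} [Fintype X]

theorem splits_tensorPow [DecidableEq X] (Φ : SuperOp X Y) (m n : ℕ) :
    Splits (Fin.appendEquiv m n) (Fin.appendEquiv m n) (tensorPow Φ (m + n)) (tensorPow Φ m)
      (tensorPow Φ n) := by
  refine superOp_ext_kronecker fun M N => ?_
  rw [LinearMap.comp_apply, LinearMap.comp_apply, tensorMap_kronecker]
  ext y y'
  rw [relabel_apply, Matrix.kronecker_apply]
  simp only [tensorPow, LinearMap.coe_mk, AddHom.coe_mk, Matrix.of_apply]
  simp_rw [← (Fin.appendEquiv (α := X) m n).sum_comp, relabel_apply, Equiv.symm_apply_apply,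
    Fin.prod_univ_add, Fintype.sum_prod_type, Matrix.kronecker_apply, Finset.sum_mul_sum]
  refine Finset.sum_congr rfl fun a _ => Finset.sum_congr rfl fun b _ =>
    Finset.sum_congr rfl fun a' _ => Finset.sum_congr rfl fun b' _ => ?_
  simp only [Fin.appendEquiv, Equiv.coe_fn_mk, Equiv.coe_fn_symm_mk, Fin.append_left,
    Fin.append_right]
  exact mul_mul_mul_comm _ _ _ _

theorem tensorPow_zero [DecidableEq X] (Φ : SuperOp X Y) :
    tensorPow Φ 0 = relabel (Equiv.ofUnique (Fin 0 → X) (Fin 0 → Y)) := by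
  ext1 M
  ext y y'
  simp only [tensorPow, LinearMap.coe_mk, AddHom.coe_mk, Matrix.of_apply, Finset.univ_unique,
    Finset.sum_singleton, Fin.prod_univ_zero, mul_one]
  rfl

theorem tensorPow_one [DecidableEq X] (Φ : SuperOp X Y) :
    tensorPow Φ 1 = relabel (Equiv.funUnique (Fin 1) Y).symm ∘ₗ Φ ∘ₗ
      relabel (Equiv.funUnique (Fin 1) X) := by
  refine superOp_ext_single fun i j => ?_
  have hsingle : relabel (Equiv.funUnique (Fin 1) X) (Matrix.single i j (1 : ℂ))
      = Matrix.single (i 0) (j 0) 1 := by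
    ext x x'
    simp only [relabel_apply, Matrix.single_apply, funext_iff, Fin.forall_fin_one]
    rfl
  ext y y'
  rw [LinearMap.comp_apply, LinearMap.comp_apply, hsingle, relabel_apply]
  simp only [tensorPow, LinearMap.coe_mk, AddHom.coe_mk, Matrix.of_apply, Matrix.single_apply,
    ite_and, ite_mul, one_mul, zero_mul, Finset.sum_ite_eq, Finset.mem_univ, if_true,
    Fin.prod_univ_one, Finset.sum_ite_irrel, Finset.sum_const_zero]
  rfl

theorem IsChannel.tensorPow [DecidableEq X] [Fintype Y] {Φ : SuperOp X Y} (hΦ : IsChannel Φ)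
    (n : ℕ) : IsChannel (tensorPow Φ n) := by
  induction n with
  | zero =>
    rw [tensorPow_zero]
    exact isChannel_relabel _
  | succ n ih =>
    rw [(splits_tensorPow Φ n 1).eq_joinMap, tensorPow_one]
    exact isChannel_joinMap _ _ ih
      ((isChannel_relabel _).comp (hΦ.comp (isChannel_relabel _)))

theorem opPow_add {X : Type} (ρ : Op X) (m n : ℕ) :
    opPow ρ (m + n) = relabel (Fin.appendEquiv m n) (opPow ρ m ⊗ₖ opPow ρ n) := by
  ext x x'
  rw [relabel_apply, Matrix.kronecker_apply]
  simp only [opPow, Matrix.of_apply, Fin.prod_univ_add]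
  rfl

theorem opPow_one {X : Type} (ρ : Op X) :
    opPow ρ 1 = relabel (Equiv.funUnique (Fin 1) X).symm ρ := by
  ext x x'
  simp only [opPow, Matrix.of_apply, Fin.prod_univ_one]
  rfl

theorem isState_opPow_zero (ρ : Op X) : IsState (opPow ρ 0) := by
  classical
  have h : opPow ρ 0 = 1 := by
    ext x x'
    rw [Subsingleton.elim x x']
    simp [opPow]
  exact h ▸ ⟨Matrix.PosSemidef.one, by simp⟩

theorem IsState.opPow {ρ : Op X} (hρ : IsState ρ) (n : ℕ) : IsState (opPow ρ n) := by
  induction n with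
  | zero => exact isState_opPow_zero ρ
  | succ n ih =>
    rw [opPow_add, opPow_one]
    exact (ih.kronecker (hρ.relabel _)).relabel _

theorem stateDiv_opPow [DecidableEq X] {ρ σ : Op X} (hρ : IsState ρ) (hσ : IsState σ) (n : ℕ) :
    stateDiv (opPow ρ n) (opPow σ n) = n * stateDiv ρ σ := by
  induction n with
  | zero =>
    rw [Nat.cast_zero, zero_mul]
    exact stateDiv_self (isState_opPow_zero ρ)
  | succ n ih =>
    have hρn := (hρ.opPow n).1
    have hσn := (hσ.opPow n).1
    have hρ₁ := (hρ.relabel (Equiv.funUnique (Fin 1) X).symm).1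
    have hσ₁ := (hσ.relabel (Equiv.funUnique (Fin 1) X).symm).1
    rw [opPow_add, opPow_add, opPow_one, opPow_one,
      stateDiv_relabel (hρn.kronecker hρ₁) (hσn.kronecker hσ₁),
      stateDiv_kronecker hρn hσn hρ₁ hσ₁, stateDiv_relabel hρ.1 hσ.1, ih, Nat.cast_succ,
      EReal.right_distrib_of_nonneg (by positivity) zero_le_one, one_mul]

end TensorPower

namespace Superchannel

variable {C A B D S : Type}

theorem IsValid.applyEnc [Fintype C] [Fintype A] [Fintype B] [Fintype D] [Fintype S]
    {R R' : Type} [Fintype R] [Fintype R'] {Θ : Superchannel C A B D S} (hΘ : Θ.IsValid)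
    {N : SuperOp (A × R) (B × R')} (hN : IsChannel N) : IsChannel (Θ.applyEnc N) :=
  (hN.tensorId S).comp ((isChannel_relabel _).comp (hΘ.1.tensorId R))

theorem IsValid.apply [Fintype C] [Fintype A] [Fintype B] [Fintype D] [Fintype S]
    {R R' : Type} [Fintype R] [Fintype R'] {Θ : Superchannel C A B D S} (hΘ : Θ.IsValid)
    {N : SuperOp (A × R) (B × R')} (hN : IsChannel N) : IsChannel (Θ.apply N) :=
  (hΘ.2.tensorId R').comp ((isChannel_relabel _).comp (hΘ.applyEnc hN))

variable [Fintype C] [DecidableEq C] [Fintype B] [DecidableEq B] [Fintype S] [DecidableEq S]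

theorem IsValid.pow [Fintype A] [Fintype D] {Θ : Superchannel C A B D S} (hΘ : Θ.IsValid)
    (n : ℕ) : (Θ.pow n).IsValid :=
  ⟨(isChannel_relabel _).comp (hΘ.1.tensorPow n), (hΘ.2.tensorPow n).comp (isChannel_relabel _)⟩

theorem splits_enc_pow [Finite A] (Θ : Superchannel C A B D S) (m n : ℕ) :
    Splits (Fin.appendEquiv m n) (joinEquiv (Fin.appendEquiv m n) (Fin.appendEquiv m n))
      (Θ.pow (m + n)).enc (Θ.pow m).enc (Θ.pow n).enc := by
  refine Splits.comp (splits_relabel ?_) (splits_tensorPow Θ.enc m n)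
  rintro ⟨x, y⟩
  refine Prod.ext ?_ ?_ <;> ext i <;> refine Fin.addCases (fun i => ?_) (fun i => ?_) i <;>
    simp [joinEquiv, Fin.appendEquiv, Equiv.arrowProdEquivProdArrow]

theorem splits_dec_pow (Θ : Superchannel C A B D S) (m n : ℕ) :
    Splits (joinEquiv (Fin.appendEquiv m n) (Fin.appendEquiv m n)) (Fin.appendEquiv m n)
      (Θ.pow (m + n)).dec (Θ.pow m).dec (Θ.pow n).dec := by
  refine Splits.comp (splits_tensorPow Θ.dec m n) (splits_relabel ?_)
  rintro ⟨x, y⟩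
  funext i
  refine Fin.addCases (fun i => ?_) (fun i => ?_) i <;>
    simp [joinEquiv, Fin.appendEquiv, Equiv.arrowProdEquivProdArrow]

end Superchannel

section SplitsApply

variable {C A B D S C₁ A₁ B₁ D₁ S₁ C₂ A₂ B₂ D₂ S₂ R R' R₁ R₁' R₂ R₂' : Type}
  [Finite C₁] [Finite A₁] [Finite B₁] [Finite S₁] [Finite R₁] [Finite R₁']
  [Finite C₂] [Finite A₂] [Finite B₂] [Finite S₂] [Finite R₂] [Finite R₂']

theorem Superchannel.splits_apply {Θ : Superchannel C A B D S} {Θ₁ : Superchannel C₁ A₁ B₁ D₁ S₁}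
    {Θ₂ : Superchannel C₂ A₂ B₂ D₂ S₂} {jC : C₁ × C₂ ≃ C} {jA : A₁ × A₂ ≃ A} {jB : B₁ × B₂ ≃ B}
    {jD : D₁ × D₂ ≃ D} {jS : S₁ × S₂ ≃ S} {e : R₁ × R₂ ≃ R} {e' : R₁' × R₂' ≃ R'}
    (henc : Splits jC (joinEquiv jA jS) Θ.enc Θ₁.enc Θ₂.enc)
    (hdec : Splits (joinEquiv jB jS) jD Θ.dec Θ₁.dec Θ₂.dec)
    {N : SuperOp (A × R) (B × R')} {N₁ : SuperOp (A₁ × R₁) (B₁ × R₁')}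
    {N₂ : SuperOp (A₂ × R₂) (B₂ × R₂')} (hN : Splits (joinEquiv jA e) (joinEquiv jB e') N N₁ N₂) :
    Splits (joinEquiv jC e) (joinEquiv jD e') (Θ.apply N) (Θ₁.apply N₁) (Θ₂.apply N₂) := by
  have hswap : Splits (joinEquiv (joinEquiv jA jS) e) (joinEquiv (joinEquiv jA e) jS)
      (relabel (swapLast A S R)) (relabel (swapLast A₁ S₁ R₁)) (relabel (swapLast A₂ S₂ R₂)) :=
    splits_relabel fun _ => rfl
  have hswap' : Splits (joinEquiv (joinEquiv jB e') jS) (joinEquiv (joinEquiv jB jS) e')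
      (relabel (swapLast B R' S)) (relabel (swapLast B₁ R₁' S₁))
      (relabel (swapLast B₂ R₂' S₂)) :=
    splits_relabel fun _ => rfl
  exact (hdec.tensorId e').comp (hswap'.comp ((hN.tensorId _).comp (hswap.comp (henc.tensorId e))))

end SplitsApply

section ExtendedReals

open Filter Topology

theorem nat_mul_le_of_superadditive {b : ℕ → EReal} (h0 : ∀ n, 0 ≤ b n)
    (hadd : ∀ m n, b m + b n ≤ b (m + n)) (n k r : ℕ) : (k : EReal) * b n ≤ b (k * n + r) := by
  induction k with
  | zero =>
    rw [Nat.cast_zero, zero_mul]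
    exact h0 _
  | succ k ih =>
    rw [Nat.cast_succ, EReal.right_distrib_of_nonneg (by positivity) zero_le_one, one_mul,
      add_one_mul, add_right_comm]
    exact (add_le_add_left ih _).trans (hadd _ _)

/-- The consequence `k a(n) ≤ a(kn + r)` of superadditivity (for nonnegative `a`). It suffices for
the convergence of `a(n)/n`, and pointwise suprema inherit it, while they need not inherit
superadditivity. -/
def MultiplesSuperadditive (a : ℕ → EReal) : Prop :=
  ∀ n k r : ℕ, 1 ≤ n → 1 ≤ k → a n ≤ a (k * n + r) / k

theorem multiplesSuperadditive_of_superadditive {b : ℕ → EReal} (h0 : ∀ n, 0 ≤ b n)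
    (hadd : ∀ m n, b m + b n ≤ b (m + n)) : MultiplesSuperadditive b := fun n k r _ hk => by
  rw [EReal.le_div_iff_mul_le (by exact_mod_cast hk) (EReal.natCast_ne_top _), mul_comm]
  exact nat_mul_le_of_superadditive h0 hadd n k r

theorem MultiplesSuperadditive.iSup {ι : Sort*} {b : ι → ℕ → EReal}
    (h : ∀ i, MultiplesSuperadditive (b i)) : MultiplesSuperadditive fun n => ⨆ i, b i n :=
  fun n k r hn hk => iSup_le fun i => (h i n k r hn hk).trans <|
    EReal.monotone_div_right_of_nonneg (by positivity) (le_iSup (fun i => b i (k * n + r)) i)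

theorem tendsto_nat_div_div_atTop (n : ℕ) :
    Tendsto (fun m : ℕ => ((m / n : ℕ) : ℝ) / m) atTop (𝓝 (1 / n)) := by
  have h := (tendsto_nat_floor_mul_div_atTop (R := ℝ) (a := 1 / n) (by positivity)).comp
    tendsto_natCast_atTop_atTop
  refine h.congr fun m => ?_
  rw [Function.comp_apply, one_div_mul_eq_div, Nat.floor_div_eq_div]

theorem MultiplesSuperadditive.one_div_mul_le_liminf {a : ℕ → EReal}
    (h : MultiplesSuperadditive a) {n : ℕ} (hn : 1 ≤ n) :
    ((1 / (n : ℝ) : ℝ) : EReal) * a n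
      ≤ liminf (fun m : ℕ => ((1 / (m : ℝ) : ℝ) : EReal) * a m) atTop := by
  have hn0 : ((1 / (n : ℝ) : ℝ) : EReal) ≠ 0 := by
    rw [EReal.coe_ne_zero]
    positivity
  have hlim : Tendsto (fun m : ℕ => ((((m / n : ℕ) : ℝ) / m : ℝ) : EReal) * a n) atTop
      (𝓝 (((1 / (n : ℝ) : ℝ) : EReal) * a n)) :=
    EReal.Tendsto.mul (EReal.tendsto_coe.2 (tendsto_nat_div_div_atTop n)) tendsto_const_nhds
      (Or.inl hn0) (Or.inl hn0) (Or.inl (EReal.coe_ne_bot _)) (Or.inl (EReal.coe_ne_top _))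
  rw [← hlim.liminf_eq]
  refine liminf_le_liminf ?_ (by isBoundedDefault) (by isBoundedDefault)
  filter_upwards [eventually_ge_atTop n] with m hm
  have hk : 1 ≤ m / n := (Nat.one_le_div_iff hn).2 hm
  have hdiv : a n * (m / n : ℕ) ≤ a m := by
    rw [← EReal.le_div_iff_mul_le (by exact_mod_cast hk) (EReal.natCast_ne_top _)]
    simpa only [Nat.div_add_mod'] using h n (m / n) (m % n) hn hk
  calc ((((m / n : ℕ) : ℝ) / m : ℝ) : EReal) * a n
      = ((1 / (m : ℝ) : ℝ) : EReal) * (a n * (m / n : ℕ)) := by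
        rw [div_eq_mul_one_div, EReal.coe_mul, EReal.coe_natCast, mul_comm (a n), mul_left_comm,
          mul_assoc]
    _ ≤ ((1 / (m : ℝ) : ℝ) : EReal) * a m :=
        mul_le_mul_of_nonneg_left hdiv (EReal.coe_nonneg.2 (by positivity))

theorem MultiplesSuperadditive.tendsto {a : ℕ → EReal} (h : MultiplesSuperadditive a) :
    Tendsto (fun m : ℕ => ((1 / (m : ℝ) : ℝ) : EReal) * a m) atTop
      (𝓝 (liminf (fun m : ℕ => ((1 / (m : ℝ) : ℝ) : EReal) * a m) atTop)) := by
  refine tendsto_of_le_liminf_of_limsup_le le_rfl (limsup_le_of_le (by isBoundedDefault) ?_)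
  filter_upwards [eventually_ge_atTop 1] with n hn
  exact h.one_div_mul_le_liminf hn

theorem le_succ_mul_of_le_add {δ d d' : EReal} {k : ℕ} (hδ : 0 ≤ δ) (h : d ≠ ⊤ → d' ≤ δ + d)
    (hd : d ≤ k * δ) : d' ≤ ((k + 1 : ℕ) : EReal) * δ := by
  rcases eq_or_ne δ ⊤ with rfl | htop
  · rw [EReal.mul_top_of_pos (by exact_mod_cast Nat.succ_pos k)]
    exact le_top
  · have hk : (k : EReal) * δ ≠ ⊤ := by
      lift δ to ℝ using ⟨htop, (EReal.bot_lt_zero.trans_le hδ).ne'⟩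
      rw [← EReal.coe_natCast, ← EReal.coe_mul]
      exact EReal.coe_ne_top _
    rw [Nat.cast_succ, EReal.right_distrib_of_nonneg (by positivity) zero_le_one, one_mul, add_comm]
    exact (h (ne_top_of_le_ne_top hk hd)).trans (add_le_add_right hd δ)

theorem one_div_mul_le_of_le_mul {n : ℕ} (hn : 1 ≤ n) {d δ : EReal} (h : d ≤ n * δ) :
    ((1 / (n : ℝ) : ℝ) : EReal) * d ≤ δ := by
  have hn0 : (n : ℝ) ≠ 0 := by positivity
  refine (mul_le_mul_of_nonneg_left h (EReal.coe_nonneg.2 (by positivity))).trans_eq ?_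
  rw [← mul_assoc, ← EReal.coe_natCast, ← EReal.coe_mul, one_div_mul_cancel hn0, EReal.coe_one,
    one_mul]

end ExtendedReals

section ChannelDivergence

variable {W X Y Z : Type} [Fintype X]

theorem isState_one_unit : IsState (1 : Op Unit) := ⟨Matrix.PosSemidef.one, by simp⟩

theorem exists_isState (X : Type) [Fintype X] [Nonempty X] : ∃ ρ : Op X, IsState ρ := by
  classical
  exact ⟨_, isState_single (Classical.arbitrary X)⟩

theorem stateDiv_ne_bot [DecidableEq X] (ρ σ : Op X) : stateDiv ρ σ ≠ ⊥ := by
  unfold stateDiv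
  split_ifs
  · exact top_ne_bot
  · exact EReal.coe_ne_bot _

theorem stateDiv_kronecker_one [DecidableEq X] {ρ τ : Op X} (hρ : ρ.PosSemidef)
    (hτ : τ.PosSemidef) : stateDiv (ρ ⊗ₖ (1 : Op Unit)) (τ ⊗ₖ (1 : Op Unit)) = stateDiv ρ τ := by
  rw [stateDiv_kronecker hρ hτ isState_one_unit.1 isState_one_unit.1,
    stateDiv_self isState_one_unit, add_zero]

variable [Fintype Y] [DecidableEq Y]

theorem le_chanDiv (Φ Ψ : SuperOp X Y) {R : Type} [Fintype R] [DecidableEq R] {ρ : Op (X × R)}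
    (hρ : IsState ρ) : stateDiv (tensorId Φ R ρ) (tensorId Ψ R ρ) ≤ chanDiv Φ Ψ :=
  le_iSup_of_le R <| le_iSup_of_le _ <| le_iSup_of_le _ <| le_iSup_of_le ρ <|
    le_iSup_of_le hρ le_rfl

theorem chanDiv_nonneg [Nonempty X] {Φ Ψ : SuperOp X Y} (hΦ : IsChannel Φ) (hΨ : IsChannel Ψ) :
    0 ≤ chanDiv Φ Ψ := by
  obtain ⟨ρ, hρ⟩ := exists_isState (X × Unit)
  exact (stateDiv_nonneg ((hΦ.tensorId _).map_isState hρ)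
    ((hΨ.tensorId _).map_isState hρ)).trans (le_chanDiv Φ Ψ hρ)

variable [DecidableEq X]

theorem stateDiv_tensorId_le_chanDivA_add (Φ Ψ : SuperOp X Y) {R : Type} [Fintype R]
    [DecidableEq R] {ρ τ : Op (X × R)} (hρ : IsState ρ) (hτ : IsState τ)
    (hfin : stateDiv ρ τ ≠ ⊤) :
    stateDiv (tensorId Φ R ρ) (tensorId Ψ R τ) ≤ chanDivA Φ Ψ + stateDiv ρ τ := by
  rw [← EReal.sub_le_iff_le_add (Or.inl (stateDiv_ne_bot ρ τ)) (Or.inl hfin)]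
  exact le_iSup_of_le R <| le_iSup_of_le _ <| le_iSup_of_le _ <| le_iSup_of_le ρ <|
    le_iSup_of_le τ <| le_iSup_of_le hρ <| le_iSup_of_le hτ <| le_iSup_of_le hfin le_rfl

theorem chanDivA_le {Φ Ψ : SuperOp X Y} {c : EReal}
    (h : ∀ (R : Type) [Fintype R] [DecidableEq R] (ρ τ : Op (X × R)), IsState ρ → IsState τ →
      stateDiv ρ τ ≠ ⊤ → stateDiv (tensorId Φ R ρ) (tensorId Ψ R τ) - stateDiv ρ τ ≤ c) :
    chanDivA Φ Ψ ≤ c :=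
  iSup_le fun R => iSup_le fun _ => iSup_le fun _ => iSup_le fun ρ => iSup_le fun τ =>
    iSup_le fun hρ => iSup_le fun hτ => iSup_le fun hfin => h R ρ τ hρ hτ hfin

theorem stateDiv_map_le_chanDivA_add {Φ Ψ : SuperOp X Y} (hΦ : IsChannel Φ) (hΨ : IsChannel Ψ)
    {ρ τ : Op X} (hρ : IsState ρ) (hτ : IsState τ) (hfin : stateDiv ρ τ ≠ ⊤) :
    stateDiv (Φ ρ) (Ψ τ) ≤ chanDivA Φ Ψ + stateDiv ρ τ := by
  rw [← stateDiv_kronecker_one hρ.1 hτ.1] at hfin ⊢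
  rw [← stateDiv_kronecker_one (hΦ.posSemidef hρ.1) (hΨ.posSemidef hτ.1), ← tensorId_kronecker,
    ← tensorId_kronecker]
  exact stateDiv_tensorId_le_chanDivA_add Φ Ψ (hρ.kronecker isState_one_unit)
    (hτ.kronecker isState_one_unit) hfin

theorem stateDiv_map_le_chanDivA {Φ Ψ : SuperOp X Y} (hΦ : IsChannel Φ) (hΨ : IsChannel Ψ)
    {ρ : Op X} (hρ : IsState ρ) : stateDiv (Φ ρ) (Ψ ρ) ≤ chanDivA Φ Ψ := by
  have h := stateDiv_map_le_chanDivA_add hΦ hΨ hρ hρ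
  rw [stateDiv_self hρ, add_zero] at h
  exact h EReal.zero_ne_top

theorem chanDivA_nonneg [Nonempty X] {Φ Ψ : SuperOp X Y} (hΦ : IsChannel Φ)
    (hΨ : IsChannel Ψ) : 0 ≤ chanDivA Φ Ψ := by
  obtain ⟨ρ, hρ⟩ := exists_isState X
  exact (stateDiv_nonneg (hΦ.map_isState hρ) (hΨ.map_isState hρ)).trans
    (stateDiv_map_le_chanDivA hΦ hΨ hρ)

theorem chanDivA_self_le {Φ : SuperOp X Y} (hΦ : IsChannel Φ) : chanDivA Φ Φ ≤ 0 :=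
  chanDivA_le fun R _ _ ρ τ hρ hτ _ => EReal.sub_le_of_le_add <| by
    rw [zero_add]
    exact stateDiv_map_le hρ.1 hτ.1 (hΦ.tensorId R)

theorem chanDivA_comp_le [Fintype W] [DecidableEq W] [Fintype Z] [DecidableEq Z]
    {pre : SuperOp W X} {N M : SuperOp X Y} {post : SuperOp Y Z} (hpre : IsChannel pre)
    (hN : IsChannel N) (hM : IsChannel M) (hpost : IsChannel post) :
    chanDivA (post ∘ₗ N ∘ₗ pre) (post ∘ₗ M ∘ₗ pre) ≤ chanDivA N M := by
  refine chanDivA_le fun R _ _ ρ τ hρ hτ hfin => ?_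
  have hρ' := (hpre.tensorId R).map_isState hρ
  have hτ' := (hpre.tensorId R).map_isState hτ
  have hle_pre := stateDiv_map_le hρ.1 hτ.1 (hpre.tensorId R)
  have hle_post := stateDiv_map_le ((hN.tensorId R).map_isState hρ').1
    ((hM.tensorId R).map_isState hτ').1 (hpost.tensorId R)
  refine (EReal.sub_le_sub hle_post hle_pre).trans (EReal.sub_le_of_le_add ?_)
  exact stateDiv_tensorId_le_chanDivA_add N M hρ' hτ' (ne_top_of_le_ne_top hfin hle_pre)

theorem isState_seqOutput {X Y M : Type} [Fintype X] [Fintype Y] [Fintype M] {Φ : SuperOp X Y}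
    (hΦ : IsChannel Φ) {ρ : Op (X × M)} (hρ : IsState ρ) {𝒜 : ℕ → SuperOp (Y × M) (X × M)}
    (h𝒜 : ∀ k, IsChannel (𝒜 k)) (k : ℕ) : IsState (seqOutput Φ ρ 𝒜 k) := by
  induction k with
  | zero => exact (hΦ.tensorId M).map_isState hρ
  | succ k ih => exact (hΦ.tensorId M).map_isState ((h𝒜 k).map_isState ih)

theorem stateDiv_seqOutput_le {M : Type} [Fintype M] [DecidableEq M] {Φ Ψ : SuperOp X Y}
    (hΦ : IsChannel Φ) (hΨ : IsChannel Ψ) {ρ : Op (X × M)} (hρ : IsState ρ)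
    {𝒜 : ℕ → SuperOp (Y × M) (X × M)} (h𝒜 : ∀ k, IsChannel (𝒜 k)) (k : ℕ) :
    stateDiv (seqOutput Φ ρ 𝒜 k) (seqOutput Ψ ρ 𝒜 k)
      ≤ ((k + 1 : ℕ) : EReal) * chanDivA Φ Ψ := by
  have : Nonempty X := hρ.nonempty.map Prod.fst
  have hnonneg := chanDivA_nonneg hΦ hΨ
  induction k with
  | zero =>
    refine le_succ_mul_of_le_add hnonneg (stateDiv_tensorId_le_chanDivA_add Φ Ψ hρ hρ) ?_
    rw [stateDiv_self hρ, Nat.cast_zero, zero_mul]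
  | succ k ih =>
    have hΦk := isState_seqOutput hΦ hρ h𝒜 k
    have hΨk := isState_seqOutput hΨ hρ h𝒜 k
    exact le_succ_mul_of_le_add hnonneg
      (stateDiv_tensorId_le_chanDivA_add Φ Ψ ((h𝒜 k).map_isState hΦk) ((h𝒜 k).map_isState hΨk))
      ((stateDiv_map_le hΦk.1 hΨk.1 (h𝒜 k)).trans ih)

end ChannelDivergence

section Superadditivity

variable {X Y X₁ X₂ Y₁ Y₂ : Type} [Fintype X₁] [Fintype X₂] [Fintype Y] [DecidableEq Y]
  [Fintype Y₁] [DecidableEq Y₁] [Fintype Y₂] [DecidableEq Y₂]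
  {j : X₁ × X₂ ≃ X} {j' : Y₁ × Y₂ ≃ Y} {Φ Ψ : SuperOp X Y} {Φ₁ Ψ₁ : SuperOp X₁ Y₁}
  {Φ₂ Ψ₂ : SuperOp X₂ Y₂}

theorem Splits.stateDiv_kronecker (hΦ : Splits j j' Φ Φ₁ Φ₂) (hΨ : Splits j j' Ψ Ψ₁ Ψ₂)
    (hΦ₁ : IsChannel Φ₁) (hΦ₂ : IsChannel Φ₂) (hΨ₁ : IsChannel Ψ₁) (hΨ₂ : IsChannel Ψ₂)
    {ρ₁ : Op X₁} {ρ₂ : Op X₂} (hρ₁ : ρ₁.PosSemidef) (hρ₂ : ρ₂.PosSemidef) :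
    stateDiv (Φ (relabel j (ρ₁ ⊗ₖ ρ₂))) (Ψ (relabel j (ρ₁ ⊗ₖ ρ₂)))
      = stateDiv (Φ₁ ρ₁) (Ψ₁ ρ₁) + stateDiv (Φ₂ ρ₂) (Ψ₂ ρ₂) := by
  have h₁ := hΦ₁.posSemidef hρ₁
  have h₂ := hΦ₂.posSemidef hρ₂
  have h₁' := hΨ₁.posSemidef hρ₁
  have h₂' := hΨ₂.posSemidef hρ₂
  rw [hΦ.apply_kronecker, hΨ.apply_kronecker,
    stateDiv_relabel (h₁.kronecker h₂) (h₁'.kronecker h₂'), QND.stateDiv_kronecker h₁ h₁' h₂ h₂']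

variable [Fintype X]

theorem Splits.chanDiv_add_le (hΦ : Splits j j' Φ Φ₁ Φ₂) (hΨ : Splits j j' Ψ Ψ₁ Ψ₂)
    (hΦ₁ : IsChannel Φ₁) (hΦ₂ : IsChannel Φ₂) (hΨ₁ : IsChannel Ψ₁) (hΨ₂ : IsChannel Ψ₂) :
    chanDiv Φ₁ Ψ₁ + chanDiv Φ₂ Ψ₂ ≤ chanDiv Φ Ψ := by
  refine EReal.add_le_of_forall_lt fun d₁ hd₁ d₂ hd₂ => ?_
  simp only [chanDiv, lt_iSup_iff] at hd₁ hd₂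
  obtain ⟨R₁, _, _, ρ₁, hρ₁, hd₁⟩ := hd₁
  obtain ⟨R₂, _, _, ρ₂, hρ₂, hd₂⟩ := hd₂
  refine (add_le_add hd₁.le hd₂.le).trans ?_
  rw [← (hΦ.tensorId (Equiv.refl (R₁ × R₂))).stateDiv_kronecker (hΨ.tensorId _) (hΦ₁.tensorId R₁)
    (hΦ₂.tensorId R₂) (hΨ₁.tensorId R₁) (hΨ₂.tensorId R₂) hρ₁.1 hρ₂.1]
  exact le_chanDiv Φ Ψ ((hρ₁.kronecker hρ₂).relabel _)

theorem multiplesSuperadditive_chanDiv_tensorPow [DecidableEq X] (hΦ : IsChannel Φ)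
    (hΨ : IsChannel Ψ) :
    MultiplesSuperadditive fun n => chanDiv (tensorPow Φ n) (tensorPow Ψ n) := by
  rcases isEmpty_or_nonempty X with hX | hX
  · intro n k r hn _
    refine iSup_le fun R => iSup_le fun _ => iSup_le fun _ => iSup_le fun ρ => iSup_le fun hρ => ?_
    exact (hX.false (hρ.nonempty.some.1 ⟨0, hn⟩)).elim
  · exact multiplesSuperadditive_of_superadditive
      (fun n => chanDiv_nonneg (hΦ.tensorPow n) (hΨ.tensorPow n)) fun m n =>
        (splits_tensorPow Φ m n).chanDiv_add_le (splits_tensorPow Ψ m n) (hΦ.tensorPow m)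
          (hΦ.tensorPow n) (hΨ.tensorPow m) (hΨ.tensorPow n)

end Superadditivity

section Regularization

variable {C A B D S S₁ S₂ : Type} [Fintype C] [Fintype A] [Fintype B] [Fintype D]

theorem opPow_relabel_add {X R : Type} (ρ : Op (X × R)) (m n : ℕ) :
    relabel (Equiv.arrowProdEquivProdArrow (Fin (m + n)) (fun _ => X) (fun _ => R))
        (opPow ρ (m + n))
      = relabel (joinEquiv (Fin.appendEquiv m n) (Fin.appendEquiv m n))
        (relabel (Equiv.arrowProdEquivProdArrow (Fin m) (fun _ => X) (fun _ => R)) (opPow ρ m) ⊗ₖ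
          relabel (Equiv.arrowProdEquivProdArrow (Fin n) (fun _ => X) (fun _ => R))
            (opPow ρ n)) := by
  ext x x'
  simp only [relabel_apply, opPow, Matrix.of_apply, Fin.prod_univ_add]
  rfl

theorem isState_productStateOutput [DecidableEq C] [DecidableEq B] [Fintype S] [DecidableEq S]
    {Θ : Superchannel C A B D S} (hΘ : Θ.IsValid)
    {n : ℕ} {R R' : Type} [Fintype R] [Fintype R']
    {N : SuperOp ((Fin n → A) × (Fin n → R)) ((Fin n → B) × R')} (hN : IsChannel N)
    {ρ : Op (C × R)} (hρ : IsState ρ) : IsState (productStateOutput Θ n N ρ) :=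
  ((hΘ.pow n).apply hN).map_isState ((hρ.opPow n).relabel _)

variable [DecidableEq D]

theorem le_superDiv (Θ₁ : Superchannel C A B D S₁) (Θ₂ : Superchannel C A B D S₂)
    {R R' : Type} [Fintype R] [Fintype R'] [DecidableEq R'] {N : SuperOp (A × R) (B × R')}
    (hN : IsChannel N) {ρ : Op (C × R)} (hρ : IsState ρ) :
    stateDiv (Θ₁.apply N ρ) (Θ₂.apply N ρ) ≤ superDiv Θ₁ Θ₂ :=
  le_iSup_of_le R <| le_iSup_of_le _ <| le_iSup_of_le (Classical.decEq R) <| le_iSup_of_le R' <|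
    le_iSup_of_le _ <| le_iSup_of_le _ <| le_iSup_of_le N <| le_iSup_of_le hN <|
    le_iSup_of_le ρ <| le_iSup_of_le hρ le_rfl

/-- The quantity `sup_N D(Θ₁(N)^{⊗n}‖Θ₂(N)^{⊗n})`, whose regularization is `superDivStateReg`. -/
noncomputable def productChannelDiv [DecidableEq C] (Θ₁ : Superchannel C A B D S₁)
    (Θ₂ : Superchannel C A B D S₂) (n : ℕ) : EReal :=
  ⨆ (R : Type) (_ : Fintype R) (_ : DecidableEq R) (R' : Type) (_ : Fintype R')
    (_ : DecidableEq R') (N : SuperOp (A × R) (B × R')) (_ : IsChannel N),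
    chanDiv (tensorPow (Θ₁.apply N) n) (tensorPow (Θ₂.apply N) n)

theorem le_productChannelDiv [DecidableEq C] (Θ₁ : Superchannel C A B D S₁)
    (Θ₂ : Superchannel C A B D S₂)
    {n : ℕ} {R R' E : Type} [Fintype R] [DecidableEq R] [Fintype R'] [DecidableEq R'] [Fintype E]
    [DecidableEq E] {N : SuperOp (A × R) (B × R')} (hN : IsChannel N)
    {ρ : Op ((Fin n → C × R) × E)} (hρ : IsState ρ) :
    stateDiv (tensorId (tensorPow (Θ₁.apply N) n) E ρ) (tensorId (tensorPow (Θ₂.apply N) n) E ρ)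
      ≤ productChannelDiv Θ₁ Θ₂ n :=
  (le_chanDiv _ _ hρ).trans <| le_iSup_of_le R <| le_iSup_of_le _ <| le_iSup_of_le _ <|
    le_iSup_of_le R' <| le_iSup_of_le _ <| le_iSup_of_le _ <| le_iSup_of_le N <|
    le_iSup_of_le hN le_rfl

variable [Fintype S₁] [Fintype S₂] {Θ₁ : Superchannel C A B D S₁}
  {Θ₂ : Superchannel C A B D S₂}

theorem superDiv_nonneg [Nonempty B] [Nonempty C] (hΘ₁ : Θ₁.IsValid) (hΘ₂ : Θ₂.IsValid) :
    0 ≤ superDiv Θ₁ Θ₂ := by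
  obtain ⟨τ, hτ⟩ := exists_isState (B × Unit)
  obtain ⟨ρ, hρ⟩ := exists_isState (C × Unit)
  have hN : IsChannel (replacement (A × Unit) τ) := isChannel_replacement hτ
  exact (stateDiv_nonneg ((hΘ₁.apply hN).map_isState hρ) ((hΘ₂.apply hN).map_isState hρ)).trans
    (le_superDiv Θ₁ Θ₂ hN hρ)

variable [DecidableEq C]

theorem multiplesSuperadditive_productChannelDiv (hΘ₁ : Θ₁.IsValid) (hΘ₂ : Θ₂.IsValid) :
    MultiplesSuperadditive (productChannelDiv Θ₁ Θ₂) :=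
  .iSup fun _ => .iSup fun _ => .iSup fun _ => .iSup fun _ => .iSup fun _ => .iSup fun _ =>
    .iSup fun _ => .iSup fun hN =>
      multiplesSuperadditive_chanDiv_tensorPow (hΘ₁.apply hN) (hΘ₂.apply hN)

variable [DecidableEq B] [DecidableEq S₁] [DecidableEq S₂]

theorem stateDiv_pow_apply_joinMap (hΘ₁ : Θ₁.IsValid) (hΘ₂ : Θ₂.IsValid) {m n : ℕ}
    {R R' R₁ R₂ R₁' R₂' : Type} [Fintype R₁] [Fintype R₂] [Fintype R'] [DecidableEq R']
    [Fintype R₁'] [DecidableEq R₁'] [Fintype R₂'] [DecidableEq R₂'] (e : R₁ × R₂ ≃ R)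
    (e' : R₁' × R₂' ≃ R') {N₁ : SuperOp ((Fin m → A) × R₁) ((Fin m → B) × R₁')}
    {N₂ : SuperOp ((Fin n → A) × R₂) ((Fin n → B) × R₂')} (hN₁ : IsChannel N₁)
    (hN₂ : IsChannel N₂) {ρ₁ : Op ((Fin m → C) × R₁)} {ρ₂ : Op ((Fin n → C) × R₂)}
    (hρ₁ : IsState ρ₁) (hρ₂ : IsState ρ₂) :
    let N := joinMap (joinEquiv (Fin.appendEquiv m n) e) (joinEquiv (Fin.appendEquiv m n) e') N₁ N₂
    let ρ := relabel (joinEquiv (Fin.appendEquiv m n) e) (ρ₁ ⊗ₖ ρ₂)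
    stateDiv ((Θ₁.pow (m + n)).apply N ρ) ((Θ₂.pow (m + n)).apply N ρ)
      = stateDiv ((Θ₁.pow m).apply N₁ ρ₁) ((Θ₂.pow m).apply N₁ ρ₁)
        + stateDiv ((Θ₁.pow n).apply N₂ ρ₂) ((Θ₂.pow n).apply N₂ ρ₂) := by
  have hN := splits_joinMap (joinEquiv (Fin.appendEquiv m n) e)
    (joinEquiv (Fin.appendEquiv m n) e') N₁ N₂
  have h₁ := Superchannel.splits_apply (Θ₁.splits_enc_pow m n) (Θ₁.splits_dec_pow m n) hN
  have h₂ := Superchannel.splits_apply (Θ₂.splits_enc_pow m n) (Θ₂.splits_dec_pow m n) hN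
  exact h₁.stateDiv_kronecker h₂ ((hΘ₁.pow m).apply hN₁) ((hΘ₁.pow n).apply hN₂)
    ((hΘ₂.pow m).apply hN₁) ((hΘ₂.pow n).apply hN₂) hρ₁.1 hρ₂.1

theorem superDiv_pow_add_le (hΘ₁ : Θ₁.IsValid) (hΘ₂ : Θ₂.IsValid) (m n : ℕ) :
    superDiv (Θ₁.pow m) (Θ₂.pow m) + superDiv (Θ₁.pow n) (Θ₂.pow n)
      ≤ superDiv (Θ₁.pow (m + n)) (Θ₂.pow (m + n)) := by
  refine EReal.add_le_of_forall_lt fun d₁ hd₁ d₂ hd₂ => ?_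
  simp only [superDiv, lt_iSup_iff] at hd₁ hd₂
  obtain ⟨R₁, _, _, R₁', _, _, N₁, hN₁, ρ₁, hρ₁, hd₁⟩ := hd₁
  obtain ⟨R₂, _, _, R₂', _, _, N₂, hN₂, ρ₂, hρ₂, hd₂⟩ := hd₂
  refine (add_le_add hd₁.le hd₂.le).trans ?_
  rw [← stateDiv_pow_apply_joinMap hΘ₁ hΘ₂ (Equiv.refl (R₁ × R₂)) (Equiv.refl (R₁' × R₂')) hN₁ hN₂
    hρ₁ hρ₂]
  exact le_superDiv _ _ (isChannel_joinMap _ _ hN₁ hN₂) ((hρ₁.kronecker hρ₂).relabel _)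

theorem multiplesSuperadditive_superDiv_pow [Nonempty B] [Nonempty C] (hΘ₁ : Θ₁.IsValid)
    (hΘ₂ : Θ₂.IsValid) : MultiplesSuperadditive fun n => superDiv (Θ₁.pow n) (Θ₂.pow n) :=
  multiplesSuperadditive_of_superadditive (fun n => superDiv_nonneg (hΘ₁.pow n) (hΘ₂.pow n))
    (superDiv_pow_add_le hΘ₁ hΘ₂)

/-- The quantity `sup_N D(Θ₁^{⊗n}(N)(ρ^{⊗n})‖Θ₂^{⊗n}(N)(ρ^{⊗n}))` for a fixed state `ρ`. It is
superadditive in `n`, since a joint channel may act as a product of two channels. -/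
noncomputable def fixedStateDiv (Θ₁ : Superchannel C A B D S₁) (Θ₂ : Superchannel C A B D S₂)
    {R : Type} [Fintype R] (ρ : Op (C × R)) (n : ℕ) : EReal :=
  ⨆ (R' : Type) (_ : Fintype R') (_ : DecidableEq R')
    (N : SuperOp ((Fin n → A) × (Fin n → R)) ((Fin n → B) × R')) (_ : IsChannel N),
    stateDiv (productStateOutput Θ₁ n N ρ) (productStateOutput Θ₂ n N ρ)

/-- The supremum over `ρ` of `fixedStateDiv`, in the order in which it appears in
`superDivChanSeq`; its regularization is `superDivChanReg`. -/
noncomputable def productStateDiv (Θ₁ : Superchannel C A B D S₁) (Θ₂ : Superchannel C A B D S₂)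
    (n : ℕ) : EReal :=
  ⨆ (R : Type) (_ : Fintype R) (_ : DecidableEq R) (R' : Type) (_ : Fintype R')
    (_ : DecidableEq R') (N : SuperOp ((Fin n → A) × (Fin n → R)) ((Fin n → B) × R'))
    (_ : IsChannel N) (ρ : Op (C × R)) (_ : IsState ρ),
    stateDiv (productStateOutput Θ₁ n N ρ) (productStateOutput Θ₂ n N ρ)

section FixedState

variable {R R' : Type} [Fintype R] [Fintype R'] [DecidableEq R'] {n : ℕ}
  {N : SuperOp ((Fin n → A) × (Fin n → R)) ((Fin n → B) × R')} {ρ : Op (C × R)}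

theorem le_fixedStateDiv (Θ₁ : Superchannel C A B D S₁) (Θ₂ : Superchannel C A B D S₂)
    (hN : IsChannel N) (ρ : Op (C × R)) :
    stateDiv (productStateOutput Θ₁ n N ρ) (productStateOutput Θ₂ n N ρ)
      ≤ fixedStateDiv Θ₁ Θ₂ ρ n :=
  le_iSup_of_le R' <| le_iSup_of_le _ <| le_iSup_of_le _ <| le_iSup_of_le N <|
    le_iSup_of_le hN le_rfl

theorem le_productStateDiv (Θ₁ : Superchannel C A B D S₁) (Θ₂ : Superchannel C A B D S₂)
    (hN : IsChannel N) (hρ : IsState ρ) :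
    stateDiv (productStateOutput Θ₁ n N ρ) (productStateOutput Θ₂ n N ρ)
      ≤ productStateDiv Θ₁ Θ₂ n :=
  le_iSup_of_le R <| le_iSup_of_le _ <| le_iSup_of_le (Classical.decEq R) <| le_iSup_of_le R' <|
    le_iSup_of_le _ <| le_iSup_of_le _ <| le_iSup_of_le N <| le_iSup_of_le hN <|
    le_iSup_of_le ρ <| le_iSup_of_le hρ le_rfl

end FixedState

variable {R : Type} [Fintype R] {ρ : Op (C × R)}

theorem fixedStateDiv_le_productStateDiv (Θ₁ : Superchannel C A B D S₁)
    (Θ₂ : Superchannel C A B D S₂) (hρ : IsState ρ) (n : ℕ) :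
    fixedStateDiv Θ₁ Θ₂ ρ n ≤ productStateDiv Θ₁ Θ₂ n :=
  iSup_le fun _ => iSup_le fun _ => iSup_le fun _ => iSup_le fun _ => iSup_le fun hN =>
    le_productStateDiv Θ₁ Θ₂ hN hρ

theorem fixedStateDiv_add_le (hΘ₁ : Θ₁.IsValid) (hΘ₂ : Θ₂.IsValid) (hρ : IsState ρ) (m n : ℕ) :
    fixedStateDiv Θ₁ Θ₂ ρ m + fixedStateDiv Θ₁ Θ₂ ρ n ≤ fixedStateDiv Θ₁ Θ₂ ρ (m + n) := by
  refine EReal.add_le_of_forall_lt fun d₁ hd₁ d₂ hd₂ => ?_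
  simp only [fixedStateDiv, lt_iSup_iff] at hd₁ hd₂
  obtain ⟨R₁', _, _, N₁, hN₁, hd₁⟩ := hd₁
  obtain ⟨R₂', _, _, N₂, hN₂, hd₂⟩ := hd₂
  refine (add_le_add hd₁.le hd₂.le).trans ?_
  simp only [productStateOutput]
  rw [← stateDiv_pow_apply_joinMap hΘ₁ hΘ₂ (Fin.appendEquiv m n) (Equiv.refl (R₁' × R₂')) hN₁ hN₂
    ((hρ.opPow m).relabel _) ((hρ.opPow n).relabel _), ← opPow_relabel_add]
  exact le_fixedStateDiv Θ₁ Θ₂ (isChannel_joinMap _ _ hN₁ hN₂) ρ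

theorem fixedStateDiv_nonneg [Nonempty B] (hΘ₁ : Θ₁.IsValid) (hΘ₂ : Θ₂.IsValid) (hρ : IsState ρ)
    (n : ℕ) : 0 ≤ fixedStateDiv Θ₁ Θ₂ ρ n := by
  obtain ⟨τ, hτ⟩ := exists_isState ((Fin n → B) × Unit)
  have hN : IsChannel (replacement ((Fin n → A) × (Fin n → R)) τ) := isChannel_replacement hτ
  exact (stateDiv_nonneg (isState_productStateOutput hΘ₁ hN hρ)
    (isState_productStateOutput hΘ₂ hN hρ)).trans (le_fixedStateDiv Θ₁ Θ₂ hN ρ)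

theorem multiplesSuperadditive_productStateDiv [Nonempty B] (hΘ₁ : Θ₁.IsValid)
    (hΘ₂ : Θ₂.IsValid) : MultiplesSuperadditive (productStateDiv Θ₁ Θ₂) := by
  intro n k r hn hk
  refine iSup_le fun R => iSup_le fun _ => iSup_le fun _ => iSup_le fun R' => iSup_le fun _ =>
    iSup_le fun _ => iSup_le fun N => iSup_le fun hN => iSup_le fun ρ => iSup_le fun hρ => ?_
  have hfixed := multiplesSuperadditive_of_superadditive (fixedStateDiv_nonneg hΘ₁ hΘ₂ hρ)
    (fixedStateDiv_add_le hΘ₁ hΘ₂ hρ)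
  calc stateDiv (productStateOutput Θ₁ n N ρ) (productStateOutput Θ₂ n N ρ)
      ≤ fixedStateDiv Θ₁ Θ₂ ρ n := le_fixedStateDiv Θ₁ Θ₂ hN ρ
    _ ≤ fixedStateDiv Θ₁ Θ₂ ρ (k * n + r) / k := hfixed n k r hn hk
    _ ≤ productStateDiv Θ₁ Θ₂ (k * n + r) / k :=
        EReal.monotone_div_right_of_nonneg (by positivity)
          (fixedStateDiv_le_productStateDiv Θ₁ Θ₂ hρ _)

end Regularization

section Nested

variable {C A B D S₁ S₂ : Type} [Fintype C] [Fintype A] [Fintype B] [Fintype D]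

theorem chanDivA_apply_le_superDivA_add [DecidableEq C] [DecidableEq A] [DecidableEq B]
    [DecidableEq D] (Θ₁ : Superchannel C A B D S₁) (Θ₂ : Superchannel C A B D S₂)
    {R R' : Type} [Fintype R] [DecidableEq R]
    [Fintype R'] [DecidableEq R'] [Nonempty (A × R)]
    {N M : SuperOp (A × R) (B × R')} (hN : IsChannel N) (hM : IsChannel M)
    (hfin : chanDivA N M ≠ ⊤) :
    chanDivA (Θ₁.apply N) (Θ₂.apply M) ≤ superDivA Θ₁ Θ₂ + chanDivA N M := by
  have hbot : chanDivA N M ≠ ⊥ := (EReal.bot_lt_zero.trans_le (chanDivA_nonneg hN hM)).ne'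
  rw [← EReal.sub_le_iff_le_add (Or.inl hbot) (Or.inl hfin)]
  exact le_iSup_of_le R <| le_iSup_of_le _ <| le_iSup_of_le _ <| le_iSup_of_le R' <|
    le_iSup_of_le _ <| le_iSup_of_le _ <| le_iSup_of_le N <| le_iSup_of_le M <|
    le_iSup_of_le hN <| le_iSup_of_le hM <| le_iSup_of_le hfin le_rfl

variable [Fintype S₁] [Fintype S₂] {Θ₁ : Superchannel C A B D S₁} {Θ₂ : Superchannel C A B D S₂}
  {R : Type} [Fintype R] {mid : SuperOp (A × R) (B × R)}
  {pre : ℕ → SuperOp (A × R) (C × R)} {post : ℕ → SuperOp (D × R) (B × R)}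

theorem Superchannel.IsValid.nested (hΘ₁ : Θ₁.IsValid) (hmid : IsChannel mid)
    (hpre : ∀ k, IsChannel (pre k)) (hpost : ∀ k, IsChannel (post k)) (k : ℕ) :
    IsChannel (Θ₁.nested mid pre post k) := by
  induction k with
  | zero => exact hΘ₁.apply hmid
  | succ k ih => exact hΘ₁.apply ((hpost k).comp (ih.comp (hpre k)))

variable [DecidableEq C] [DecidableEq A] [DecidableEq B] [DecidableEq D] [DecidableEq R]

variable [Nonempty C] [Nonempty A] [Nonempty B]

theorem superDivA_nonneg (hΘ₁ : Θ₁.IsValid) (hΘ₂ : Θ₂.IsValid) : 0 ≤ superDivA Θ₁ Θ₂ := by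
  obtain ⟨τ, hτ⟩ := exists_isState (B × Unit)
  have hN : IsChannel (replacement (A × Unit) τ) := isChannel_replacement hτ
  have hself := chanDivA_self_le hN
  calc 0 ≤ chanDivA (Θ₁.apply (replacement (A × Unit) τ)) (Θ₂.apply (replacement (A × Unit) τ)) :=
        chanDivA_nonneg (hΘ₁.apply hN) (hΘ₂.apply hN)
    _ ≤ superDivA Θ₁ Θ₂ + chanDivA (replacement (A × Unit) τ) (replacement (A × Unit) τ) :=
        chanDivA_apply_le_superDivA_add Θ₁ Θ₂ hN hN (ne_top_of_le_ne_top EReal.zero_ne_top hself)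
    _ ≤ superDivA Θ₁ Θ₂ := (add_le_add_right hself _).trans (add_zero _).le

theorem chanDivA_nested_le [Nonempty R] (hΘ₁ : Θ₁.IsValid) (hΘ₂ : Θ₂.IsValid)
    (hmid : IsChannel mid) (hpre : ∀ k, IsChannel (pre k)) (hpost : ∀ k, IsChannel (post k))
    (k : ℕ) :
    chanDivA (Θ₁.nested mid pre post k) (Θ₂.nested mid pre post k)
      ≤ ((k + 1 : ℕ) : EReal) * superDivA Θ₁ Θ₂ := by
  have hnonneg := superDivA_nonneg hΘ₁ hΘ₂
  induction k with
  | zero =>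
    refine le_succ_mul_of_le_add hnonneg (chanDivA_apply_le_superDivA_add Θ₁ Θ₂ hmid hmid) ?_
    rw [Nat.cast_zero, zero_mul]
    exact chanDivA_self_le hmid
  | succ k ih =>
    have hΘ₁k := hΘ₁.nested hmid hpre hpost k
    have hΘ₂k := hΘ₂.nested hmid hpre hpost k
    exact le_succ_mul_of_le_add hnonneg (chanDivA_apply_le_superDivA_add Θ₁ Θ₂
      ((hpost k).comp (hΘ₁k.comp (hpre k))) ((hpost k).comp (hΘ₂k.comp (hpre k))))
      ((chanDivA_comp_le (hpre k) hΘ₁k hΘ₂k (hpost k)).trans ih)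

end Nested

section Amortization

theorem comp_replacement {X Y Z : Type} [Fintype X] (Φ : SuperOp Y Z) (τ : Op Y) :
    Φ ∘ₗ replacement X τ = replacement X (Φ τ) :=
  LinearMap.ext fun _ => map_smul Φ _ _

theorem chanDivA_replacement {X : Type} [Fintype X] [DecidableEq X] {a b : Op X} (ha : IsState a)
    (hb : IsState b) : chanDivA (replacement Unit a) (replacement Unit b) = stateDiv a b := by
  refine le_antisymm (chanDivA_le fun R _ _ ρ τ hρ hτ _ => EReal.sub_le_of_le_add ?_) ?_
  · have htrace : ∀ M : Op (Unit × R),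
        ∑ x : Unit, M.submatrix (fun r : R => (x, r)) (fun r => (x, r))
          = relabel (Equiv.punitProd R) M := fun M => Fintype.sum_unique _
    rw [tensorId_replacement, tensorId_replacement, htrace, htrace,
      stateDiv_kronecker ha.1 hb.1 (hρ.relabel _).1 (hτ.relabel _).1, stateDiv_relabel hρ.1 hτ.1]
  · simpa [replacement_apply] using stateDiv_map_le_chanDivA (isChannel_replacement (X := Unit) ha)
      (isChannel_replacement (X := Unit) hb) isState_one_unit

variable {C A B D S₁ S₂ : Type} [Fintype C] [Fintype A] [Fintype B] [DecidableEq B] [Fintype D]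
  [DecidableEq D] [Fintype S₁] [DecidableEq S₁]

/-- `δ` bounds the increase of the divergence when one superchannel is completed. The encoder used
under the second hypothesis is that of `Θ₁` before the completion and that of `Θ₂` after it, as in
`superDivAStar`; here the optimization is over states `ω₁`, `ω₂` instead of channels preparing
them. -/
def IsAmortizedBound (Θ₁ : Superchannel C A B D S₁) (Θ₂ : Superchannel C A B D S₂)
    (δ : EReal) : Prop :=
  ∀ (R R' : Type) [Fintype R] [DecidableEq R] [Fintype R'] [DecidableEq R']
    (N M : SuperOp (A × R) (B × R')) (ω₁ ω₂ : Op (C × R)), IsChannel N → IsChannel M →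
    IsState ω₁ → IsState ω₂ → stateDiv (Θ₁.applyEnc N ω₁) (Θ₁.applyEnc M ω₂) ≠ ⊤ →
    stateDiv (Θ₁.apply N ω₁) (Θ₂.apply M ω₂)
      ≤ δ + stateDiv (Θ₁.applyEnc N ω₁) (Θ₁.applyEnc M ω₂)

variable [Fintype S₂] {Θ₁ : Superchannel C A B D S₁} {Θ₂ : Superchannel C A B D S₂}

theorem isAmortizedBound_superDivAStar (hΘ₁ : Θ₁.IsValid) (hΘ₂ : Θ₂.IsValid) :
    IsAmortizedBound Θ₁ Θ₂ (superDivAStar Θ₁ Θ₂) := by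
  intro R R' _ _ _ _ N M ω₁ ω₂ hN hM hω₁ hω₂ hfin
  -- Preparing `ω₁`, `ω₂` by replacement channels turns channel divergences into state divergences.
  have henc := chanDivA_replacement ((hΘ₁.applyEnc hN).map_isState hω₁)
    ((hΘ₁.applyEnc hM).map_isState hω₂)
  have hout := chanDivA_replacement ((hΘ₁.apply hN).map_isState hω₁)
    ((hΘ₂.apply hM).map_isState hω₂)
  rw [← comp_replacement, ← comp_replacement] at henc hout
  rw [← EReal.sub_le_iff_le_add (Or.inl (stateDiv_ne_bot _ _)) (Or.inl hfin), ← henc, ← hout]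
  rw [← henc] at hfin
  exact le_iSup_of_le R <| le_iSup_of_le _ <| le_iSup_of_le (Classical.decEq R) <|
    le_iSup_of_le R' <| le_iSup_of_le _ <| le_iSup_of_le _ <| le_iSup_of_le Unit <|
    le_iSup_of_le _ <| le_iSup_of_le _ <| le_iSup_of_le N <| le_iSup_of_le M <| le_iSup_of_le _ <|
    le_iSup_of_le _ <| le_iSup_of_le hN <| le_iSup_of_le hM <|
    le_iSup_of_le (isChannel_replacement hω₁) <| le_iSup_of_le (isChannel_replacement hω₂) <|
    le_iSup_of_le hfin le_rfl

theorem IsAmortizedBound.nonneg [Nonempty C] [Nonempty B] {δ : EReal}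
    (h : IsAmortizedBound Θ₁ Θ₂ δ) (hΘ₁ : Θ₁.IsValid) (hΘ₂ : Θ₂.IsValid) : 0 ≤ δ := by
  obtain ⟨τ, hτ⟩ := exists_isState (B × Unit)
  obtain ⟨ω, hω⟩ := exists_isState (C × Unit)
  have hN : IsChannel (replacement (A × Unit) τ) := isChannel_replacement hτ
  have hself := stateDiv_self ((hΘ₁.applyEnc hN).map_isState hω)
  have hle := h _ _ _ _ ω ω hN hN hω hω (by rw [hself]; exact EReal.zero_ne_top)
  rw [hself, add_zero] at hle
  exact (stateDiv_nonneg ((hΘ₁.apply hN).map_isState hω) ((hΘ₂.apply hN).map_isState hω)).trans hle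

end Amortization

section AdaptiveSteps

namespace Protocol

variable {C A B D S X R : Type}

/-- The use of a new superchannel with encoder `E`, preceded by the channel `𝒜`, on the joint state
of the experimenter's system and the `k` memories that are already open. -/
def encStep (E : SuperOp C (A × S)) (𝒜 : SuperOp X (C × R)) (k : ℕ) :
    SuperOp (X × (Fin k → S)) ((A × R) × (Fin (k + 1) → S)) :=
  relabel (openEquiv A R S k) ∘ₗ tensorId E (R × (Fin k → S)) ∘ₗ
    relabel (Equiv.prodAssoc C R (Fin k → S)) ∘ₗ tensorId 𝒜 (Fin k → S)

/-- The completion of the `j`-th open superchannel with decoder `E`, preceded by the channel `𝒜`. -/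
def decStep (E : SuperOp (B × S) D) (𝒜 : SuperOp X (B × R)) {k : ℕ} (j : Fin (k + 1)) :
    SuperOp (X × (Fin (k + 1) → S)) ((D × R) × (Fin k → S)) :=
  relabel (Equiv.prodAssoc D R (Fin k → S)).symm ∘ₗ tensorId E (R × (Fin k → S)) ∘ₗ
    relabel (closeEquiv B R S k j) ∘ₗ tensorId 𝒜 (Fin (k + 1) → S)

variable [Fintype S] [Fintype X] [Fintype R]

theorem isChannel_encStep [Fintype C] [Fintype A] {E : SuperOp C (A × S)} (hE : IsChannel E)
    {𝒜 : SuperOp X (C × R)} (h𝒜 : IsChannel 𝒜) (k : ℕ) : IsChannel (encStep E 𝒜 k) :=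
  (isChannel_relabel _).comp ((hE.tensorId _).comp ((isChannel_relabel _).comp (h𝒜.tensorId _)))

theorem isChannel_decStep [Fintype B] [Fintype D] {E : SuperOp (B × S) D} (hE : IsChannel E)
    {𝒜 : SuperOp X (B × R)} (h𝒜 : IsChannel 𝒜) {k : ℕ} (j : Fin (k + 1)) :
    IsChannel (decStep E 𝒜 j) :=
  (isChannel_relabel _).comp ((hE.tensorId _).comp ((isChannel_relabel _).comp (h𝒜.tensorId _)))

end Protocol

end AdaptiveSteps

section Padding

variable {X Y R R₀ T : Type}

theorem tensorId_apply_of_slice {Φ : SuperOp X Y} {M : Op (X × R)} {M₀ : Op (X × R₀)} {r r' : R}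
    {r₀ r₀' : R₀} {c : ℂ} (h : ∀ x x', M (x, r) (x', r') = c * M₀ (x, r₀) (x', r₀')) (y y' : Y) :
    tensorId Φ R M (y, r) (y', r') = c * tensorId Φ R₀ M₀ (y, r₀) (y', r₀') := by
  have hslice : (Matrix.of fun x x' => M (x, r) (x', r'))
      = c • Matrix.of fun x x' => M₀ (x, r₀) (x', r₀') := Matrix.ext h
  simp only [tensorId_apply]
  rw [hslice, map_smul, Matrix.smul_apply, smul_eq_mul]

/-- The map `M ↦ M ⊗ τ`, composed of channels so that it is a channel for every state `τ`. -/
def attach (X : Type) (τ : Op T) : SuperOp X (X × T) :=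
  relabel (Equiv.prodComm T X) ∘ₗ tensorId (replacement Unit τ) X ∘ₗ
    relabel (Equiv.punitProd X).symm

theorem attach_apply (τ : Op T) (M : Op X) : attach X τ M = M ⊗ₖ τ := by
  ext x x'
  simp only [attach, LinearMap.comp_apply]
  rw [relabel_apply, tensorId_apply, replacement_apply]
  simp only [Matrix.trace, Fintype.sum_unique]
  rfl

theorem isChannel_attach [Fintype X] [Fintype T] {τ : Op T} (hτ : IsState τ) :
    IsChannel (attach X τ) :=
  (isChannel_relabel _).comp (((isChannel_replacement hτ).tensorId X).comp (isChannel_relabel _))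

variable {S S' : Type}

/-- The operator `M ⊗ τ ⊗ ⋯ ⊗ τ` on `X` and `k` memories `S' ≃ S × T`, for an operator `M` on `X`
and `k` memories `S`. -/
def padMemory {k : ℕ} (e : S' ≃ S × T) (τ : Op T) (M : Op (X × (Fin k → S))) :
    Op (X × (Fin k → S')) :=
  Matrix.of fun x x' => (∏ i, τ (e (x.2 i)).2 (e (x'.2 i)).2) *
    M (x.1, fun i => (e (x.2 i)).1) (x'.1, fun i => (e (x'.2 i)).1)

theorem tensorId_padMemory {k : ℕ} (Φ : SuperOp X Y) (e : S' ≃ S × T) (τ : Op T)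
    (M : Op (X × (Fin k → S))) :
    tensorId Φ (Fin k → S') (padMemory e τ M) = padMemory e τ (tensorId Φ (Fin k → S) M) :=
  Matrix.ext fun y y' => tensorId_apply_of_slice (fun _ _ => rfl) y.1 y'.1

variable [Fintype T]

/-- The partial trace over the second system. -/
def detach (X T : Type) [Fintype T] : SuperOp (X × T) X :=
  relabel (Equiv.punitProd X) ∘ₗ tensorId (replacement T (1 : Op Unit)) X ∘ₗ
    relabel (Equiv.prodComm X T)

theorem detach_kronecker {τ : Op T} (hτ : IsState τ) (M : Op X) : detach X T (M ⊗ₖ τ) = M := by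
  simp only [detach, LinearMap.comp_apply]
  rw [relabel_prodComm_kronecker, tensorId_kronecker, replacement_apply, hτ.2, one_smul]
  ext x x'
  rw [relabel_apply, Matrix.kronecker_apply]
  simp

theorem isChannel_detach [Fintype X] : IsChannel (detach X T) :=
  (isChannel_relabel _).comp
    (((isChannel_replacement isState_one_unit).tensorId X).comp (isChannel_relabel _))

variable {C A B D : Type}

/-- The identification `(X × S) × T ≃ X × S'` for a given `S' ≃ S × T`. -/
def memoryEquiv (X : Type) (e : S' ≃ S × T) : (X × S) × T ≃ X × S' :=
  (Equiv.prodAssoc X S T).trans ((Equiv.refl X).prodCongr e.symm)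

namespace Superchannel

/-- The superchannel `Θ` with an enlarged memory `S' ≃ S × T`, whose second part is in the
state `τ` and is discarded by the decoder. -/
def pad (Θ : Superchannel C A B D S) (e : S' ≃ S × T) (τ : Op T) : Superchannel C A B D S' where
  enc := relabel (memoryEquiv A e) ∘ₗ attach (A × S) τ ∘ₗ Θ.enc
  dec := Θ.dec ∘ₗ detach (B × S) T ∘ₗ relabel (memoryEquiv B e).symm

theorem IsValid.pad [Fintype C] [Fintype A] [Fintype B] [Fintype D] [Fintype S] [Fintype S']
    {Θ : Superchannel C A B D S} (hΘ : Θ.IsValid) (e : S' ≃ S × T) {τ : Op T} (hτ : IsState τ) :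
    (Θ.pad e τ).IsValid :=
  ⟨(isChannel_relabel _).comp ((isChannel_attach hτ).comp hΘ.1),
    hΘ.2.comp (isChannel_detach.comp (isChannel_relabel _))⟩

variable (Θ : Superchannel C A B D S) (e : S' ≃ S × T) {τ : Op T}

theorem pad_enc_apply (τ : Op T) (M : Op C) (a a' : A) (s s' : S') :
    (Θ.pad e τ).enc M (a, s) (a', s')
      = τ (e s).2 (e s').2 * Θ.enc M (a, (e s).1) (a', (e s').1) := by
  simp only [pad, LinearMap.comp_apply]
  rw [relabel_apply, attach_apply, Matrix.kronecker_apply, mul_comm]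
  rfl

theorem pad_dec_of_eq (hτ : IsState τ) {M : Op (B × S')} {K : Op (B × S)} {c : ℂ}
    (h : ∀ b b' s s', M (b, s) (b', s')
      = c * (τ (e s).2 (e s').2 * K (b, (e s).1) (b', (e s').1))) :
    (Θ.pad e τ).dec M = c • Θ.dec K := by
  have hM : relabel (memoryEquiv B e).symm M = c • (K ⊗ₖ τ) := by
    ext x x'
    rw [relabel_apply, Matrix.smul_apply, Matrix.kronecker_apply, smul_eq_mul, mul_comm (K _ _)]
    refine (h _ _ _ _).trans ?_
    simp
  simp only [pad, LinearMap.comp_apply]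
  rw [hM, map_smul, detach_kronecker hτ, map_smul]

theorem pad_applyEnc (τ : Op T) {R R' : Type} (N : SuperOp (A × R) (B × R')) (M : Op (C × R)) :
    (Θ.pad e τ).applyEnc N M = relabel (memoryEquiv (B × R') e) (Θ.applyEnc N M ⊗ₖ τ) := by
  ext ⟨y, s⟩ ⟨y', s'⟩
  rw [relabel_apply, Matrix.kronecker_apply, mul_comm]
  simp only [applyEnc, LinearMap.comp_apply]
  refine tensorId_apply_of_slice (fun x x' => ?_) y y'
  exact Θ.pad_enc_apply e τ _ _ _ _ _

theorem pad_apply (hτ : IsState τ) {R R' : Type} (N : SuperOp (A × R) (B × R')) :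
    (Θ.pad e τ).apply N = Θ.apply N := by
  ext1 M
  ext ⟨d, r⟩ ⟨d', r'⟩
  simp only [apply, LinearMap.comp_apply, pad_applyEnc]
  rw [tensorId_apply, tensorId_apply, Θ.pad_dec_of_eq e hτ (c := 1), one_smul]
  intro b b' s s'
  rw [one_mul, mul_comm]
  rfl

end Superchannel

theorem IsAmortizedBound.pad [Fintype C] [Fintype A] [Fintype B] [DecidableEq B] [Fintype D]
    [DecidableEq D] {S₁ S₂ T₁ T₂ : Type} [Fintype S₁] [DecidableEq S₁] [Fintype T₁] [Fintype T₂]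
    [Fintype S'] [DecidableEq S']
    {Θ₁ : Superchannel C A B D S₁} {Θ₂ : Superchannel C A B D S₂} {δ : EReal}
    (h : IsAmortizedBound Θ₁ Θ₂ δ) (hΘ₁ : Θ₁.IsValid) (e₁ : S' ≃ S₁ × T₁) (e₂ : S' ≃ S₂ × T₂)
    {τ₁ : Op T₁} {τ₂ : Op T₂} (hτ₁ : IsState τ₁) (hτ₂ : IsState τ₂) :
    IsAmortizedBound (Θ₁.pad e₁ τ₁) (Θ₂.pad e₂ τ₂) δ := by
  classical
  intro R R' _ _ _ _ N M ω₁ ω₂ hN hM hω₁ hω₂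
  have hν₁ := (hΘ₁.applyEnc hN).map_isState hω₁
  have hν₂ := (hΘ₁.applyEnc hM).map_isState hω₂
  rw [Θ₁.pad_apply e₁ hτ₁, Θ₂.pad_apply e₂ hτ₂, Θ₁.pad_applyEnc, Θ₁.pad_applyEnc,
    stateDiv_relabel (hν₁.1.kronecker hτ₁.1) (hν₂.1.kronecker hτ₁.1),
    stateDiv_kronecker hν₁.1 hν₂.1 hτ₁.1 hτ₁.1, stateDiv_self hτ₁, add_zero]
  exact h R R' N M ω₁ ω₂ hN hM hω₁ hω₂

namespace Protocol

variable {k : ℕ} (Θ : Superchannel C A B D S) (e : S' ≃ S × T) {τ : Op T}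

theorem encStep_pad (τ : Op T) (𝒜 : SuperOp X (C × R)) (M : Op (X × (Fin k → S))) :
    encStep (Θ.pad e τ).enc 𝒜 k (padMemory e τ M) = padMemory e τ (encStep Θ.enc 𝒜 k M) := by
  ext ⟨⟨a, r⟩, w⟩ ⟨⟨a', r'⟩, w'⟩
  simp only [encStep, LinearMap.comp_apply, tensorId_padMemory]
  generalize tensorId 𝒜 (Fin k → S) M = K
  have hslice : tensorId (Θ.pad e τ).enc (R × (Fin k → S'))
        (relabel (Equiv.prodAssoc C R (Fin k → S')) (padMemory e τ K))
        ((a, w 0), (r, fun i => w i.succ)) ((a', w' 0), (r', fun i => w' i.succ))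
      = (∏ i : Fin k, τ (e (w i.succ)).2 (e (w' i.succ)).2) *
        tensorId (Θ.pad e τ).enc (R × (Fin k → S)) (relabel (Equiv.prodAssoc C R (Fin k → S)) K)
        ((a, w 0), (r, fun i => (e (w i.succ)).1)) ((a', w' 0), (r', fun i => (e (w' i.succ)).1)) :=
    tensorId_apply_of_slice (fun _ _ => rfl) _ _
  refine hslice.trans ((congrArg (_ * ·) (Θ.pad_enc_apply e τ _ _ _ _ _)).trans ?_)
  rw [← mul_assoc, mul_comm (∏ i, _), ← Fin.prod_univ_succ fun i => τ (e (w i)).2 (e (w' i)).2]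
  rfl

theorem decStep_pad (hτ : IsState τ) (𝒜 : SuperOp X (B × R)) (j : Fin (k + 1))
    (M : Op (X × (Fin (k + 1) → S))) :
    decStep (Θ.pad e τ).dec 𝒜 j (padMemory e τ M) = padMemory e τ (decStep Θ.dec 𝒜 j M) := by
  ext ⟨⟨d, r⟩, w⟩ ⟨⟨d', r'⟩, w'⟩
  simp only [decStep, LinearMap.comp_apply, tensorId_padMemory]
  generalize tensorId 𝒜 (Fin (k + 1) → S) M = K
  have hinsert (s : S') (w : Fin k → S') :
      (fun i => (e ((j.insertNth s w : Fin (k + 1) → S') i)).1)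
        = (j.insertNth (e s).1 fun i => (e (w i)).1 : Fin (k + 1) → S) := by
    rw [Fin.eq_insertNth_iff]
    exact ⟨by simp, funext fun i => by simp [Fin.removeNth]⟩
  rw [relabel_apply, tensorId_apply, Θ.pad_dec_of_eq e hτ
    (c := ∏ i, τ (e (w i)).2 (e (w' i)).2)
    (K := Matrix.of fun x x' => relabel (closeEquiv B R S k j) K (x, (r, fun i => (e (w i)).1))
      (x', (r', fun i => (e (w' i)).1)))]
  · rfl
  · intro b b' s s'
    have hpad : padMemory e τ K ((b, r), j.insertNth s w) ((b', r'), j.insertNth s' w')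
        = _ * _ := rfl
    dsimp only at hpad
    rw [hinsert, hinsert, Fin.prod_univ_succAbove _ j] at hpad
    simp only [Fin.insertNth_apply_same, Fin.insertNth_apply_succAbove] at hpad
    rw [← mul_assoc, mul_comm (∏ i, _)]
    exact hpad

theorem run_pad (hτ : IsState τ) {m : ℕ} (P : Protocol C A B D m k X) :
    run (Θ.pad e τ) P = padMemory e τ (run Θ P) := by
  induction P with
  | prepare ρ hρ =>
    ext x x'
    simp only [padMemory, Matrix.of_apply, Finset.univ_eq_empty, Finset.prod_empty, one_mul]
    rfl
  | useEnc P 𝒜 _ ih => exact (congrArg _ ih).trans (encStep_pad Θ e τ 𝒜 (run Θ P))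
  | useDec P 𝒜 _ j ih => exact (congrArg _ ih).trans (decStep_pad Θ e hτ 𝒜 j (run Θ P))

theorem output_pad (hτ : IsState τ) {m : ℕ} (P : Protocol C A B D m 0 X) :
    output (Θ.pad e τ) P = output Θ P := by
  ext x x'
  simp only [output, relabel_apply, run_pad Θ e hτ, padMemory, Matrix.of_apply,
    Finset.univ_eq_empty, Finset.prod_empty, one_mul]
  congr 1 <;> exact Prod.ext rfl (Subsingleton.elim _ _)

end Protocol

end Padding

section InsertNth

variable {α : Type*} {k : ℕ}

theorem insertNth_const (j : Fin (k + 1)) (a : α) :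
    (j.insertNth a fun _ => a : Fin (k + 1) → α) = fun _ => a :=
  Fin.insertNth_eq_iff.2 ⟨rfl, rfl⟩

theorem insertNth_comm (i : Fin (k + 2)) (j : Fin (k + 1)) (a b : α) (f : Fin k → α) :
    (i.insertNth a (j.insertNth b f : Fin (k + 1) → α) : Fin (k + 2) → α)
      = (i.succAbove j).insertNth b ((j.predAbove i).insertNth a f : Fin (k + 1) → α) := by
  rw [Fin.eq_insertNth_iff, Fin.eq_insertNth_iff]
  refine ⟨by simp, ?_, ?_⟩
  · simp only [Fin.removeNth, Fin.succAbove_succAbove_predAbove, Fin.insertNth_apply_same]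
  · rw [← Fin.removeNth_removeNth_eq_swap, Fin.removeNth_insertNth, Fin.removeNth_insertNth]

theorem insertNth_succ (j : Fin (k + 1)) (a : α) (f : Fin (k + 1) → α) :
    (j.succ.insertNth a f : Fin (k + 2) → α)
      = Fin.cons (f 0) (j.insertNth a fun i => f i.succ : Fin (k + 1) → α) := by
  rw [← Fin.insertNth_succ_cons]
  exact congrArg (j.succ.insertNth (α := fun _ => α) a) (Fin.cons_self_tail f).symm

theorem forall_insertNth {p : α → Prop} (j : Fin (k + 1)) {a : α} {f : Fin k → α} (ha : p a)
    (hf : ∀ i, p (f i)) (i : Fin (k + 1)) : p ((j.insertNth a f : Fin (k + 1) → α) i) := by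
  refine Fin.succAboveCases j ?_ (fun i => ?_) i
  · rwa [Fin.insertNth_apply_same]
  · rw [Fin.insertNth_apply_succAbove]
    exact hf i

end InsertNth

namespace Protocol

section SplitMemory

variable {C A B D S X R : Type} {k : ℕ}

/-- Separation of the memory of the `j`-th open superchannel. -/
def splitMemory (X S : Type) (j : Fin (k + 1)) :
    X × (Fin (k + 1) → S) ≃ (X × (Fin k → S)) × S where
  toFun x := ((x.1, j.removeNth x.2), x.2 j)
  invFun x := (x.1.1, j.insertNth x.2 x.1.2)
  left_inv x := by simp
  right_inv x := by simp

/-- The map `𝒜 ⊗ id_M : X M → B R M`, with `M` as a part of the reference system of `B`. -/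
def tensorIdAssoc (𝒜 : SuperOp X (B × R)) (M : Type) : SuperOp (X × M) (B × (R × M)) :=
  relabel (Equiv.prodAssoc B R M) ∘ₗ tensorId 𝒜 M

theorem isChannel_tensorIdAssoc [Fintype X] [Fintype B] [Fintype R] {𝒜 : SuperOp X (B × R)}
    (h𝒜 : IsChannel 𝒜) (M : Type) [Fintype M] : IsChannel (tensorIdAssoc 𝒜 M) :=
  (isChannel_relabel _).comp (h𝒜.tensorId M)

/-- The state of `Y` and the memory `S` after the encoder `E` and the channel `N` have acted on
the state `ω`. -/
def comb {Y : Type} (N : SuperOp (A × R) Y) (ω : Op (C × R)) (E : SuperOp C (A × S)) :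
    Op (Y × S) :=
  tensorId N S (relabel (swapLast A S R) (tensorId E R ω))

theorem isState_comb [Fintype C] [Fintype A] [Fintype S] [Fintype R] {Y : Type} [Fintype Y]
    {N : SuperOp (A × R) Y} (hN : IsChannel N) {ω : Op (C × R)} (hω : IsState ω)
    {E : SuperOp C (A × S)} (hE : IsChannel E) : IsState (comb N ω E) :=
  (hN.tensorId S).map_isState (((hE.tensorId R).map_isState hω).relabel _)

theorem splitMemory_encStep_zero (E : SuperOp C (A × S)) (𝒜 : SuperOp X (C × R))
    (M : Op (X × (Fin k → S))) :
    relabel (splitMemory (A × R) S 0) (encStep E 𝒜 k M)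
      = comb (relabel (Equiv.prodAssoc A R (Fin k → S)).symm)
          (tensorIdAssoc 𝒜 (Fin k → S) M) E := by
  ext ⟨⟨⟨a, r⟩, t⟩, s⟩ ⟨⟨⟨a', r'⟩, t'⟩, s'⟩
  have hopen (a : A) (r : R) (s : S) (t : Fin k → S) : (openEquiv A R S k).symm
      ((a, r), (Fin.insertNth 0 s t : Fin (k + 1) → S)) = ((a, s), (r, t)) := by
    rw [Equiv.symm_apply_eq]
    rfl
  simp only [encStep, LinearMap.comp_apply]
  rw [relabel_apply, relabel_apply]
  exact congrArg₂ (tensorId E (R × (Fin k → S)) _) (hopen a r s t) (hopen a' r' s' t')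

theorem splitMemory_encStep_succ (E : SuperOp C (A × S)) (𝒜 : SuperOp X (C × R))
    (j : Fin (k + 1)) (M : Op (X × (Fin (k + 1) → S))) :
    relabel (splitMemory (A × R) S j.succ) (encStep E 𝒜 (k + 1) M)
      = tensorId (encStep E 𝒜 k) S (relabel (splitMemory X S j) M) := by
  ext ⟨⟨⟨a, r⟩, t⟩, s⟩ ⟨⟨⟨a', r'⟩, t'⟩, s'⟩
  have hopen (a : A) (r : R) (s : S) (t : Fin (k + 1) → S) : (openEquiv A R S (k + 1)).symm
      ((a, r), (j.succ.insertNth s t : Fin (k + 2) → S))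
        = ((a, t 0), (r, (j.insertNth s (Fin.removeNth 0 t) : Fin (k + 1) → S))) := by
    rw [Equiv.symm_apply_eq, insertNth_succ, ← Fin.insertNth_zero']
    rfl
  simp only [encStep, LinearMap.comp_apply]
  rw [relabel_apply, relabel_apply]
  exact congrArg₂ (tensorId E (R × (Fin (k + 1) → S)) _) (hopen a r s t) (hopen a' r' s' t')

theorem splitMemory_decStep (E : SuperOp (B × S) D) (𝒜 : SuperOp X (B × R)) (i : Fin (k + 2))
    (j : Fin (k + 1)) (M : Op (X × (Fin (k + 2) → S))) :
    relabel (splitMemory (D × R) S j) (decStep E 𝒜 i M)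
      = tensorId (decStep E 𝒜 (j.predAbove i)) S
          (relabel (splitMemory X S (i.succAbove j)) M) := by
  ext ⟨⟨⟨d, r⟩, t⟩, s⟩ ⟨⟨⟨d', r'⟩, t'⟩, s'⟩
  have hclose (b : B) (r : R) (s s₀ : S) (t : Fin k → S) : (closeEquiv B R S (k + 1) i).symm
      ((b, s₀), (r, (j.insertNth s t : Fin (k + 1) → S)))
        = ((b, r), ((i.succAbove j).insertNth s
            ((j.predAbove i).insertNth s₀ t : Fin (k + 1) → S) : Fin (k + 2) → S)) := by
    rw [← insertNth_comm]
    rfl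
  refine congrArg (fun K => E K d d') (Matrix.ext fun ⟨b, s₀⟩ ⟨b', s₀'⟩ => ?_)
  exact congrArg₂ (tensorId 𝒜 (Fin (k + 2) → S) M) (hclose b r s s₀ t) (hclose b' r' s' s₀' t')

theorem closeEquiv_tensorId_splitMemory_symm (𝒜 : SuperOp X (B × R)) (j : Fin (k + 1))
    (M : Op ((X × (Fin k → S)) × S)) :
    relabel (closeEquiv B R S k j) (tensorId 𝒜 (Fin (k + 1) → S)
        (relabel (splitMemory X S j).symm M))
      = relabel (swapLast B (R × (Fin k → S)) S)
          (tensorId (tensorIdAssoc 𝒜 (Fin k → S)) S M) := by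
  ext ⟨⟨b, s⟩, ⟨r, t⟩⟩ ⟨⟨b', s'⟩, ⟨r', t'⟩⟩
  have hsplit (s : S) (t : Fin k → S) (x : X) :
      splitMemory X S j (x, (j.insertNth s t : Fin (k + 1) → S)) = ((x, t), s) := by
    rw [← Equiv.eq_symm_apply]
    rfl
  refine congrArg (fun K => 𝒜 K (b, r) (b', r')) (Matrix.ext fun x x' => ?_)
  exact congrArg₂ M (hsplit s t x) (hsplit s' t' x')

theorem applyEnc_comp (Θ : Superchannel C A B D S) {R₀ Y Z : Type} (𝒟 : SuperOp Y (B × Z))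
    (N : SuperOp (A × R₀) Y) (ω : Op (C × R₀)) :
    Θ.applyEnc (𝒟 ∘ₗ N) ω = tensorId 𝒟 S (comb N ω Θ.enc) :=
  rfl

theorem decStep_comb (Θ : Superchannel C A B D S) {R₀ : Type} (𝒜 : SuperOp X (B × R))
    (j : Fin (k + 1)) (N : SuperOp (A × R₀) (X × (Fin k → S))) (ω : Op (C × R₀)) :
    decStep Θ.dec 𝒜 j (relabel (splitMemory X S j).symm (comb N ω Θ.enc))
      = relabel (Equiv.prodAssoc D R (Fin k → S)).symm
          (Θ.apply (tensorIdAssoc 𝒜 (Fin k → S) ∘ₗ N) ω) := by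
  simp only [decStep, LinearMap.comp_apply]
  rw [closeEquiv_tensorId_splitMemory_symm]
  rfl

end SplitMemory

section Hybrid

variable {C A B D S : Type}

/-- The state of a protocol in which the completed superchannels are given by `Θ`, whereas the
open ones have used the encoders `f`. -/
def hybridRun (Θ : Superchannel C A B D S) {m k : ℕ} {X : Type} :
    Protocol C A B D m k X → (Fin k → SuperOp C (A × S)) → Op (X × (Fin k → S))
  | prepare ρ _, _ => relabel (Equiv.prodUnique _ (Fin 0 → S)).symm ρ
  | useEnc P 𝒜 _, f => encStep (f 0) 𝒜 _ (hybridRun Θ P fun i => f i.succ)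
  | useDec P 𝒜 _ j, f => decStep Θ.dec 𝒜 j (hybridRun Θ P (j.insertNth Θ.enc f))

theorem hybridRun_const (Θ : Superchannel C A B D S) {m k : ℕ} {X : Type}
    (P : Protocol C A B D m k X) : hybridRun Θ P (fun _ => Θ.enc) = run Θ P := by
  induction P with
  | prepare ρ _ => rfl
  | useEnc P 𝒜 _ ih =>
    simp only [hybridRun, ih]
    rfl
  | useDec P 𝒜 _ j ih =>
    simp only [hybridRun, insertNth_const, ih]
    rfl

variable [hC : Fintype C] [Fintype A] [hB : Fintype B] [Fintype D] [Fintype S]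

theorem isState_hybridRun {Θ : Superchannel C A B D S} (hΘ : Θ.IsValid) {m k : ℕ} {X : Type}
    (P : Protocol C A B D m k X) : ∀ [Fintype X] {f : Fin k → SuperOp C (A × S)},
      (∀ i, IsChannel (f i)) → IsState (hybridRun Θ P f) := by
  induction P with
  | @prepare X i₁ _ ρ hρ =>
    intro hX _ _
    obtain rfl : hX = i₁ := Subsingleton.elim _ _
    exact hρ.relabel _
  | @useEnc m k X R _ _ _ _ i₅ _ P 𝒜 h𝒜 ih =>
    intro hX _ hf
    obtain rfl : hX = instFintypeProd A R := Subsingleton.elim _ _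
    obtain rfl : hC = i₅ := Subsingleton.elim _ _
    exact (isChannel_encStep (hf 0) h𝒜 k).map_isState (ih fun i => hf i.succ)
  | @useDec m k X R _ _ _ _ i₅ _ P 𝒜 h𝒜 j ih =>
    intro hX _ hf
    obtain rfl : hX = instFintypeProd D R := Subsingleton.elim _ _
    obtain rfl : hB = i₅ := Subsingleton.elim _ _
    exact (isChannel_decStep hΘ.2 h𝒜 j).map_isState (ih (forall_insertNth j hΘ.1 hf))

theorem isState_output {Θ : Superchannel C A B D S} (hΘ : Θ.IsValid) {m : ℕ} {X : Type}
    [Fintype X] (P : Protocol C A B D m 0 X) : IsState (P.output Θ) := by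
  have hrun := isState_hybridRun hΘ P (f := fun _ => Θ.enc) fun _ => hΘ.1
  rw [hybridRun_const] at hrun
  exact hrun.relabel _

/-- The dependence of the state of the protocol on the encoder of the `j`-th open superchannel is
that of a comb. Its reference system `R` does not depend on the other components, so that two
superchannels can be compared on it. -/
def HasCombAt (S : Type) [Fintype S] {m k : ℕ} {X : Type} [Fintype X]
    (P : Protocol C A B D m (k + 1) X) (j : Fin (k + 1)) : Prop :=
  ∃ (R : Type) (_ : Fintype R), ∀ Θ : Superchannel C A B D S, Θ.IsValid →
    ∀ f : Fin k → SuperOp C (A × S), (∀ i, IsChannel (f i)) →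
      ∃ (N : SuperOp (A × R) (X × (Fin k → S))) (ω : Op (C × R)), IsChannel N ∧ IsState ω ∧
        ∀ E, relabel (splitMemory X S j) (hybridRun Θ P (j.insertNth E f)) = comb N ω E

section

variable {m k : ℕ} {X R : Type} [Fintype X] [DecidableEq X] [Fintype R] [DecidableEq R]

theorem hasCombAt_useEnc_zero [DecidableEq C] (P : Protocol C A B D m k X)
    {𝒜 : SuperOp X (C × R)} (h𝒜 : IsChannel 𝒜) : HasCombAt S (useEnc P 𝒜 h𝒜) 0 :=
  ⟨R × (Fin k → S), inferInstance, fun _ hΘ _ hf =>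
    ⟨_, _, isChannel_relabel _,
      (isChannel_tensorIdAssoc h𝒜 _).map_isState (isState_hybridRun hΘ P hf),
      fun E => splitMemory_encStep_zero E 𝒜 _⟩⟩

theorem HasCombAt.useEnc [DecidableEq C] {P : Protocol C A B D m (k + 1) X}
    {j : Fin (k + 1)} (hP : HasCombAt S P j) {𝒜 : SuperOp X (C × R)} (h𝒜 : IsChannel 𝒜) :
    HasCombAt S (useEnc P 𝒜 h𝒜) j.succ := by
  obtain ⟨R₀, _, hcomb⟩ := hP
  refine ⟨R₀, inferInstance, fun Θ hΘ f hf => ?_⟩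
  obtain ⟨N, ω, hN, hω, hNω⟩ := hcomb Θ hΘ (fun i => f i.succ) fun i => hf i.succ
  refine ⟨encStep (f 0) 𝒜 k ∘ₗ N, ω, (isChannel_encStep (hf 0) h𝒜 k).comp hN, hω, fun E => ?_⟩
  rw [insertNth_succ]
  exact (splitMemory_encStep_succ (f 0) 𝒜 j _).trans
    (congrArg (tensorId (encStep (f 0) 𝒜 k) S) (hNω E))

theorem HasCombAt.useDec [DecidableEq B] {P : Protocol C A B D m (k + 2) X}
    {i : Fin (k + 2)} {j : Fin (k + 1)} (hP : HasCombAt S P (i.succAbove j))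
    {𝒜 : SuperOp X (B × R)} (h𝒜 : IsChannel 𝒜) : HasCombAt S (useDec P 𝒜 h𝒜 i) j := by
  obtain ⟨R₀, _, hcomb⟩ := hP
  refine ⟨R₀, inferInstance, fun Θ hΘ f hf => ?_⟩
  obtain ⟨N, ω, hN, hω, hNω⟩ := hcomb Θ hΘ ((j.predAbove i).insertNth Θ.enc f)
    (forall_insertNth _ hΘ.1 hf)
  refine ⟨decStep Θ.dec 𝒜 (j.predAbove i) ∘ₗ N, ω, (isChannel_decStep hΘ.2 h𝒜 _).comp hN, hω,
    fun E => ?_⟩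
  simp only [hybridRun]
  rw [insertNth_comm, splitMemory_decStep]
  exact congrArg (tensorId (decStep Θ.dec 𝒜 (j.predAbove i)) S) (hNω E)

end

theorem hasCombAt {m l : ℕ} {X : Type} (P : Protocol C A B D m l X) :
    ∀ [Fintype X] {k : ℕ} (hl : l = k + 1) (j : Fin (k + 1)), HasCombAt S (hl ▸ P) j := by
  induction P with
  | prepare ρ _ => exact fun hl => absurd hl (Nat.succ_ne_zero _).symm
  | @useEnc m l X R _ _ _ _ i₅ _ P 𝒜 h𝒜 ih =>
    intro hX k hl j
    obtain rfl : hX = instFintypeProd A R := Subsingleton.elim _ _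
    obtain rfl : hC = i₅ := Subsingleton.elim _ _
    obtain rfl : l = k := Nat.succ.inj hl
    cases j using Fin.cases with
    | zero => exact hasCombAt_useEnc_zero P h𝒜
    | succ j =>
      cases l with
      | zero => exact j.elim0
      | succ l => exact (ih rfl j).useEnc h𝒜
  | @useDec m l X R _ _ _ _ i₅ _ P 𝒜 h𝒜 i ih =>
    intro hX k hl j
    obtain rfl : hX = instFintypeProd D R := Subsingleton.elim _ _
    obtain rfl : hB = i₅ := Subsingleton.elim _ _
    subst hl
    exact (ih rfl (i.succAbove j)).useDec h𝒜

end Hybrid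

section OutputDivergence

variable {C A B D S : Type} [hC : Fintype C] [Fintype A] [hB : Fintype B] [dB : DecidableEq B]
  [Fintype D] [DecidableEq D] [Fintype S] [DecidableEq S] {Θ₁ Θ₂ : Superchannel C A B D S}
  {δ : EReal} {m k : ℕ} {X R : Type}

theorem stateDiv_decStep_comb_le [Fintype X] [DecidableEq X] [Fintype R] [DecidableEq R]
    (hΘ₁ : Θ₁.IsValid) (hΘ₂ : Θ₂.IsValid) (hδ : IsAmortizedBound Θ₁ Θ₂ δ)
    {𝒜 : SuperOp X (B × R)} (h𝒜 : IsChannel 𝒜) (j : Fin (k + 1)) {R₀ : Type} [Fintype R₀]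
    {N M : SuperOp (A × R₀) (X × (Fin k → S))} {ω₁ ω₂ : Op (C × R₀)} (hN : IsChannel N)
    (hM : IsChannel M) (hω₁ : IsState ω₁) (hω₂ : IsState ω₂)
    (hfin : stateDiv (comb N ω₁ Θ₁.enc) (comb M ω₂ Θ₁.enc) ≠ ⊤) :
    stateDiv (decStep Θ₁.dec 𝒜 j (relabel (splitMemory X S j).symm (comb N ω₁ Θ₁.enc)))
        (decStep Θ₂.dec 𝒜 j (relabel (splitMemory X S j).symm (comb M ω₂ Θ₂.enc)))
      ≤ δ + stateDiv (comb N ω₁ Θ₁.enc) (comb M ω₂ Θ₁.enc) := by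
  classical
  have h𝒜' := isChannel_tensorIdAssoc h𝒜 (Fin k → S)
  have hle : stateDiv (Θ₁.applyEnc (tensorIdAssoc 𝒜 (Fin k → S) ∘ₗ N) ω₁)
      (Θ₁.applyEnc (tensorIdAssoc 𝒜 (Fin k → S) ∘ₗ M) ω₂)
      ≤ stateDiv (comb N ω₁ Θ₁.enc) (comb M ω₂ Θ₁.enc) := by
    rw [applyEnc_comp, applyEnc_comp]
    exact stateDiv_map_le (isState_comb hN hω₁ hΘ₁.1).1 (isState_comb hM hω₂ hΘ₁.1).1
      (h𝒜'.tensorId S)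
  rw [decStep_comb, decStep_comb,
    stateDiv_relabel ((hΘ₁.apply (h𝒜'.comp hN)).map_isState hω₁).1
      ((hΘ₂.apply (h𝒜'.comp hM)).map_isState hω₂).1]
  exact (hδ _ _ _ _ ω₁ ω₂ (h𝒜'.comp hN) (h𝒜'.comp hM) hω₁ hω₂
    (ne_top_of_le_ne_top hfin hle)).trans (add_le_add_right hle δ)

theorem stateDiv_hybridRun_useDec_le [Fintype X] [DecidableEq X] [Fintype R] [DecidableEq R]
    (hΘ₁ : Θ₁.IsValid) (hΘ₂ : Θ₂.IsValid) (hδ : IsAmortizedBound Θ₁ Θ₂ δ)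
    (P : Protocol C A B D m (k + 1) X) {𝒜 : SuperOp X (B × R)} (h𝒜 : IsChannel 𝒜)
    (j : Fin (k + 1))
    (hfin : stateDiv (hybridRun Θ₁ P fun _ => Θ₁.enc) (hybridRun Θ₂ P fun _ => Θ₁.enc) ≠ ⊤) :
    stateDiv (hybridRun Θ₁ (useDec P 𝒜 h𝒜 j) fun _ => Θ₁.enc)
        (hybridRun Θ₂ (useDec P 𝒜 h𝒜 j) fun _ => Θ₁.enc)
      ≤ δ + stateDiv (hybridRun Θ₁ P fun _ => Θ₁.enc) (hybridRun Θ₂ P fun _ => Θ₁.enc) := by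
  obtain ⟨R₀, _, hcomb⟩ : HasCombAt S P j := hasCombAt P rfl j
  obtain ⟨N, ω₁, hN, hω₁, hrun₁⟩ := hcomb Θ₁ hΘ₁ (fun _ => Θ₁.enc) fun _ => hΘ₁.1
  obtain ⟨M, ω₂, hM, hω₂, hrun₂⟩ := hcomb Θ₂ hΘ₂ (fun _ => Θ₁.enc) fun _ => hΘ₁.1
  have hdiv : stateDiv (hybridRun Θ₁ P fun _ => Θ₁.enc) (hybridRun Θ₂ P fun _ => Θ₁.enc)
      = stateDiv (comb N ω₁ Θ₁.enc) (comb M ω₂ Θ₁.enc) := by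
    rw [← hrun₁, ← hrun₂, insertNth_const]
    exact (stateDiv_relabel (isState_hybridRun hΘ₁ P fun _ => hΘ₁.1).1
      (isState_hybridRun hΘ₂ P fun _ => hΘ₁.1).1 _).symm
  rw [hdiv] at hfin ⊢
  have h := stateDiv_decStep_comb_le hΘ₁ hΘ₂ hδ h𝒜 j hN hM hω₁ hω₂ hfin
  have hsplit₁ := congrArg (relabel (splitMemory X S j).symm) (hrun₁ Θ₁.enc)
  have hsplit₂ := congrArg (relabel (splitMemory X S j).symm) (hrun₂ Θ₂.enc)
  rw [relabel_symm_apply_relabel] at hsplit₁ hsplit₂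
  rwa [← hsplit₁, ← hsplit₂] at h

theorem stateDiv_hybridRun_le (hΘ₁ : Θ₁.IsValid) (hΘ₂ : Θ₂.IsValid)
    (hδ : IsAmortizedBound Θ₁ Θ₂ δ) (h0 : 0 ≤ δ) (P : Protocol C A B D m k X) :
    ∀ [Fintype X] [DecidableEq X], ∃ c : ℕ, m = c + k ∧
      stateDiv (hybridRun Θ₁ P fun _ => Θ₁.enc) (hybridRun Θ₂ P fun _ => Θ₁.enc) ≤ c * δ := by
  induction P with
  | @prepare X i₁ _ ρ hρ =>
    intro hX _
    obtain rfl : hX = i₁ := Subsingleton.elim _ _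
    refine ⟨0, rfl, ?_⟩
    rw [Nat.cast_zero, zero_mul]
    exact (stateDiv_self (hρ.relabel _)).le
  | @useEnc m k X R _ _ _ _ i₅ _ P 𝒜 h𝒜 ih =>
    intro hX dX
    obtain rfl : hX = instFintypeProd A R := Subsingleton.elim _ _
    obtain rfl : hC = i₅ := Subsingleton.elim _ _
    obtain ⟨c, hc, h⟩ := ih
    refine ⟨c, by omega, le_trans ?_ h⟩
    exact stateDiv_map_le (isState_hybridRun hΘ₁ P fun _ => hΘ₁.1).1
      (isState_hybridRun hΘ₂ P fun _ => hΘ₁.1).1 (isChannel_encStep hΘ₁.1 h𝒜 k)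
  | @useDec m k X R _ _ _ _ i₅ i₆ P 𝒜 h𝒜 j ih =>
    intro hX dX
    obtain rfl : hX = instFintypeProd D R := Subsingleton.elim _ _
    obtain rfl : dX = instDecidableEqProd := Subsingleton.elim _ _
    obtain rfl : hB = i₅ := Subsingleton.elim _ _
    obtain rfl : dB = i₆ := Subsingleton.elim _ _
    obtain ⟨c, hc, h⟩ := ih
    exact ⟨c + 1, by omega,
      le_succ_mul_of_le_add h0 (stateDiv_hybridRun_useDec_le hΘ₁ hΘ₂ hδ P h𝒜 j) h⟩

theorem stateDiv_output_le_of_common_memory [Fintype X] [DecidableEq X] (hΘ₁ : Θ₁.IsValid)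
    (hΘ₂ : Θ₂.IsValid) (hδ : IsAmortizedBound Θ₁ Θ₂ δ) (h0 : 0 ≤ δ)
    (P : Protocol C A B D m 0 X) : stateDiv (P.output Θ₁) (P.output Θ₂) ≤ m * δ := by
  obtain ⟨c, rfl, h⟩ := stateDiv_hybridRun_le hΘ₁ hΘ₂ hδ h0 P
  have henc : (fun _ : Fin 0 => Θ₁.enc) = fun _ => Θ₂.enc := Subsingleton.elim _ _
  rwa [← stateDiv_relabel (isState_hybridRun hΘ₁ P fun _ => hΘ₁.1).1
    (isState_hybridRun hΘ₂ P fun _ => hΘ₁.1).1 (Equiv.prodUnique X (Fin 0 → S)),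
    hybridRun_const, henc, hybridRun_const] at h

end OutputDivergence

theorem stateDiv_output_le {C A B D S₁ S₂ X : Type} [Fintype C] [Nonempty C] [Fintype A]
    [Fintype B] [DecidableEq B] [Fintype D] [DecidableEq D] [Fintype S₁] [DecidableEq S₁]
    [Fintype S₂] [Fintype X] [DecidableEq X]
    {Θ₁ : Superchannel C A B D S₁} {Θ₂ : Superchannel C A B D S₂}
    (hΘ₁ : Θ₁.IsValid) (hΘ₂ : Θ₂.IsValid) {δ : EReal} (hδ : IsAmortizedBound Θ₁ Θ₂ δ)
    (h0 : 0 ≤ δ) {m : ℕ} (P : Protocol C A B D m 0 X) :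
    stateDiv (P.output Θ₁) (P.output Θ₂) ≤ m * δ := by
  classical
  obtain ⟨ρ, hρ⟩ := exists_isState C
  have : Nonempty S₁ := (hΘ₁.1.map_isState hρ).nonempty.map Prod.snd
  have : Nonempty S₂ := (hΘ₂.1.map_isState hρ).nonempty.map Prod.snd
  obtain ⟨τ₁, hτ₁⟩ := exists_isState S₁
  obtain ⟨τ₂, hτ₂⟩ := exists_isState S₂
  have h := stateDiv_output_le_of_common_memory (hΘ₁.pad (Equiv.refl (S₁ × S₂)) hτ₂)
    (hΘ₂.pad (Equiv.prodComm S₁ S₂) hτ₁) (hδ.pad hΘ₁ _ _ hτ₂ hτ₁) h0 P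
  rwa [output_pad Θ₁ _ hτ₂, output_pad Θ₂ _ hτ₁] at h

end Protocol

section Exponents

variable {C A B D S₁ S₂ : Type} [Fintype C] [Fintype A] [Fintype B] [Fintype D] [DecidableEq D]
  [Fintype S₁] [Fintype S₂] {Θ₁ : Superchannel C A B D S₁} {Θ₂ : Superchannel C A B D S₂}
  {p : ℝ} {n : ℕ}

theorem bestExponent_le_of_le {X : Type} [Fintype X] [DecidableEq X] {ρ σ : Op X}
    (hρ : IsState ρ) (hσ : IsState σ) (hp : 0 < p) (hp' : p < 1) {c : EReal}
    (h : ((1 / (n : ℝ) : ℝ) : EReal) * stateDiv ρ σ ≤ c) :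
    bestExponent n p ρ σ ≤ ((-(1 / (n : ℝ)) * Real.logb 2 (p * (1 - p)) : ℝ) : EReal) + c :=
  (bestExponent_le hρ hσ hp hp' n).trans (add_le_add_right h _)

theorem one_div_mul_le_one_div_mul {d d' : EReal} (h : d ≤ d') :
    ((1 / (n : ℝ) : ℝ) : EReal) * d ≤ ((1 / (n : ℝ) : ℝ) : EReal) * d' :=
  mul_le_mul_of_nonneg_left h (EReal.coe_nonneg.2 (by positivity))

theorem xiProduct_le (hΘ₁ : Θ₁.IsValid) (hΘ₂ : Θ₂.IsValid) (hp : 0 < p) (hp' : p < 1)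
    (hn : 1 ≤ n) :
    xiProduct n p Θ₁ Θ₂
      ≤ ((-(1 / (n : ℝ)) * Real.logb 2 (p * (1 - p)) : ℝ) : EReal) + superDiv Θ₁ Θ₂ := by
  refine iSup_le fun R => iSup_le fun _ => iSup_le fun _ => iSup_le fun R' => iSup_le fun _ =>
    iSup_le fun _ => iSup_le fun N => iSup_le fun hN => iSup_le fun ρ => iSup_le fun hρ => ?_
  have hout₁ := (hΘ₁.apply hN).map_isState hρ
  have hout₂ := (hΘ₂.apply hN).map_isState hρ
  refine bestExponent_le_of_le (hout₁.opPow n) (hout₂.opPow n) hp hp'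
    (one_div_mul_le_of_le_mul hn ?_)
  rw [stateDiv_opPow hout₁ hout₂]
  exact mul_le_mul_of_nonneg_left (le_superDiv Θ₁ Θ₂ hN hρ) (by positivity)

theorem xiParallelProductChannel_le [DecidableEq C] (hΘ₁ : Θ₁.IsValid) (hΘ₂ : Θ₂.IsValid)
    (hp : 0 < p) (hp' : p < 1) (hn : 1 ≤ n) :
    xiParallelProductChannel n p Θ₁ Θ₂
      ≤ ((-(1 / (n : ℝ)) * Real.logb 2 (p * (1 - p)) : ℝ) : EReal) + superDivStateReg Θ₁ Θ₂ := by
  refine iSup_le fun R => iSup_le fun _ => iSup_le fun _ => iSup_le fun R' => iSup_le fun _ =>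
    iSup_le fun _ => iSup_le fun E => iSup_le fun _ => iSup_le fun _ => iSup_le fun N =>
    iSup_le fun hN => iSup_le fun ρ => iSup_le fun hρ => ?_
  refine bestExponent_le_of_le ((((hΘ₁.apply hN).tensorPow n).tensorId E).map_isState hρ)
    ((((hΘ₂.apply hN).tensorPow n).tensorId E).map_isState hρ) hp hp' ?_
  exact (one_div_mul_le_one_div_mul (le_productChannelDiv Θ₁ Θ₂ hN hρ)).trans
    ((multiplesSuperadditive_productChannelDiv hΘ₁ hΘ₂).one_div_mul_le_liminf hn)

theorem xiParallelProductState_le [DecidableEq C] [DecidableEq B] [Nonempty B] [DecidableEq S₁]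
    [DecidableEq S₂] (hΘ₁ : Θ₁.IsValid) (hΘ₂ : Θ₂.IsValid) (hp : 0 < p) (hp' : p < 1) (hn : 1 ≤ n) :
    xiParallelProductState n p Θ₁ Θ₂
      ≤ ((-(1 / (n : ℝ)) * Real.logb 2 (p * (1 - p)) : ℝ) : EReal) + superDivChanReg Θ₁ Θ₂ := by
  refine iSup_le fun R => iSup_le fun _ => iSup_le fun _ => iSup_le fun R' => iSup_le fun _ =>
    iSup_le fun _ => iSup_le fun N => iSup_le fun hN => iSup_le fun ρ => iSup_le fun hρ => ?_
  refine bestExponent_le_of_le (isState_productStateOutput hΘ₁ hN hρ)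
    (isState_productStateOutput hΘ₂ hN hρ) hp hp' ?_
  exact (one_div_mul_le_one_div_mul (le_productStateDiv Θ₁ Θ₂ hN hρ)).trans
    ((multiplesSuperadditive_productStateDiv hΘ₁ hΘ₂).one_div_mul_le_liminf hn)

theorem xiParallel_le [DecidableEq C] [Nonempty C] [DecidableEq B] [Nonempty B] [DecidableEq S₁]
    [DecidableEq S₂] (hΘ₁ : Θ₁.IsValid) (hΘ₂ : Θ₂.IsValid) (hp : 0 < p) (hp' : p < 1) (hn : 1 ≤ n) :
    xiParallel n p Θ₁ Θ₂
      ≤ ((-(1 / (n : ℝ)) * Real.logb 2 (p * (1 - p)) : ℝ) : EReal) + superDivReg Θ₁ Θ₂ := by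
  refine iSup_le fun R => iSup_le fun _ => iSup_le fun _ => iSup_le fun R' => iSup_le fun _ =>
    iSup_le fun _ => iSup_le fun N => iSup_le fun hN => iSup_le fun ρ => iSup_le fun hρ => ?_
  refine bestExponent_le_of_le (((hΘ₁.pow n).apply hN).map_isState hρ)
    (((hΘ₂.pow n).apply hN).map_isState hρ) hp hp' ?_
  exact (one_div_mul_le_one_div_mul (le_superDiv _ _ hN hρ)).trans
    ((multiplesSuperadditive_superDiv_pow hΘ₁ hΘ₂).one_div_mul_le_liminf hn)

theorem xiSuccessive_le [DecidableEq C] (hΘ₁ : Θ₁.IsValid) (hΘ₂ : Θ₂.IsValid) (hp : 0 < p)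
    (hp' : p < 1) (hn : 1 ≤ n) :
    xiSuccessive n p Θ₁ Θ₂
      ≤ ((-(1 / (n : ℝ)) * Real.logb 2 (p * (1 - p)) : ℝ) : EReal) + superDivStateA Θ₁ Θ₂ := by
  refine iSup_le fun R => iSup_le fun _ => iSup_le fun _ => iSup_le fun R' => iSup_le fun _ =>
    iSup_le fun _ => iSup_le fun M => iSup_le fun _ => iSup_le fun _ => iSup_le fun N =>
    iSup_le fun hN => iSup_le fun ρ => iSup_le fun hρ => iSup_le fun 𝒜 => iSup_le fun h𝒜 => ?_
  have hout₁ := hΘ₁.apply hN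
  have hout₂ := hΘ₂.apply hN
  refine bestExponent_le_of_le (isState_seqOutput hout₁ hρ h𝒜 _)
    (isState_seqOutput hout₂ hρ h𝒜 _) hp hp' (one_div_mul_le_of_le_mul hn ?_)
  have h := stateDiv_seqOutput_le hout₁ hout₂ hρ h𝒜 (n - 1)
  rw [Nat.sub_add_cancel hn] at h
  refine h.trans (mul_le_mul_of_nonneg_left ?_ (by positivity))
  exact le_iSup_of_le R <| le_iSup_of_le inferInstance <| le_iSup_of_le inferInstance <|
    le_iSup_of_le R' <| le_iSup_of_le inferInstance <| le_iSup_of_le inferInstance <|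
    le_iSup_of_le N <| le_iSup_of_le hN le_rfl

theorem xiNested_le [DecidableEq C] [Nonempty C] [DecidableEq A] [Nonempty A] [DecidableEq B]
    [Nonempty B] (hΘ₁ : Θ₁.IsValid) (hΘ₂ : Θ₂.IsValid) (hp : 0 < p) (hp' : p < 1) (hn : 1 ≤ n) :
    xiNested n p Θ₁ Θ₂
      ≤ ((-(1 / (n : ℝ)) * Real.logb 2 (p * (1 - p)) : ℝ) : EReal) + superDivA Θ₁ Θ₂ := by
  refine iSup_le fun R => iSup_le fun _ => iSup_le fun _ => iSup_le fun ρ => iSup_le fun hρ =>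
    iSup_le fun mid => iSup_le fun hmid => iSup_le fun pre => iSup_le fun hpre =>
    iSup_le fun post => iSup_le fun hpost => ?_
  have : Nonempty R := hρ.nonempty.map Prod.snd
  have hout₁ := hΘ₁.nested hmid hpre hpost (n - 1)
  have hout₂ := hΘ₂.nested hmid hpre hpost (n - 1)
  refine bestExponent_le_of_le (hout₁.map_isState hρ) (hout₂.map_isState hρ) hp hp'
    (one_div_mul_le_of_le_mul hn ((stateDiv_map_le_chanDivA hout₁ hout₂ hρ).trans ?_))
  have h := chanDivA_nested_le hΘ₁ hΘ₂ hmid hpre hpost (n - 1)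
  rwa [Nat.sub_add_cancel hn] at h

theorem xiGeneral_le [Nonempty C] [DecidableEq B] [Nonempty B] [DecidableEq S₁]
    (hΘ₁ : Θ₁.IsValid) (hΘ₂ : Θ₂.IsValid) (hp : 0 < p) (hp' : p < 1) (hn : 1 ≤ n) :
    xiGeneral n p Θ₁ Θ₂
      ≤ ((-(1 / (n : ℝ)) * Real.logb 2 (p * (1 - p)) : ℝ) : EReal) + superDivAStar Θ₁ Θ₂ := by
  refine iSup_le fun X => iSup_le fun _ => iSup_le fun _ => iSup_le fun P => ?_
  have hδ := isAmortizedBound_superDivAStar hΘ₁ hΘ₂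
  exact bestExponent_le_of_le (Protocol.isState_output hΘ₁ P) (Protocol.isState_output hΘ₂ P) hp hp'
    (one_div_mul_le_of_le_mul hn
      (Protocol.stateDiv_output_le hΘ₁ hΘ₂ hδ (hδ.nonneg hΘ₁ hΘ₂) P))

end Exponents

end QND

theorem mainTheorem7 {C A B D S₁ S₂ : Type}
    [Fintype C] [DecidableEq C] [Nonempty C] [Fintype A] [DecidableEq A] [Nonempty A]
    [Fintype B] [DecidableEq B] [Nonempty B] [Fintype D] [DecidableEq D] [Nonempty D]
    [Fintype S₁] [DecidableEq S₁] [Fintype S₂] [DecidableEq S₂]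
    (Θ₁ : Superchannel C A B D S₁) (Θ₂ : Superchannel C A B D S₂)
    (hΘ₁ : Θ₁.IsValid) (hΘ₂ : Θ₂.IsValid) :
    (Filter.Tendsto (superDivStateSeq Θ₁ Θ₂) Filter.atTop (nhds (superDivStateReg Θ₁ Θ₂)) ∧
      Filter.Tendsto (superDivChanSeq Θ₁ Θ₂) Filter.atTop (nhds (superDivChanReg Θ₁ Θ₂)) ∧
      Filter.Tendsto (superDivSeq Θ₁ Θ₂) Filter.atTop (nhds (superDivReg Θ₁ Θ₂))) ∧
    ∀ (p : ℝ), 0 < p → p < 1 → ∀ n : ℕ, 1 ≤ n →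
      xiProduct n p Θ₁ Θ₂ ≤
        ((-(1 / (n : ℝ)) * Real.logb 2 (p * (1 - p)) : ℝ) : EReal) + superDiv Θ₁ Θ₂ ∧
      xiParallelProductChannel n p Θ₁ Θ₂ ≤
        ((-(1 / (n : ℝ)) * Real.logb 2 (p * (1 - p)) : ℝ) : EReal) + superDivStateReg Θ₁ Θ₂ ∧
      xiParallelProductState n p Θ₁ Θ₂ ≤
        ((-(1 / (n : ℝ)) * Real.logb 2 (p * (1 - p)) : ℝ) : EReal) + superDivChanReg Θ₁ Θ₂ ∧
      xiParallel n p Θ₁ Θ₂ ≤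
        ((-(1 / (n : ℝ)) * Real.logb 2 (p * (1 - p)) : ℝ) : EReal) + superDivReg Θ₁ Θ₂ ∧
      xiSuccessive n p Θ₁ Θ₂ ≤
        ((-(1 / (n : ℝ)) * Real.logb 2 (p * (1 - p)) : ℝ) : EReal) + superDivStateA Θ₁ Θ₂ ∧
      xiNested n p Θ₁ Θ₂ ≤
        ((-(1 / (n : ℝ)) * Real.logb 2 (p * (1 - p)) : ℝ) : EReal) + superDivA Θ₁ Θ₂ ∧
      xiGeneral n p Θ₁ Θ₂ ≤
        ((-(1 / (n : ℝ)) * Real.logb 2 (p * (1 - p)) : ℝ) : EReal) + superDivAStar Θ₁ Θ₂ := by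
  refine ⟨⟨?_, ?_, ?_⟩, fun p hp hp' n hn => ⟨?_, ?_, ?_, ?_, ?_, ?_, ?_⟩⟩
  · exact (multiplesSuperadditive_productChannelDiv hΘ₁ hΘ₂).tendsto
  · exact (multiplesSuperadditive_productStateDiv hΘ₁ hΘ₂).tendsto
  · exact (multiplesSuperadditive_superDiv_pow hΘ₁ hΘ₂).tendsto
  · exact xiProduct_le hΘ₁ hΘ₂ hp hp' hn
  · exact xiParallelProductChannel_le hΘ₁ hΘ₂ hp hp' hn
  · exact xiParallelProductState_le hΘ₁ hΘ₂ hp hp' hn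
  · exact xiParallel_le hΘ₁ hΘ₂ hp hp' hn
  · exact xiSuccessive_le hΘ₁ hΘ₂ hp hp' hn
  · exact xiNested_le hΘ₁ hΘ₂ hp hp' hn
  · exact xiGeneral_le hΘ₁ hΘ₂ hp hp' hn
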